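/- **Setting.** Let $n\ge 2$ and let $U\subset\mathbb R^n$ be a bounded domain with $C^1$ boundary $\Gamma$. Let $N\ge1$, $0=\alpha_0<\alpha_1<\dots<\alpha_N$ and $a=\frac{\alpha_N}{\alpha_N+1}\in(0,1)$. Let $\phi:U\to(0,1]$ (porosity) and $a_0,\dots,a_N\ge0$ be measurable on $U$, with $a_0,a_N>0$ and $a_N\in L^1(U)$. Put $g(x,s)=\sum_{j=0}^N a_j(x)s^{\alpha_j}$; for $\xi\ge0$ let $s(x,\xi)\ge 0$ be the unique solution of $s\,g(x,s)=\xi$, and $$K(x,\xi)=\frac1{g(x,s(x,\xi))},\qquad H(x,\xi)=\int_0^{\xi^2}K(x,\sqrt s)\,ds,\qquad W_1(x)=\frac{a_N(x)^a}{2N\max_j a_j(x)} .$$ For $f\ge0$ let $\|u\|_{L^p_f}=\big(\int_U f|u|^p dx\big)^{1/p}$. Say that $(u_k,\nabla u_k)$ converges to $(u,\nabla u)$ *in energy* if $\int_U\phi|u_k-u|^2dx+\int_U H(x,|\nabla u_k-\nabla u|)\,dx\to0$; all gradients are weak gradients of locally integrable functions. "$u=0$ on $\Gamma$" means that $u$ is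 a limit in energy of functions of $C_c^\infty(U)$. Time derivatives of functions of $(x,t)$ are limits of difference quotients in energy (one-sided at $t=0$). *Boundary data.* $\Psi$ is an admissible extension of boundary data if it has a time derivative $\Psi_t$ at every $t\ge0$, and the quantities $$G[\Psi](t)=\max\Big\{\int_U a_N dx,1\Big\}+\int_U a_0^{-1}|\nabla\Psi|^2dx+\int_U W_1|\nabla\Psi|^{2-a}dx+\Big(\int_U|\Psi_t|^2\phi\,dx\Big)^{\frac{2-a}{2(1-a)}},$$ $$G_1[\Psi](t)=\int_U a_0^{-1}|\nabla\Psi_t|^2dx$$ are finite and continuous on $[0,\infty)$. Let $\mathcal M[\Psi]$ denote any continuous increasing function on $[0,\infty)$ with $\mathcal M[\Psi](t)\ge G[\Psi](t)$ for all $t\ge0$. *Solutions.* $p$ is a solution of $$\phi\,p_t=\nabla\cdot\big(K(x,|\nabla p|)\nabla p\big)\ \text{ in }U\times(0,\infty),\qquad p=\Psi\ \text{ on }\Gamma\times(0,\infty),$$ if $\int_U\phi|p-\Psi|^2dx$ and $\int_U H(x,|\nabla p|)dx$ are finite for all $t\ge0$; $p$ is continuous in energy at $t=0$ and has a time derivative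 $p_t$ at every $t>0$; for every $t>0$ the flux $K(x,|\nabla p|)\nabla p$ is locally integrable in $U$ and the equation holds in the sense of distributions in $U$; and $p-\Psi=0$ on $\Gamma$ for every $t>0$. For $i=1,2$ let $\Psi_i$ be admissible and $p_i$ a solution with $p_i=\Psi_i$ on $\Gamma$. Put $\bar p_i=p_i-\Psi_i$, $\bar P=\bar p_1-\bar p_2$, $\Phi=\Psi_1-\Psi_2$ and $$D(t)=\int_U a_0^{-1}|\nabla\Phi|^2dx+\Big(\int_U a_0^{-1}|\nabla\Phi|^2dx\Big)^{1/2}+\Big(\int_U|\Phi_t|^2\phi\,dx\Big)^{1/2},$$ and assume that $D$ is continuous on $[0,\infty)$. Assume that, with a constant $c_P>0$, the weighted Poincaré–Sobolev inequality $$\Big(\int_U|u|^2\phi\,dx\Big)^{1/2}\le c_P\Big(\int_U W_1|\nabla u|^{2-a}dx\Big)^{\frac1{2-a}}$$ holds for $u=\bar p_1(t),\ \bar p_2(t),\ \bar P(t)$, $t>0$. Finally let $$\mathcal M_1(t)=\sum_{i=1}^2\int_U H(x,|\nabla p_i(x,0)|)dx+\sum_{i=1}^2\int_U\bar p_i(x,0)^2\phi\,dx+\Big(\sum_{i=1}^2\mathcal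 M[\Psi_i](t)\Big)^{\frac2{2-a}}+\sup_{\tau\in[0,t]}\sum_{i=1}^2G_1[\Psi_i](\tau).$$ **Theorem (continuous dependence on the initial and boundary data).** There are constants $C,d_4>0$, depending only on $n$, $U$, $N$, the exponents $\alpha_j$ and $c_P$ (not on $\phi$, the $a_j$, or the initial and boundary data), such that for all $t\ge0$ $$\|\bar P(t)\|_{L^2_\phi}^2\le e^{-d_4\int_0^t\mathcal M_1(\tau)^{-\frac a{2-a}}d\tau}\|\bar P(0)\|_{L^2_\phi}^2+C\int_0^t e^{-d_4\int_s^t\mathcal M_1(\tau)^{-\frac a{2-a}}d\tau}\mathcal M_1(s)^{1/2}D(s)\,ds .$$ In particular, for every $T>0$, $$\sup_{t\in[0,T]}\|\bar P(t)\|_{L^2_\phi}^2\le\|\bar P(0)\|_{L^2_\phi}^2+C\,\mathcal M_1(T)^{1/2}\int_0^T D(t)\,dt .$$ -/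

import Mathlib

open MeasureTheory Set Filter Topology
open scoped ENNReal ContDiff

noncomputable section

namespace Forchheimer

/-- The space `ℝⁿ` with its Euclidean norm. -/
abbrev Space (n : ℕ) := EuclideanSpace ℝ (Fin n)

variable {n N : ℕ}

/-- A bounded domain (nonempty, open, connected) with `C¹` boundary: near every boundary point
`U` is the sublevel set `{ρ < 0}` of a `C¹` function `ρ` whose differential does not vanish. -/
structure IsBoundedC1Domain (U : Set (Space n)) : Prop where
  isOpen : IsOpen U
  isConnected : IsConnected U
  isBounded : Bornology.IsBounded U
  boundary : ∀ x₀ ∈ frontier U, ∃ V : Set (Space n), IsOpen V ∧ x₀ ∈ V ∧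
    ∃ ρ : Space n → ℝ, ContDiff ℝ 1 ρ ∧ ρ x₀ = 0 ∧ fderiv ℝ ρ x₀ ≠ 0 ∧
      U ∩ V = {x ∈ V | ρ x < 0}

/-! ### The generalized Forchheimer polynomial and the functions derived from it -/

/-- The exponents of a generalized polynomial: `0 = α₀ < α₁ < ⋯ < α_N`, with `N ≥ 1`. -/
structure IsExponents (α : Fin (N + 1) → ℝ) : Prop where
  one_le : 1 ≤ N
  zero : α 0 = 0
  strictMono : StrictMono α

/-- The porosity `φ` and the coefficients `a₀, …, a_N` of a heterogeneous porous medium in `U`. -/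
structure IsMedium (U : Set (Space n)) (φ : Space n → ℝ) (a : Fin (N + 1) → Space n → ℝ) :
    Prop where
  porosity_measurable : AEMeasurable φ (volume.restrict U)
  porosity_pos : ∀ x ∈ U, 0 < φ x
  porosity_le_one : ∀ x ∈ U, φ x ≤ 1
  coeff_measurable : ∀ j, AEMeasurable (a j) (volume.restrict U)
  coeff_nonneg : ∀ j, ∀ x ∈ U, 0 ≤ a j x
  coeff_zero_pos : ∀ x ∈ U, 0 < a 0 x
  coeff_last_pos : ∀ x ∈ U, 0 < a (Fin.last N) x
  coeff_last_integrable : IntegrableOn (a (Fin.last N)) U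

/-- `g(x,s) = a₀(x) s^{α₀} + ⋯ + a_N(x) s^{α_N}`. -/
def g (α : Fin (N + 1) → ℝ) (a : Fin (N + 1) → Space n → ℝ) (x : Space n) (s : ℝ) : ℝ :=
  ∑ j, a j x * s ^ α j

/-- `s(x,ξ)`, the unique nonnegative solution `s` of `s g(x,s) = ξ`
(see `speed_spec`, `eq_speed`). -/
def speed (α : Fin (N + 1) → ℝ) (a : Fin (N + 1) → Space n → ℝ) (x : Space n) (ξ : ℝ) : ℝ :=
  sInf {s : ℝ | 0 ≤ s ∧ s * g α a x s = ξ}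

/-- `K(x,ξ) = 1 / g(x, s(x,ξ))`. -/
def K (α : Fin (N + 1) → ℝ) (a : Fin (N + 1) → Space n → ℝ) (x : Space n) (ξ : ℝ) : ℝ :=
  1 / g α a x (speed α a x ξ)

/-- `H(x,ξ) = ∫₀^{ξ²} K(x,√s) ds`. -/
def H (α : Fin (N + 1) → ℝ) (a : Fin (N + 1) → Space n → ℝ) (x : Space n) (ξ : ℝ) : ℝ :=
  ∫ s in (0 : ℝ)..(ξ ^ 2), K α a x (Real.sqrt s)

/-- The exponent `a = α_N / (α_N + 1)`. -/
def expo (α : Fin (N + 1) → ℝ) : ℝ := α (Fin.last N) / (α (Fin.last N) + 1)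

/-- `M(x) = max_j a_j(x)`. -/
def maxCoeff (a : Fin (N + 1) → Space n → ℝ) (x : Space n) : ℝ :=
  Finset.univ.sup' Finset.univ_nonempty (fun j => a j x)

/-- The weight `W₁(x) = a_N(x)^a / (2 N M(x))`. -/
def W₁ (α : Fin (N + 1) → ℝ) (a : Fin (N + 1) → Space n → ℝ) (x : Space n) : ℝ :=
  a (Fin.last N) x ^ expo α / (2 * N * maxCoeff a x)

/-! ### Well-posedness of the definition of `s(x,ξ)` -/

theorem strictMonoOn_mul_g {α : Fin (N + 1) → ℝ} (hα : IsExponents α) {U : Set (Space n)}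
    {φ : Space n → ℝ} {a : Fin (N + 1) → Space n → ℝ} (ha : IsMedium U φ a) {x : Space n}
    (hx : x ∈ U) : StrictMonoOn (fun s => s * g α a x s) (Ici 0) := by
  have hα0 : ∀ j, 0 ≤ α j := fun j => hα.zero ▸ hα.strictMono.monotone (Fin.zero_le j)
  have hg : ∀ s t : ℝ, 0 ≤ s → s ≤ t → g α a x s ≤ g α a x t := fun s t hs hst =>
    Finset.sum_le_sum fun j _ =>
      mul_le_mul_of_nonneg_left (Real.rpow_le_rpow hs hst (hα0 j)) (ha.coeff_nonneg j x hx)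
  have hpos : ∀ s : ℝ, 0 ≤ s → 0 < g α a x s := fun s hs => by
    have h0 : a 0 x * s ^ α 0 ≤ g α a x s :=
      Finset.single_le_sum (f := fun j => a j x * s ^ α j)
        (fun j _ => mul_nonneg (ha.coeff_nonneg j x hx) (Real.rpow_nonneg hs _))
        (Finset.mem_univ 0)
    rw [hα.zero, Real.rpow_zero, mul_one] at h0
    exact (ha.coeff_zero_pos x hx).trans_le h0
  intro s hs t ht hst
  have hs' : (0 : ℝ) ≤ s := hs
  exact mul_lt_mul hst (hg s t hs' hst.le) (hpos s hs') ht

/-- `s(x,ξ)` is a nonnegative solution of `s g(x,s) = ξ`, for `x ∈ U` and `ξ ≥ 0`. -/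
theorem speed_spec {α : Fin (N + 1) → ℝ} (hα : IsExponents α) {U : Set (Space n)}
    {φ : Space n → ℝ} {a : Fin (N + 1) → Space n → ℝ} (ha : IsMedium U φ a) {x : Space n}
    (hx : x ∈ U) {ξ : ℝ} (hξ : 0 ≤ ξ) :
    0 ≤ speed α a x ξ ∧ speed α a x ξ * g α a x (speed α a x ξ) = ξ := by
  have hα0 : ∀ j, 0 ≤ α j := fun j => hα.zero ▸ hα.strictMono.monotone (Fin.zero_le j)
  have hmono := strictMonoOn_mul_g hα ha hx
  have hcont : Continuous (fun s => s * g α a x s) := by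
    refine continuous_id.mul (continuous_finsetSum _ fun j _ => ?_)
    exact continuous_const.mul (Real.continuous_rpow_const (hα0 j))
  have ha0 := ha.coeff_zero_pos x hx
  have hb : 0 ≤ ξ / a 0 x := div_nonneg hξ ha0.le
  have htop : ξ ≤ ξ / a 0 x * g α a x (ξ / a 0 x) := by
    have h0 : a 0 x * (ξ / a 0 x) ^ α 0 ≤ g α a x (ξ / a 0 x) :=
      Finset.single_le_sum (f := fun j => a j x * (ξ / a 0 x) ^ α j)
        (fun j _ => mul_nonneg (ha.coeff_nonneg j x hx) (Real.rpow_nonneg hb _))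
        (Finset.mem_univ 0)
    rw [hα.zero, Real.rpow_zero, mul_one] at h0
    calc ξ = ξ / a 0 x * a 0 x := (div_mul_cancel₀ ξ ha0.ne').symm
      _ ≤ _ := mul_le_mul_of_nonneg_left h0 hb
  obtain ⟨s, hs, hsξ⟩ := intermediate_value_Icc hb hcont.continuousOn
    (show ξ ∈ Icc ((0 : ℝ) * g α a x 0) (ξ / a 0 x * g α a x (ξ / a 0 x)) from
      ⟨by simpa using hξ, htop⟩)
  have hset : {s : ℝ | 0 ≤ s ∧ s * g α a x s = ξ} = {s} := by
    ext t
    refine ⟨fun ht => hmono.injOn ht.1 hs.1 (ht.2.trans hsξ.symm), ?_⟩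
    rintro rfl
    exact ⟨hs.1, hsξ⟩
  have : speed α a x ξ = s := by rw [speed, hset, csInf_singleton]
  rw [this]
  exact ⟨hs.1, hsξ⟩

/-- `s(x,ξ)` is the only nonnegative solution of `s g(x,s) = ξ`. -/
theorem eq_speed {α : Fin (N + 1) → ℝ} (hα : IsExponents α) {U : Set (Space n)}
    {φ : Space n → ℝ} {a : Fin (N + 1) → Space n → ℝ} (ha : IsMedium U φ a) {x : Space n}
    (hx : x ∈ U) {s : ℝ} (hs : 0 ≤ s) : speed α a x (s * g α a x s) = s := by
  have hg : 0 ≤ g α a x s := Finset.sum_nonneg fun j _ =>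
    mul_nonneg (ha.coeff_nonneg j x hx) (Real.rpow_nonneg hs _)
  have h := speed_spec hα ha hx (mul_nonneg hs hg)
  exact (strictMonoOn_mul_g hα ha hx).injOn h.1 hs h.2

/-! ### Weak gradients, energy, boundary values -/

/-- `η ∈ C_c^∞(U)`. -/
def IsTestFunction (U : Set (Space n)) (η : Space n → ℝ) : Prop :=
  ContDiff ℝ ∞ η ∧ HasCompactSupport η ∧ tsupport η ⊆ U

/-- `F` is the weak gradient of `u` in `U`. -/
structure HasWeakGradient (U : Set (Space n)) (u : Space n → ℝ) (F : Space n → Space n) :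
    Prop where
  locallyIntegrable : LocallyIntegrableOn u U
  locallyIntegrable_grad : LocallyIntegrableOn F U
  integral_eq : ∀ η, IsTestFunction U η → ∀ v : Space n,
    ∫ x in U, u x * fderiv ℝ η x v = -∫ x in U, inner ℝ (F x) v * η x

/-- `∫_U φ u² dx + ∫_U H(x,|F|) dx`, with values in `[0,∞]`. Convergence to `0` of this
quantity is convergence in the energy space (`L²_φ` for functions and the Musielak–Orlicz space
of `H` for gradients). -/
def energy (U : Set (Space n)) (φ : Space n → ℝ) (α : Fin (N + 1) → ℝ)
    (a : Fin (N + 1) → Space n → ℝ) (u : Space n → ℝ) (F : Space n → Space n) : ℝ≥0∞ :=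
  (∫⁻ x in U, ENNReal.ofReal (φ x * u x ^ 2)) + ∫⁻ x in U, ENNReal.ofReal (H α a x ‖F x‖)

/-- `u = 0` on `∂U`: the function `u`, with weak gradient `F`, belongs to the closure of
`C_c^∞(U)` in the energy space. -/
def VanishesOnBoundary (U : Set (Space n)) (φ : Space n → ℝ) (α : Fin (N + 1) → ℝ)
    (a : Fin (N + 1) → Space n → ℝ) (u : Space n → ℝ) (F : Space n → Space n) : Prop :=
  HasWeakGradient U u F ∧ ∀ ε : ℝ≥0∞, 0 < ε → ∃ η, IsTestFunction U η ∧
    energy U φ α a (fun x => u x - η x) (fun x => F x - gradient η x) < ε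

/-- The norm of `L^p_f(U)`: `(∫_U f |u|^p dx)^{1/p}`. -/
def weightedNorm (U : Set (Space n)) (f : Space n → ℝ) (p : ℝ) (u : Space n → ℝ) : ℝ :=
  (∫ x in U, f x * |u x| ^ p) ^ (1 / p)

/-- The two-weight Poincaré–Sobolev inequality with constant `c` for the function `u` with
gradient `F`: `(∫_U |u|² φ)^{1/2} ≤ c (∫_U W₁ |∇u|^{2-a})^{1/(2-a)}`. -/
def PoincareSobolev (U : Set (Space n)) (φ : Space n → ℝ) (α : Fin (N + 1) → ℝ)
    (a : Fin (N + 1) → Space n → ℝ) (c : ℝ) (u : Space n → ℝ) (F : Space n → Space n) : Prop :=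
  weightedNorm U φ 2 u ≤ c * weightedNorm U (W₁ α a) (2 - expo α) (fun x => ‖F x‖)

/-! ### Functions of space and time -/

/-- Representatives of a function `u(x,t)`, of `∇u`, of `u_t` and of `∇u_t`, as functions of `t`
and `x`. That the last three are the derivatives is required in `IsBoundaryData` and
`IsSolution`. -/
structure Evolution (n : ℕ) where
  /-- `u` -/
  val : ℝ → Space n → ℝ
  /-- `∇u` -/
  grad : ℝ → Space n → Space n
  /-- `u_t` -/
  dt : ℝ → Space n → ℝ
  /-- `∇u_t` -/
  gradDt : ℝ → Space n → Space n

instance : Sub (Evolution n) where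
  sub u v :=
    { val := fun t x => u.val t x - v.val t x
      grad := fun t x => u.grad t x - v.grad t x
      dt := fun t x => u.dt t x - v.dt t x
      gradDt := fun t x => u.gradDt t x - v.gradDt t x }

/-- At time `t`, the function `u : [0,∞) → energy space` has the derivative `u_t`, with gradient
`∇u_t` (a one-sided derivative if `t = 0`). -/
def HasTimeDerivAt (U : Set (Space n)) (φ : Space n → ℝ) (α : Fin (N + 1) → ℝ)
    (a : Fin (N + 1) → Space n → ℝ) (u : Evolution n) (t : ℝ) : Prop :=
  Tendsto (fun s => energy U φ α a
      (fun x => (s - t)⁻¹ * (u.val s x - u.val t x) - u.dt t x)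
      (fun x => (s - t)⁻¹ • (u.grad s x - u.grad t x) - u.gradDt t x))
    (𝓝[Ici 0 \ {t}] t) (𝓝 0)

/-- `B_* = max{∫_U a_N dx, 1}`. -/
def Bstar (U : Set (Space n)) (a : Fin (N + 1) → Space n → ℝ) : ℝ :=
  max (∫ x in U, a (Fin.last N) x) 1

/-- `G[Ψ](t) = B_* + ∫ a₀⁻¹|∇Ψ|² + ∫ W₁|∇Ψ|^{2-a} + (∫ |Ψ_t|² φ)^{(2-a)/(2(1-a))}`. -/
def G (U : Set (Space n)) (φ : Space n → ℝ) (α : Fin (N + 1) → ℝ)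
    (a : Fin (N + 1) → Space n → ℝ) (Ψ : Evolution n) (t : ℝ) : ℝ :=
  Bstar U a + (∫ x in U, (a 0 x)⁻¹ * ‖Ψ.grad t x‖ ^ 2)
    + (∫ x in U, W₁ α a x * ‖Ψ.grad t x‖ ^ (2 - expo α))
    + (∫ x in U, Ψ.dt t x ^ 2 * φ x) ^ ((2 - expo α) / (2 * (1 - expo α)))

/-- `G₁[Ψ](t) = ∫ a₀⁻¹|∇Ψ_t|²`. -/
def G₁ (U : Set (Space n)) (a : Fin (N + 1) → Space n → ℝ) (Ψ : Evolution n) (t : ℝ) : ℝ :=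
  ∫ x in U, (a 0 x)⁻¹ * ‖Ψ.gradDt t x‖ ^ 2

/-- `D(t) = ∫ a₀⁻¹|∇Φ|² + (∫ a₀⁻¹|∇Φ|²)^{1/2} + (∫ |Φ_t|² φ)^{1/2}`. -/
def D (U : Set (Space n)) (φ : Space n → ℝ) (a : Fin (N + 1) → Space n → ℝ)
    (Φ : Evolution n) (t : ℝ) : ℝ :=
  (∫ x in U, (a 0 x)⁻¹ * ‖Φ.grad t x‖ ^ 2)
    + (∫ x in U, (a 0 x)⁻¹ * ‖Φ.grad t x‖ ^ 2) ^ (1 / 2 : ℝ)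
    + (∫ x in U, Φ.dt t x ^ 2 * φ x) ^ (1 / 2 : ℝ)

/-- `Ψ` is an admissible extension to `U × [0,∞)` of boundary data: it is differentiable in time,
and the quantities `G[Ψ]` and `G₁[Ψ]` are finite and continuous on `[0,∞)`. -/
structure IsBoundaryData (U : Set (Space n)) (φ : Space n → ℝ) (α : Fin (N + 1) → ℝ)
    (a : Fin (N + 1) → Space n → ℝ) (Ψ : Evolution n) : Prop where
  weakGradient : ∀ t, 0 ≤ t → HasWeakGradient U (Ψ.val t) (Ψ.grad t)
  weakGradient_dt : ∀ t, 0 ≤ t → HasWeakGradient U (Ψ.dt t) (Ψ.gradDt t)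
  hasTimeDeriv : ∀ t, 0 ≤ t → HasTimeDerivAt U φ α a Ψ t
  integrable_grad_sq : ∀ t, 0 ≤ t → IntegrableOn (fun x => (a 0 x)⁻¹ * ‖Ψ.grad t x‖ ^ 2) U
  integrable_grad_rpow : ∀ t, 0 ≤ t →
    IntegrableOn (fun x => W₁ α a x * ‖Ψ.grad t x‖ ^ (2 - expo α)) U
  integrable_dt_sq : ∀ t, 0 ≤ t → IntegrableOn (fun x => Ψ.dt t x ^ 2 * φ x) U
  integrable_gradDt_sq : ∀ t, 0 ≤ t →
    IntegrableOn (fun x => (a 0 x)⁻¹ * ‖Ψ.gradDt t x‖ ^ 2) U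
  continuousOn_G : ContinuousOn (G U φ α a Ψ) (Ici 0)
  continuousOn_G₁ : ContinuousOn (G₁ U a Ψ) (Ici 0)

/-- `p` is a solution of `φ p_t = ∇ · (K(x,|∇p|) ∇p)` on `U × (0,∞)` with `p = Ψ` on
`∂U × (0,∞)`, continuous on `[0,∞)` and differentiable on `(0,∞)` as a function of time with
values in the energy space. -/
structure IsSolution (U : Set (Space n)) (φ : Space n → ℝ) (α : Fin (N + 1) → ℝ)
    (a : Fin (N + 1) → Space n → ℝ) (Ψ p : Evolution n) : Prop where
  weakGradient : ∀ t, 0 ≤ t → HasWeakGradient U (p.val t) (p.grad t)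
  weakGradient_dt : ∀ t, 0 < t → HasWeakGradient U (p.dt t) (p.gradDt t)
  integrable_sq : ∀ t, 0 ≤ t → IntegrableOn (fun x => φ x * (p - Ψ).val t x ^ 2) U
  integrable_H : ∀ t, 0 ≤ t → IntegrableOn (fun x => H α a x ‖p.grad t x‖) U
  continuous_zero : Tendsto (fun t => energy U φ α a
      (fun x => p.val t x - p.val 0 x) (fun x => p.grad t x - p.grad 0 x)) (𝓝[>] 0) (𝓝 0)
  hasTimeDeriv : ∀ t, 0 < t → HasTimeDerivAt U φ α a p t
  flux_locallyIntegrable : ∀ t, 0 < t →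
    LocallyIntegrableOn (fun x => K α a x ‖p.grad t x‖ • p.grad t x) U
  equation : ∀ t, 0 < t → ∀ η, IsTestFunction U η →
    ∫ x in U, φ x * p.dt t x * η x
      = -∫ x in U, inner ℝ (K α a x ‖p.grad t x‖ • p.grad t x) (gradient η x)
  boundary : ∀ t, 0 < t → VanishesOnBoundary U φ α a ((p - Ψ).val t) ((p - Ψ).grad t)

/-- `𝓜` is a continuous increasing function on `[0,∞)` with `𝓜 ≥ G[Ψ]`. -/
structure IsMajorant (U : Set (Space n)) (φ : Space n → ℝ) (α : Fin (N + 1) → ℝ)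
    (a : Fin (N + 1) → Space n → ℝ) (Ψ : Evolution n) (M : ℝ → ℝ) : Prop where
  continuousOn : ContinuousOn M (Ici 0)
  monotoneOn : MonotoneOn M (Ici 0)
  le : ∀ t, 0 ≤ t → G U φ α a Ψ t ≤ M t

/-- `𝓜₁(t) = 𝓗₀ + 𝓟₀ + (𝓜[Ψ₁](t) + 𝓜[Ψ₂](t))^{2/(2-a)} + sup_{[0,t]} (G₁[Ψ₁] + G₁[Ψ₂])`,
where `𝓗₀ = ∑ᵢ ∫ H(x,|∇pᵢ(x,0)|)` and `𝓟₀ = ∑ᵢ ∫ (pᵢ - Ψᵢ)²(x,0) φ`. -/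
def bigM₁ (U : Set (Space n)) (φ : Space n → ℝ) (α : Fin (N + 1) → ℝ)
    (a : Fin (N + 1) → Space n → ℝ) (p Ψ : Fin 2 → Evolution n) (M : Fin 2 → ℝ → ℝ)
    (t : ℝ) : ℝ :=
  (∑ i, ∫ x in U, H α a x ‖(p i).grad 0 x‖)
    + (∑ i, ∫ x in U, (p i - Ψ i).val 0 x ^ 2 * φ x)
    + (∑ i, M i t) ^ (2 / (2 - expo α))
    + sSup ((fun τ => ∑ i, G₁ U a (Ψ i) τ) '' Icc 0 t)

end Forchheimer

end

/-!
Put `y(t) = ∫ φ P̄²`. Testing the equation of each solution with `P̄` gives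

`y' = -2 ∫ (K₁∇p₁ - K₂∇p₂) · ∇P̄ - 2 ∫ φ P̄ Φ_t`.

The flux `K(x,|y|) y` is strongly monotone with constant `(1-a) K(x, max(|y|,|z|))`
(`inner_flux_sub_ge`), so up to terms in `∇Φ` and `Φ_t` the right side is at most
`-(1-a) ∫ K_max |∇P̄|²`, where `K_max` is the conductivity at the larger of the two pressure gradients
(`deriv_sq_diff_le`). The pointwise bound `W₁_le`, Hölder's inequality and the Poincaré–Sobolev
inequality turn this integral into a damping term `y (∫ (a_N + H₁ + H₂))^{-a/(2-a)}`
(`sq_diff_le_dissipation`), with `Hᵢ = H(x,|∇pᵢ|)`. Grönwall's inequality then gives the estimate,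
once `∫ φ (pᵢ - Ψᵢ)²` and `∫ Hᵢ` are known to be bounded by a multiple of `𝓜₁`.

These a priori bounds (`exists_totalEnergy_le`) come from testing the equation with `p - Ψ` and with
`p_t - Ψ_t`. The first gives an inequality for `∫ φ (p - Ψ)²`, which by the Poincaré–Sobolev inequality
decreases wherever it is large compared with `G[Ψ]^{2/(2-a)}`; the second controls the growth of
`∫ H(x,|∇p|)`. In the sum of the two, the dissipation of the first absorbs this growth.

The solutions are only differentiable in time in the sense of the energy, and the flux need not be
integrable against arbitrary gradients, so testing and differentiating have to be justified. Both
parts of the energy, `φ u²` and `H(x,|F|)`, are convex densities `Θ` with gradient `2ψ` that satisfy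

`0 ≤ Θ(z) - Θ(y) - 2 ψ(y)·(z - y) ≤ 8 Θ(z - y)`, `|ψ(y)·z| ≤ δ Θ(y) + δ⁻¹ Θ(z)` and
`Θ(hy) ≤ 2 h^{2-a} Θ(y)` for `0 < h ≤ 1`.

The structure `IsModular` records these properties. The first and third make `∫ Θ` differentiable along
curves that are differentiable in energy (`IsModular.hasDerivAt_integral`); the second makes the weak
form continuous in energy, so that it extends from test functions to `p - Ψ` and, through difference
quotients, to `p_t - Ψ_t`. All of this rests on elementary properties of `K`: it decreases in `ξ`,
`K(x,ξ) ξ = s(x,ξ)` increases, and `h^a K(x,hξ) ≤ K(x,ξ)` for `0 < h ≤ 1` (`K_scale`).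
-/

namespace Forchheimer

/-! ### The conductivity `K` -/

section

variable {n N : ℕ} {α : Fin (N + 1) → ℝ} {U : Set (Space n)} {φ : Space n → ℝ}
  {a : Fin (N + 1) → Space n → ℝ} {x : Space n}

theorem IsExponents.nonneg (hα : IsExponents α) (j : Fin (N + 1)) : 0 ≤ α j :=
  hα.zero ▸ hα.strictMono.monotone (Fin.zero_le j)

theorem IsExponents.last_pos (hα : IsExponents α) : 0 < α (Fin.last N) := by
  have h := hα.one_le
  have : (0 : Fin (N + 1)) < Fin.last N := by
    rw [Fin.lt_def]; simp; omega
  simpa [hα.zero] using hα.strictMono this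

theorem expo_pos (hα : IsExponents α) : 0 < expo α := by
  have := hα.last_pos
  unfold expo; positivity

theorem expo_lt_one (hα : IsExponents α) : expo α < 1 := by
  have := hα.last_pos
  unfold expo
  rw [div_lt_one (by positivity)]; linarith

theorem coeff_mul_le_g (ha : IsMedium U φ a) (hx : x ∈ U) {s : ℝ} (hs : 0 ≤ s)
    (j : Fin (N + 1)) : a j x * s ^ α j ≤ g α a x s :=
  Finset.single_le_sum (f := fun j => a j x * s ^ α j)
    (fun j _ => mul_nonneg (ha.coeff_nonneg j x hx) (Real.rpow_nonneg hs _))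
    (Finset.mem_univ _)

theorem coeff_zero_le_g (hα : IsExponents α) (ha : IsMedium U φ a) (hx : x ∈ U) {s : ℝ}
    (hs : 0 ≤ s) : a 0 x ≤ g α a x s := by
  simpa [hα.zero] using coeff_mul_le_g (α := α) ha hx hs 0

theorem g_pos (hα : IsExponents α) (ha : IsMedium U φ a) (hx : x ∈ U) {s : ℝ} (hs : 0 ≤ s) :
    0 < g α a x s :=
  (ha.coeff_zero_pos x hx).trans_le (coeff_zero_le_g hα ha hx hs)

theorem g_mono (hα : IsExponents α) (ha : IsMedium U φ a) (hx : x ∈ U) {s t : ℝ} (hs : 0 ≤ s)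
    (hst : s ≤ t) : g α a x s ≤ g α a x t :=
  Finset.sum_le_sum fun j _ =>
    mul_le_mul_of_nonneg_left (Real.rpow_le_rpow hs hst (hα.nonneg j)) (ha.coeff_nonneg j x hx)

theorem speed_nonneg (hα : IsExponents α) (ha : IsMedium U φ a) (hx : x ∈ U) {ξ : ℝ}
    (hξ : 0 ≤ ξ) : 0 ≤ speed α a x ξ := (speed_spec hα ha hx hξ).1

theorem speed_mono (hα : IsExponents α) (ha : IsMedium U φ a) (hx : x ∈ U) {ξ ζ : ℝ}
    (hξ : 0 ≤ ξ) (h : ξ ≤ ζ) : speed α a x ξ ≤ speed α a x ζ := by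
  have h1 := speed_spec hα ha hx hξ
  have h2 := speed_spec hα ha hx (hξ.trans h)
  refine ((strictMonoOn_mul_g hα ha hx).le_iff_le h1.1 h2.1).1 ?_
  simp only [h1.2, h2.2, h]

theorem K_pos (hα : IsExponents α) (ha : IsMedium U φ a) (hx : x ∈ U) {ξ : ℝ}
    (hξ : 0 ≤ ξ) : 0 < K α a x ξ :=
  one_div_pos.2 (g_pos hα ha hx (speed_nonneg hα ha hx hξ))

theorem K_anti (hα : IsExponents α) (ha : IsMedium U φ a) (hx : x ∈ U) {ξ ζ : ℝ}
    (hξ : 0 ≤ ξ) (h : ξ ≤ ζ) : K α a x ζ ≤ K α a x ξ :=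
  one_div_le_one_div_of_le (g_pos hα ha hx (speed_nonneg hα ha hx hξ))
    (g_mono hα ha hx (speed_nonneg hα ha hx hξ) (speed_mono hα ha hx hξ h))

/-- The scalar flux `K(x,ξ) ξ` is the speed `s(x,ξ)`. -/
theorem K_mul_eq_speed (hα : IsExponents α) (ha : IsMedium U φ a) (hx : x ∈ U) {ξ : ℝ}
    (hξ : 0 ≤ ξ) : K α a x ξ * ξ = speed α a x ξ := by
  have h := speed_spec hα ha hx hξ
  have hg := g_pos hα ha hx h.1
  unfold K
  nth_rw 2 [← h.2]
  field_simp

theorem K_mul_mono (hα : IsExponents α) (ha : IsMedium U φ a) (hx : x ∈ U) {ξ ζ : ℝ}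
    (hξ : 0 ≤ ξ) (h : ξ ≤ ζ) : K α a x ξ * ξ ≤ K α a x ζ * ζ := by
  rw [K_mul_eq_speed hα ha hx hξ, K_mul_eq_speed hα ha hx (hξ.trans h)]
  exact speed_mono hα ha hx hξ h

theorem K_le_inv (hα : IsExponents α) (ha : IsMedium U φ a) (hx : x ∈ U) {ξ : ℝ}
    (hξ : 0 ≤ ξ) : K α a x ξ ≤ (a 0 x)⁻¹ := by
  rw [← one_div]
  exact one_div_le_one_div_of_le (ha.coeff_zero_pos x hx)
    (coeff_zero_le_g hα ha hx (speed_nonneg hα ha hx hξ))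

/-- `K(x,·)` grows at most like the power `-a` towards the origin: with `s = s(x,ξ)`,
`s' = s(x,hξ)` and `r = g(x,s') / g(x,s)` one has `s'/s = h/r`, and `r ≥ (s'/s)^{α_N}` because all
exponents of `g` are at most `α_N`; hence `r ≥ h^a`. -/
theorem K_scale (hα : IsExponents α) (ha : IsMedium U φ a) (hx : x ∈ U) {ξ h : ℝ}
    (hξ : 0 ≤ ξ) (h0 : 0 < h) (h1 : h ≤ 1) :
    h ^ expo α * K α a x (h * ξ) ≤ K α a x ξ := by
  rcases hξ.eq_or_lt with rfl | hξ
  · rw [mul_zero]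
    exact mul_le_of_le_one_left (K_pos hα ha hx le_rfl).le
      (Real.rpow_le_one h0.le h1 (expo_pos hα).le)
  have hhξ : 0 < h * ξ := mul_pos h0 hξ
  obtain ⟨hs, hsg⟩ := speed_spec hα ha hx hξ.le
  obtain ⟨ht, htg⟩ := speed_spec hα ha hx hhξ.le
  have hts : speed α a x (h * ξ) ≤ speed α a x ξ :=
    speed_mono hα ha hx hhξ.le (mul_le_of_le_one_left hξ.le h1)
  unfold K
  set s := speed α a x ξ
  set t := speed α a x (h * ξ)
  have hgs := g_pos hα ha hx hs
  have hgt := g_pos hα ha hx ht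
  have hs0 : 0 < s := hs.lt_of_ne (by rintro h'; rw [← h'] at hsg; simp at hsg; linarith)
  have ht0 : 0 < t := ht.lt_of_ne (by rintro h'; rw [← h'] at htg; simp at htg; grind)
  set r := g α a x t / g α a x s with hr
  have hr0 : 0 < r := div_pos hgt hgs
  have hrr : t / s = h / r := by
    rw [hr]; field_simp; rw [htg, ← hsg]; ring
  have key : (t / s) ^ α (Fin.last N) * g α a x s ≤ g α a x t := by
    unfold g
    rw [Finset.mul_sum]
    refine Finset.sum_le_sum fun j _ => ?_
    have : (t / s) ^ α (Fin.last N) * s ^ α j ≤ t ^ α j := by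
      calc (t / s) ^ α (Fin.last N) * s ^ α j ≤ (t / s) ^ α j * s ^ α j := by
            refine mul_le_mul_of_nonneg_right ?_ (by positivity)
            exact Real.rpow_le_rpow_of_exponent_ge (by positivity) ((div_le_one hs0).2 hts)
              (hα.strictMono.monotone (Fin.le_last j))
        _ = t ^ α j := by
            rw [← Real.mul_rpow (by positivity) hs0.le, div_mul_cancel₀ _ hs0.ne']
    calc _ = a j x * ((t / s) ^ α (Fin.last N) * s ^ α j) := by ring
      _ ≤ _ := mul_le_mul_of_nonneg_left this (ha.coeff_nonneg j x hx)
  have key2 : (h / r) ^ α (Fin.last N) ≤ r := by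
    rw [← hrr, hr, le_div_iff₀ hgs]; exact key
  have hN := hα.last_pos
  have key3 : h ^ expo α ≤ r := by
    rw [Real.div_rpow h0.le hr0.le, div_le_iff₀ (by positivity)] at key2
    have h2 : r * r ^ α (Fin.last N) = r ^ (α (Fin.last N) + 1) := by
      rw [Real.rpow_add_one hr0.ne', mul_comm]
    rw [h2] at key2
    calc h ^ expo α = (h ^ α (Fin.last N)) ^ (1 / (α (Fin.last N) + 1)) := by
          rw [← Real.rpow_mul h0.le, expo]; congr 1; ring
      _ ≤ (r ^ (α (Fin.last N) + 1)) ^ (1 / (α (Fin.last N) + 1)) :=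
          Real.rpow_le_rpow (by positivity) key2 (by positivity)
      _ = r := by
          rw [← Real.rpow_mul hr0.le, mul_one_div_cancel (by positivity), Real.rpow_one]
  rw [hr, le_div_iff₀ hgs] at key3
  rw [mul_one_div, div_le_div_iff₀ hgt hgs]
  linarith

theorem maxCoeff_pos (ha : IsMedium U φ a) (hx : x ∈ U) : 0 < maxCoeff a x :=
  (ha.coeff_zero_pos x hx).trans_le
    (Finset.le_sup' (fun j => a j x) (Finset.mem_univ 0))

theorem le_maxCoeff (a : Fin (N + 1) → Space n → ℝ) (x : Space n) (j : Fin (N + 1)) :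
    a j x ≤ maxCoeff a x :=
  Finset.le_sup' (fun j => a j x) (Finset.mem_univ j)

theorem W₁_nonneg (ha : IsMedium U φ a) (hx : x ∈ U) : 0 ≤ W₁ α a x := by
  have := maxCoeff_pos ha hx
  have := ha.coeff_last_pos x hx
  unfold W₁; positivity

theorem g_le_max (hα : IsExponents α) (ha : IsMedium U φ a) (hx : x ∈ U) {s b : ℝ}
    (hs : 0 ≤ s) (hb : ∀ j, s ^ α j ≤ b) (hb0 : 0 ≤ b) :
    g α a x s / (2 * N * maxCoeff a x) ≤ b := by
  have hM := maxCoeff_pos ha hx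
  have hN : (1 : ℝ) ≤ N := by exact_mod_cast hα.one_le
  rw [div_le_iff₀ (by positivity)]
  calc g α a x s ≤ ∑ _j : Fin (N + 1), maxCoeff a x * b :=
        Finset.sum_le_sum fun j _ => mul_le_mul (le_maxCoeff a x j) (hb j)
          (Real.rpow_nonneg hs _) hM.le
    _ = (N + 1) * (maxCoeff a x * b) := by simp
    _ ≤ (2 * N) * (maxCoeff a x * b) := by gcongr; linarith
    _ = _ := by ring

/-- The lower bound on the conductivity that links the weight `W₁` to the energy. It splits at
`s = 1`, where `s = s(x,ξ)`: for `s ≥ 1` the term `Kξ²` suffices, for `s ≤ 1` the term `a_N`. -/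
theorem W₁_le (hα : IsExponents α) (ha : IsMedium U φ a) (hx : x ∈ U) {ξ : ℝ} (hξ : 0 ≤ ξ) :
    W₁ α a x ≤ K α a x ξ ^ ((2 - expo α) / 2) *
      (a (Fin.last N) x + K α a x ξ * ξ ^ 2) ^ (expo α / 2) := by
  have he0 := expo_pos hα
  have he1 := expo_lt_one hα
  obtain ⟨hs, hsg⟩ := speed_spec hα ha hx hξ
  have hg := g_pos hα ha hx hs
  have hK := K_pos hα ha hx hξ
  have hM := maxCoeff_pos ha hx
  have hAN := ha.coeff_last_pos x hx
  have hN : (1 : ℝ) ≤ N := by exact_mod_cast hα.one_le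
  have hNpos := hα.last_pos
  have hKg : K α a x ξ * g α a x (speed α a x ξ) = 1 := by
    unfold K; field_simp
  have main : W₁ α a x * g α a x (speed α a x ξ) ≤
      (a (Fin.last N) x * g α a x (speed α a x ξ) + ξ ^ 2) ^ (expo α / 2) := by
    set s := speed α a x ξ
    set G := g α a x s with hG
    set q := G / (2 * N * maxCoeff a x) with hq
    have hW : W₁ α a x * G = a (Fin.last N) x ^ expo α * q := by
      rw [W₁, hq]; ring
    rw [hW]
    rcases le_total 1 s with h1 | h1
    · have hqs : q ≤ s ^ α (Fin.last N) := g_le_max hα ha hx hs (fun j =>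
        Real.rpow_le_rpow_of_exponent_le h1 (hα.strictMono.monotone (Fin.le_last j)))
        (by positivity)
      have hs0 : 0 < s := by linarith
      have e1 : s ^ α (Fin.last N) = (s ^ (α (Fin.last N) + 1)) ^ expo α := by
        rw [← Real.rpow_mul hs, expo]; congr 1; field_simp
      calc a (Fin.last N) x ^ expo α * q
          ≤ a (Fin.last N) x ^ expo α * s ^ α (Fin.last N) := by gcongr
        _ = (a (Fin.last N) x * s ^ (α (Fin.last N) + 1)) ^ expo α := by
            rw [e1, ← Real.mul_rpow hAN.le (by positivity)]
        _ ≤ ξ ^ expo α := by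
            refine Real.rpow_le_rpow (by positivity) ?_ he0.le
            rw [← hsg, Real.rpow_add_one hs0.ne']
            have := coeff_mul_le_g (α := α) ha hx hs (Fin.last N)
            nlinarith
        _ = (ξ ^ 2) ^ (expo α / 2) := by
            rw [← Real.rpow_natCast ξ 2, ← Real.rpow_mul hξ]; congr 1; push_cast; ring
        _ ≤ _ := Real.rpow_le_rpow (by positivity) (by nlinarith) (by positivity)
    · have hq1 : q ≤ 1 := g_le_max hα ha hx hs (fun j =>
        Real.rpow_le_one hs h1 (hα.nonneg j)) zero_le_one
      have hq0 : 0 < q := by positivity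
      calc a (Fin.last N) x ^ expo α * q
          ≤ a (Fin.last N) x ^ expo α * q ^ (expo α / 2) := by
            refine mul_le_mul_of_nonneg_left ?_ (by positivity)
            exact Real.self_le_rpow_of_le_one hq0.le hq1 (by linarith)
        _ = (a (Fin.last N) x ^ 2 * q) ^ (expo α / 2) := by
            rw [Real.mul_rpow (by positivity) hq0.le, ← Real.rpow_natCast _ 2,
              ← Real.rpow_mul hAN.le]
            congr 2; push_cast; ring
        _ ≤ _ := by
            refine Real.rpow_le_rpow (by positivity) ?_ (by positivity)
            have hr : a (Fin.last N) x / (2 * N * maxCoeff a x) ≤ 1 := by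
              rw [div_le_one (by positivity)]
              have := le_maxCoeff a x (Fin.last N)
              nlinarith
            calc a (Fin.last N) x ^ 2 * q
                = (a (Fin.last N) x * G) * (a (Fin.last N) x / (2 * N * maxCoeff a x)) := by
                  rw [hq]; ring
              _ ≤ (a (Fin.last N) x * G) * 1 := by gcongr
              _ ≤ _ := by nlinarith [sq_nonneg ξ]
  calc W₁ α a x = K α a x ξ * (W₁ α a x * g α a x (speed α a x ξ)) := by
        rw [mul_left_comm, hKg, mul_one]
    _ ≤ K α a x ξ * (a (Fin.last N) x * g α a x (speed α a x ξ) + ξ ^ 2) ^ (expo α / 2) := by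
        gcongr
    _ = K α a x ξ ^ ((2 - expo α) / 2) * (K α a x ξ ^ (expo α / 2) *
          (a (Fin.last N) x * g α a x (speed α a x ξ) + ξ ^ 2) ^ (expo α / 2)) := by
        rw [← mul_assoc, ← Real.rpow_add hK]
        congr 1
        rw [show (2 - expo α) / 2 + expo α / 2 = 1 by ring, Real.rpow_one]
    _ = _ := by
        rw [← Real.mul_rpow hK.le (by positivity)]
        congr 2
        rw [mul_add, mul_left_comm, hKg, mul_one]

theorem W₁_mul_rpow_le (hα : IsExponents α) (ha : IsMedium U φ a) (hx : x ∈ U) {ξ ζ : ℝ}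
    (hξ : 0 ≤ ξ) (hζ : 0 ≤ ζ) :
    W₁ α a x * ζ ^ (2 - expo α) ≤ (K α a x ξ * ζ ^ 2) ^ ((2 - expo α) / 2) *
      (a (Fin.last N) x + K α a x ξ * ξ ^ 2) ^ (1 - (2 - expo α) / 2) := by
  have hK := K_pos hα ha hx hξ
  rw [Real.mul_rpow hK.le (by positivity), ← Real.rpow_natCast ζ 2, ← Real.rpow_mul hζ,
    show ((2 : ℕ) : ℝ) * ((2 - expo α) / 2) = 2 - expo α by push_cast; ring,
    show 1 - (2 - expo α) / 2 = expo α / 2 by ring, mul_right_comm]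
  exact mul_le_mul_of_nonneg_right (W₁_le hα ha hx hξ) (by positivity)

end

/-! ### The energy density `H` -/

section

variable {n N : ℕ} {α : Fin (N + 1) → ℝ} {U : Set (Space n)} {φ : Space n → ℝ}
  {a : Fin (N + 1) → Space n → ℝ} {x : Space n}

theorem H_zero : H α a x 0 = 0 := by simp [H]

theorem intervalIntegrable_K_sqrt (hα : IsExponents α) (ha : IsMedium U φ a) (hx : x ∈ U)
    (b c : ℝ) : IntervalIntegrable (fun s => K α a x (Real.sqrt s)) volume b c := by
  refine Antitone.intervalIntegrable fun s t hst => ?_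
  exact K_anti hα ha hx (Real.sqrt_nonneg s) (Real.sqrt_le_sqrt hst)

/-- The derivative of `H(x,·)` at `ξ` is `2K(x,ξ)ξ`; this is the resulting convexity inequality.
It follows from `K(x,√s) √s` being increasing in `s`, which bounds the integrand of `H` by
`K(x,ξ) ξ / √s` from below beyond `ξ²` and from above before it. -/
theorem H_sub_ge (hα : IsExponents α) (ha : IsMedium U φ a) (hx : x ∈ U) {ξ ζ : ℝ}
    (hξ : 0 ≤ ξ) (hζ : 0 ≤ ζ) :
    2 * (K α a x ξ * ξ) * (ζ - ξ) ≤ H α a x ζ - H α a x ξ := by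
  have hint := intervalIntegrable_K_sqrt hα ha hx
  have hsub : H α a x ζ - H α a x ξ = ∫ s in (ξ ^ 2)..(ζ ^ 2), K α a x (Real.sqrt s) := by
    rw [H, H, intervalIntegral.integral_interval_sub_left (hint _ _) (hint _ _)]
  have hpow : ∀ b c : ℝ, 0 ≤ b → 0 ≤ c →
      ∫ s in (b ^ 2)..(c ^ 2), K α a x ξ * ξ * s ^ (-(1 / 2) : ℝ) =
        2 * (K α a x ξ * ξ) * (c - b) := by
    intro b c hb hc
    have e : ∀ y : ℝ, 0 ≤ y → (y ^ 2) ^ (1 / 2 : ℝ) = y := fun y hy => by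
      rw [← Real.sqrt_eq_rpow, Real.sqrt_sq hy]
    rw [intervalIntegral.integral_const_mul, integral_rpow (Or.inl (by norm_num)),
      show (-(1 / 2) : ℝ) + 1 = 1 / 2 by norm_num, e b hb, e c hc]
    ring
  have hpowint : ∀ b c : ℝ, IntervalIntegrable
      (fun s => K α a x ξ * ξ * s ^ (-(1 / 2) : ℝ)) volume b c := fun b c =>
    (intervalIntegral.intervalIntegrable_rpow' (by norm_num)).const_mul _
  have hsq : ∀ s : ℝ, 0 < s → s ^ (-(1 / 2) : ℝ) = (Real.sqrt s)⁻¹ := fun s hs => by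
    rw [Real.rpow_neg hs.le, Real.sqrt_eq_rpow]
  rcases le_total ξ ζ with h | h
  · rw [hsub, ← hpow ξ ζ hξ hζ]
    refine intervalIntegral.integral_mono_on_of_le_Ioo (by gcongr) (hpowint _ _) (hint _ _) ?_
    intro s hs
    have hs0 : 0 < s := (sq_nonneg ξ).trans_lt hs.1
    rw [hsq s hs0, ← div_eq_mul_inv, div_le_iff₀ (Real.sqrt_pos.2 hs0)]
    exact K_mul_mono hα ha hx hξ (Real.le_sqrt_of_sq_le hs.1.le)
  · have hle : ∫ s in (ζ ^ 2)..(ξ ^ 2), K α a x (Real.sqrt s) ≤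
        2 * (K α a x ξ * ξ) * (ξ - ζ) := by
      rw [← hpow ζ ξ hζ hξ]
      refine intervalIntegral.integral_mono_on_of_le_Ioo (by gcongr) (hint _ _) (hpowint _ _) ?_
      intro s hs
      have hs0 : 0 < s := (sq_nonneg ζ).trans_lt hs.1
      rw [hsq s hs0, ← div_eq_mul_inv, le_div_iff₀ (Real.sqrt_pos.2 hs0)]
      refine K_mul_mono hα ha hx (Real.sqrt_nonneg s) ?_
      rw [Real.sqrt_le_left hξ]; exact hs.2.le
    rw [hsub, intervalIntegral.integral_symm]
    linarith

theorem H_le_two_mul (hα : IsExponents α) (ha : IsMedium U φ a) (hx : x ∈ U) {ξ : ℝ}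
    (hξ : 0 ≤ ξ) : H α a x ξ ≤ 2 * (K α a x ξ * ξ ^ 2) := by
  have := H_sub_ge hα ha hx hξ le_rfl
  rw [H_zero] at this
  nlinarith

theorem le_H (hα : IsExponents α) (ha : IsMedium U φ a) (hx : x ∈ U) {ξ : ℝ}
    (hξ : 0 ≤ ξ) : K α a x ξ * ξ ^ 2 ≤ H α a x ξ := by
  have : ∫ _s in (0 : ℝ)..(ξ ^ 2), K α a x ξ ≤ H α a x ξ := by
    refine intervalIntegral.integral_mono_on_of_le_Ioo (by positivity)
      intervalIntegrable_const (intervalIntegrable_K_sqrt hα ha hx _ _) ?_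
    intro s hs
    refine K_anti hα ha hx (Real.sqrt_nonneg s) ?_
    rw [Real.sqrt_le_left hξ]; exact hs.2.le
  simpa [mul_comm] using this

theorem H_nonneg (hα : IsExponents α) (ha : IsMedium U φ a) (hx : x ∈ U) {ξ : ℝ}
    (hξ : 0 ≤ ξ) : 0 ≤ H α a x ξ := by
  have := K_pos hα ha hx hξ
  exact le_trans (by positivity) (le_H hα ha hx hξ)

theorem H_mono (hα : IsExponents α) (ha : IsMedium U φ a) (hx : x ∈ U) {ξ ζ : ℝ}
    (hξ : 0 ≤ ξ) (h : ξ ≤ ζ) : H α a x ξ ≤ H α a x ζ := by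
  have := H_sub_ge hα ha hx hξ (hξ.trans h)
  have hK := K_pos hα ha hx hξ
  have : 0 ≤ 2 * (K α a x ξ * ξ) * (ζ - ξ) := by
    have := sub_nonneg.2 h
    positivity
  linarith

theorem H_le_inv (hα : IsExponents α) (ha : IsMedium U φ a) (hx : x ∈ U) {ξ : ℝ}
    (hξ : 0 ≤ ξ) : H α a x ξ ≤ 2 * ((a 0 x)⁻¹ * ξ ^ 2) := by
  have := K_le_inv hα ha hx hξ
  exact (H_le_two_mul hα ha hx hξ).trans (by gcongr)

theorem H_scale_le_one (hα : IsExponents α) (ha : IsMedium U φ a) (hx : x ∈ U) {ξ h : ℝ}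
    (hξ : 0 ≤ ξ) (h0 : 0 < h) (h1 : h ≤ 1) :
    H α a x (h * ξ) ≤ 2 * h ^ (2 - expo α) * H α a x ξ := by
  have h2 := K_scale hα ha hx hξ h0 h1
  have h3 := H_le_two_mul hα ha hx (mul_nonneg h0.le hξ)
  have h4 := le_H hα ha hx hξ
  have e : h ^ 2 = h ^ (2 - expo α) * h ^ expo α := by
    rw [← Real.rpow_add h0]; norm_num
  calc H α a x (h * ξ) ≤ 2 * (K α a x (h * ξ) * (h * ξ) ^ 2) := h3
    _ = 2 * h ^ (2 - expo α) * (h ^ expo α * K α a x (h * ξ) * ξ ^ 2) := by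
        rw [mul_pow, e]; ring
    _ ≤ 2 * h ^ (2 - expo α) * (K α a x ξ * ξ ^ 2) := by gcongr
    _ ≤ _ := by gcongr

theorem H_scale_one_le (hα : IsExponents α) (ha : IsMedium U φ a) (hx : x ∈ U) {ξ h : ℝ}
    (hξ : 0 ≤ ξ) (h1 : 1 ≤ h) : H α a x (h * ξ) ≤ 2 * h ^ 2 * H α a x ξ := by
  have h3 := H_le_two_mul hα ha hx (mul_nonneg (zero_le_one.trans h1) hξ)
  have h4 := le_H hα ha hx hξ
  have h5 : K α a x (h * ξ) ≤ K α a x ξ :=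
    K_anti hα ha hx hξ (le_mul_of_one_le_left hξ h1)
  calc H α a x (h * ξ) ≤ 2 * (K α a x (h * ξ) * (h * ξ) ^ 2) := h3
    _ ≤ 2 * (K α a x ξ * (h * ξ) ^ 2) := by gcongr
    _ = 2 * h ^ 2 * (K α a x ξ * ξ ^ 2) := by ring
    _ ≤ _ := by gcongr

theorem H_norm_smul_le (hα : IsExponents α) (ha : IsMedium U φ a) (hx : x ∈ U) (c : ℝ)
    (y : Space n) : H α a x ‖c • y‖ ≤ 2 * (1 + c ^ 2) * H α a x ‖y‖ := by
  have hH := H_nonneg hα ha hx (norm_nonneg y)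
  rw [norm_smul, Real.norm_eq_abs]
  rcases le_total |c| 1 with h | h
  · have := H_mono hα ha hx (by positivity) (mul_le_of_le_one_left (norm_nonneg y) h)
    nlinarith [mul_nonneg (sq_nonneg c) hH]
  · have := H_scale_one_le hα ha hx (norm_nonneg y) h
    rw [sq_abs] at this
    nlinarith

theorem H_norm_sub_le (hα : IsExponents α) (ha : IsMedium U φ a) (hx : x ∈ U)
    (y z : Space n) : H α a x ‖y - z‖ ≤ 8 * (H α a x ‖y‖ + H α a x ‖z‖) := by
  have hy := H_nonneg hα ha hx (norm_nonneg y)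
  have hz := H_nonneg hα ha hx (norm_nonneg z)
  have hsub := norm_sub_le y z
  rcases le_total ‖y‖ ‖z‖ with h | h
  · have h1 := H_mono hα ha hx (norm_nonneg _) (show ‖y - z‖ ≤ 2 * ‖z‖ by linarith)
    have h2 := H_scale_one_le hα ha hx (norm_nonneg z) one_le_two
    linarith
  · have h1 := H_mono hα ha hx (norm_nonneg _) (show ‖y - z‖ ≤ 2 * ‖y‖ by linarith)
    have h2 := H_scale_one_le hα ha hx (norm_nonneg y) one_le_two
    linarith

/-! ### The flux `K(x,|y|) y` -/

/-- The flux `K(x,|y|) y`, as a function of `y`. -/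
noncomputable def flux (α : Fin (N + 1) → ℝ) (a : Fin (N + 1) → Space n → ℝ) (x : Space n) (y : Space n) :
    Space n := K α a x ‖y‖ • y

theorem norm_flux (hα : IsExponents α) (ha : IsMedium U φ a) (hx : x ∈ U) (y : Space n) :
    ‖flux α a x y‖ = K α a x ‖y‖ * ‖y‖ := by
  rw [flux, norm_smul, Real.norm_eq_abs, abs_of_pos (K_pos hα ha hx (norm_nonneg y))]

theorem inner_flux_self (y : Space n) :
    inner ℝ (flux α a x y) y = K α a x ‖y‖ * ‖y‖ ^ 2 := by
  rw [flux, real_inner_smul_left, real_inner_self_eq_norm_sq]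

theorem H_norm_sub_ge (hα : IsExponents α) (ha : IsMedium U φ a) (hx : x ∈ U) (y z : Space n) :
    2 * inner ℝ (flux α a x y) (z - y) ≤ H α a x ‖z‖ - H α a x ‖y‖ := by
  have h := H_sub_ge hα ha hx (norm_nonneg y) (norm_nonneg z)
  have hK := K_pos hα ha hx (norm_nonneg y)
  rw [inner_sub_right, inner_flux_self, flux, real_inner_smul_left]
  have := mul_le_mul_of_nonneg_left (real_inner_le_norm y z) hK.le
  nlinarith

/-- Young's inequality for the complementary pair `K(x,ξ)ξ`, `ζ`: compare `ζ` with `δξ`. -/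
theorem K_mul_mul_le (hα : IsExponents α) (ha : IsMedium U φ a) (hx : x ∈ U) {ξ ζ δ : ℝ}
    (hξ : 0 ≤ ξ) (hζ : 0 ≤ ζ) (hδ : 0 < δ) (hδ1 : δ ≤ 1) :
    K α a x ξ * ξ * ζ ≤ δ * H α a x ξ + δ⁻¹ * H α a x ζ := by
  have h1 := le_H hα ha hx hξ
  have h2 := le_H hα ha hx hζ
  have h3 := H_nonneg hα ha hx hξ
  have h4 := H_nonneg hα ha hx hζ
  have hK := K_pos hα ha hx hξ
  rcases le_total ζ (δ * ξ) with h | h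
  · have : K α a x ξ * ξ * ζ ≤ δ * H α a x ξ := by
      calc K α a x ξ * ξ * ζ ≤ K α a x ξ * ξ * (δ * ξ) := by gcongr
        _ = δ * (K α a x ξ * ξ ^ 2) := by ring
        _ ≤ _ := by gcongr
    have : 0 ≤ δ⁻¹ * H α a x ζ := by positivity
    linarith
  · have h5 : K α a x ξ * ξ ≤ K α a x ζ * (δ⁻¹ * ζ) := by
      have hle : ξ ≤ δ⁻¹ * ζ := by rwa [inv_mul_eq_div, le_div_iff₀' hδ]
      have hle2 : ζ ≤ δ⁻¹ * ζ := le_mul_of_one_le_left hζ ((one_le_inv₀ hδ).2 hδ1)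
      calc K α a x ξ * ξ ≤ K α a x (δ⁻¹ * ζ) * (δ⁻¹ * ζ) := K_mul_mono hα ha hx hξ hle
        _ ≤ _ := mul_le_mul_of_nonneg_right (K_anti hα ha hx hζ hle2) (by positivity)
    have : K α a x ξ * ξ * ζ ≤ δ⁻¹ * H α a x ζ := by
      calc K α a x ξ * ξ * ζ ≤ K α a x ζ * (δ⁻¹ * ζ) * ζ := by gcongr
        _ = δ⁻¹ * (K α a x ζ * ζ ^ 2) := by ring
        _ ≤ _ := by gcongr
    have : 0 ≤ δ * H α a x ξ := by positivity
    linarith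

theorem abs_inner_flux_le (hα : IsExponents α) (ha : IsMedium U φ a) (hx : x ∈ U)
    (y z : Space n) {δ : ℝ} (hδ : 0 < δ) (hδ1 : δ ≤ 1) :
    |inner ℝ (flux α a x y) z| ≤ δ * H α a x ‖y‖ + δ⁻¹ * H α a x ‖z‖ := by
  refine (abs_real_inner_le_norm _ _).trans ?_
  rw [norm_flux hα ha hx]
  exact K_mul_mul_le hα ha hx (norm_nonneg _) (norm_nonneg _) hδ hδ1

/-- The flux is continuous with modulus `4K(x,d)d`. For `|z| ≤ |y|` write the increment
as `K(|y|)(y - z) + (K(|y|) - K(|z|)) z`; monotonicity of `K(ξ)ξ` bounds the second term by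
`K(|y|)|y - z|` as well, and `|y - z| ≤ 2|y|`. -/
theorem norm_flux_sub_le (hα : IsExponents α) (ha : IsMedium U φ a) (hx : x ∈ U)
    (y z : Space n) :
    ‖flux α a x y - flux α a x z‖ ≤ 4 * (K α a x ‖y - z‖ * ‖y - z‖) := by
  wlog h : ‖z‖ ≤ ‖y‖ generalizing y z
  · rw [norm_sub_rev, norm_sub_rev y z]
    exact this z y (le_of_not_ge h)
  have hKy := K_pos hα ha hx (norm_nonneg y)
  have hd : ‖y‖ - ‖z‖ ≤ ‖y - z‖ := norm_sub_norm_le y z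
  have h1 := K_mul_mono hα ha hx (norm_nonneg z) h
  have h2 := K_anti hα ha hx (norm_nonneg z) h
  have e : flux α a x y - flux α a x z
      = K α a x ‖y‖ • (y - z) + (K α a x ‖y‖ - K α a x ‖z‖) • z := by
    unfold flux; module
  have h3 : ‖flux α a x y - flux α a x z‖ ≤ 2 * (K α a x ‖y‖ * ‖y - z‖) := by
    rw [e]
    refine (norm_add_le _ _).trans ?_
    rw [norm_smul, norm_smul, Real.norm_eq_abs, Real.norm_eq_abs, abs_of_pos hKy,
      abs_of_nonpos (by linarith)]
    nlinarith
  have hd0 := norm_nonneg (y - z)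
  have h4 : K α a x ‖y‖ ≤ K α a x (‖y - z‖ / 2) := by
    refine K_anti hα ha hx (by positivity) ?_
    linarith [norm_sub_le y z]
  have h5 := K_mul_mono hα ha hx (show 0 ≤ ‖y - z‖ / 2 by positivity)
    (show ‖y - z‖ / 2 ≤ ‖y - z‖ by linarith)
  nlinarith

theorem H_norm_sub_le_add (hα : IsExponents α) (ha : IsMedium U φ a) (hx : x ∈ U)
    (y z : Space n) :
    H α a x ‖z‖ - H α a x ‖y‖ ≤
      2 * inner ℝ (flux α a x y) (z - y) + 8 * H α a x ‖z - y‖ := by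
  have h1 := H_norm_sub_ge hα ha hx z y
  have h2 := le_H hα ha hx (norm_nonneg (z - y))
  have h3 : inner ℝ (flux α a x z - flux α a x y) (z - y) ≤ 4 * H α a x ‖z - y‖ := by
    refine (real_inner_le_norm _ _).trans ?_
    have := mul_le_mul_of_nonneg_right (norm_flux_sub_le hα ha hx z y) (norm_nonneg (z - y))
    nlinarith
  rw [inner_sub_left] at h3
  rw [← neg_sub z y, inner_neg_right] at h1
  linarith

/-- Strong monotonicity of the flux. Splitting off the angle between `y` and `z` reduces it to the
scalar inequality `K(ξ)ξ - K(ζ)ζ ≥ (1-a) K(ξ)(ξ - ζ)` for `ζ ≤ ξ`, a consequence of `K_scale` and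
Bernoulli's inequality. -/
theorem inner_flux_sub_ge (hα : IsExponents α) (ha : IsMedium U φ a) (hx : x ∈ U)
    (y z : Space n) :
    (1 - expo α) * (K α a x (max ‖y‖ ‖z‖) * ‖y - z‖ ^ 2) ≤
      inner ℝ (flux α a x y - flux α a x z) (y - z) := by
  wlog h : ‖z‖ ≤ ‖y‖ generalizing y z
  · have := this z y (le_of_not_ge h)
    rwa [max_comm, norm_sub_rev, ← neg_sub (flux α a x y), ← neg_sub y z, inner_neg_neg] at this
  rw [max_eq_left h]
  have he0 := expo_pos hα
  have he1 := expo_lt_one hα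
  set ky := K α a x ‖y‖ with hky
  set kz := K α a x ‖z‖ with hkz
  have hKy : 0 < ky := K_pos hα ha hx (norm_nonneg y)
  have h2 : ky ≤ kz := K_anti hα ha hx (norm_nonneg z) h
  have hsc : (1 - expo α) * (ky * (‖y‖ - ‖z‖)) ≤ ky * ‖y‖ - kz * ‖z‖ := by
    rcases (norm_nonneg z).eq_or_lt with hz | hz
    · rw [← hz]
      have : 0 ≤ ky * ‖y‖ := by positivity
      nlinarith
    have hy : 0 < ‖y‖ := hz.trans_le h
    set r := ‖z‖ / ‖y‖ with hr
    have hr0 : 0 < r := by positivity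
    have hr1 : r ≤ 1 := (div_le_one hy).2 h
    have hzr : ‖z‖ = r * ‖y‖ := by rw [hr]; field_simp
    have h3 : r ^ expo α * kz ≤ ky := by
      have := K_scale hα ha hx (norm_nonneg y) hr0 hr1
      rwa [← hzr] at this
    have e : r = r ^ (1 - expo α) * r ^ expo α := by
      rw [← Real.rpow_add hr0]; simp
    have h4 : kz * ‖z‖ ≤ r ^ (1 - expo α) * (ky * ‖y‖) := by
      calc kz * ‖z‖ = r ^ (1 - expo α) * (r ^ expo α * kz * ‖y‖) := by
            rw [hzr]; nth_rw 1 [e]; ring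
        _ ≤ _ := by gcongr
    have h5 : r ^ (1 - expo α) ≤ 1 + (1 - expo α) * (r - 1) := by
      have := rpow_one_add_le_one_add_mul_self (s := r - 1) (by linarith)
        (p := 1 - expo α) (by linarith) (by linarith)
      simpa using this
    have h6 := mul_le_mul_of_nonneg_right h5 (show 0 ≤ ky * ‖y‖ by positivity)
    rw [hzr]
    rw [hzr] at h4
    nlinarith
  have hin := real_inner_le_norm y z
  have e1 : inner ℝ (flux α a x y - flux α a x z) (y - z) =
      (ky * ‖y‖ - kz * ‖z‖) * (‖y‖ - ‖z‖) + (ky + kz) * (‖y‖ * ‖z‖ - inner ℝ y z) := by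
    unfold flux
    simp only [inner_sub_left, inner_sub_right, real_inner_smul_left,
      real_inner_self_eq_norm_sq, ← hky, ← hkz, real_inner_comm y z]
    ring
  have e2 : ‖y - z‖ ^ 2 = (‖y‖ - ‖z‖) ^ 2 + 2 * (‖y‖ * ‖z‖ - inner ℝ y z) := by
    rw [norm_sub_sq_real]; ring
  rw [e1, e2]
  have t1 := mul_le_mul_of_nonneg_right hsc (sub_nonneg.2 h)
  have hw : 0 ≤ ‖y‖ * ‖z‖ - inner ℝ y z := sub_nonneg.2 hin
  have t2 : (1 - expo α) * (ky * (2 * (‖y‖ * ‖z‖ - inner ℝ y z))) ≤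
      (ky + kz) * (‖y‖ * ‖z‖ - inner ℝ y z) := by
    have : (1 - expo α) * ky ≤ ky := mul_le_of_le_one_left hKy.le (by linarith)
    nlinarith
  nlinarith

end

/-! ### Measurability -/

section

variable {n N : ℕ} {α : Fin (N + 1) → ℝ} {U : Set (Space n)} {φ : Space n → ℝ}
  {a : Fin (N + 1) → Space n → ℝ} {x : Space n}

/-- The coefficient vectors and arguments for which `K` is defined. -/
def coeffDomain (N : ℕ) : Set ((Fin (N + 1) → ℝ) × ℝ) :=
  {q | (∀ j, 0 ≤ q.1 j) ∧ 0 < q.1 0 ∧ 0 < q.1 (Fin.last N) ∧ 0 ≤ q.2}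

theorem measurableSet_coeffDomain : MeasurableSet (coeffDomain N) := by
  have e : coeffDomain N = ((⋂ j, {q | 0 ≤ q.1 j}) ∩ ({q | 0 < q.1 0} ∩
      ({q | 0 < q.1 (Fin.last N)} ∩ {q | 0 ≤ q.2}))) := by
    ext q; simp [coeffDomain]
  rw [e]
  refine (MeasurableSet.iInter fun j => measurableSet_le measurable_const (by fun_prop)).inter
    ((measurableSet_lt measurable_const (by fun_prop)).inter
      ((measurableSet_lt measurable_const (by fun_prop)).inter
        (measurableSet_le measurable_const measurable_snd)))

/-- A homogeneous medium, concentrated at the origin of `ℝ⁰`, with given coefficients. It makes the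
properties of `s(x,ξ)` available for a bare coefficient vector. -/
theorem isMedium_const {A : Fin (N + 1) → ℝ} (h0 : ∀ j, 0 ≤ A j) (h1 : 0 < A 0)
    (h2 : 0 < A (Fin.last N)) :
    IsMedium ({0} : Set (Space 0)) (fun _ => 1) (fun j _ => A j) where
  porosity_measurable := aemeasurable_const
  porosity_pos _ _ := one_pos
  porosity_le_one _ _ := le_rfl
  coeff_measurable _ := aemeasurable_const
  coeff_nonneg j _ _ := h0 j
  coeff_zero_pos _ _ := h1
  coeff_last_pos _ _ := h2
  coeff_last_integrable := integrableOn_const (by simp)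

open Classical in
/-- `K` as a function of the coefficient vector, set to `0` off the domain of definition. -/
noncomputable def coeffK (α : Fin (N + 1) → ℝ) (q : (Fin (N + 1) → ℝ) × ℝ) : ℝ :=
  if q ∈ coeffDomain N then K α (fun j _ => q.1 j) (0 : Space 0) q.2 else 0

theorem measurable_coeffK (hα : IsExponents α) : Measurable (coeffK α) := by
  classical
  let S : (Fin (N + 1) → ℝ) × ℝ → ℝ := fun q =>
    if q ∈ coeffDomain N then speed α (fun j _ => q.1 j) (0 : Space 0) q.2 else 0
  have hg : ∀ s : ((Fin (N + 1) → ℝ) × ℝ) → ℝ, Measurable s →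
      Measurable fun q => g α (fun j _ => q.1 j) (0 : Space 0) (s q) := fun s hs => by
    unfold g
    exact Finset.measurable_fun_sum _ fun j _ => (by fun_prop)
  have hS : Measurable S := by
    refine measurable_of_Iic fun c => ?_
    rcases lt_or_ge c 0 with hc | hc
    · convert MeasurableSet.empty
      refine eq_empty_of_forall_notMem fun q hq => ?_
      simp only [S, mem_preimage, mem_Iic] at hq
      split_ifs at hq with h
      · have := speed_nonneg hα (isMedium_const h.1 h.2.1 h.2.2.1) (mem_singleton _) h.2.2.2
        linarith
      · linarith
    · have : S ⁻¹' Iic c = (coeffDomain N)ᶜ ∪ (coeffDomain N ∩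
          {q | q.2 ≤ c * g α (fun j _ => q.1 j) (0 : Space 0) c}) := by
        ext q
        simp only [S, mem_preimage, mem_Iic, mem_union, mem_compl_iff, mem_inter_iff, mem_ofPred_eq]
        split_ifs with h
        · have hm := isMedium_const h.1 h.2.1 h.2.2.1
          have hsp := speed_spec hα hm (mem_singleton _) h.2.2.2
          rw [← (strictMonoOn_mul_g hα hm (mem_singleton _)).le_iff_le hsp.1 hc]
          simp only [hsp.2, h]
          tauto
        · simp [h, hc]
      rw [this]
      exact measurableSet_coeffDomain.compl.union (measurableSet_coeffDomain.inter
        (measurableSet_le measurable_snd (measurable_const.mul (hg _ measurable_const))))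
  have : coeffK α = fun q => if q ∈ coeffDomain N then
      1 / g α (fun j _ => q.1 j) (0 : Space 0) (S q) else 0 := by
    funext q
    simp only [coeffK, S, K]
    split_ifs <;> rfl
  rw [this]
  exact Measurable.ite measurableSet_coeffDomain (measurable_const.div (hg _ hS)) measurable_const

theorem coeffK_eq (ha : IsMedium U φ a) (hx : x ∈ U) {ξ : ℝ} (hξ : 0 ≤ ξ) :
    coeffK α (fun j => a j x, ξ) = K α a x ξ := by
  rw [coeffK, if_pos]
  · rfl
  · exact ⟨fun j => ha.coeff_nonneg j x hx, ha.coeff_zero_pos x hx, ha.coeff_last_pos x hx, hξ⟩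

theorem aemeasurable_coeff (ha : IsMedium U φ a) {ξ : Space n → ℝ}
    (hξ : AEMeasurable ξ (volume.restrict U)) :
    AEMeasurable (fun x => ((fun j => a j x, ξ x) : (Fin (N + 1) → ℝ) × ℝ))
      (volume.restrict U) :=
  (aemeasurable_pi_lambda _ ha.coeff_measurable).prodMk hξ

theorem aemeasurable_K (hU : MeasurableSet U) (hα : IsExponents α) (ha : IsMedium U φ a)
    {ξ : Space n → ℝ} (hξ : AEMeasurable ξ (volume.restrict U)) (hξ0 : ∀ x, 0 ≤ ξ x) :
    AEMeasurable (fun x => K α a x (ξ x)) (volume.restrict U) := by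
  refine ((measurable_coeffK hα).comp_aemeasurable (aemeasurable_coeff ha hξ)).congr ?_
  filter_upwards [ae_restrict_mem hU] with x hx
  exact coeffK_eq ha hx (hξ0 x)

/-- `H` is `ξ² ∫₀¹ K(x, ξ√θ) dθ`, hence measurable as a parametric integral. -/
theorem aemeasurable_H (hU : MeasurableSet U) (hα : IsExponents α) (ha : IsMedium U φ a)
    {ξ : Space n → ℝ} (hξ : AEMeasurable ξ (volume.restrict U)) (hξ0 : ∀ x, 0 ≤ ξ x) :
    AEMeasurable (fun x => H α a x (ξ x)) (volume.restrict U) := by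
  have hm : Measurable fun q : (Fin (N + 1) → ℝ) × ℝ =>
      q.2 ^ 2 * ∫ θ in Ioc (0 : ℝ) 1, coeffK α (q.1, q.2 * Real.sqrt θ) := by
    refine (measurable_snd.pow_const 2).mul ?_
    have : StronglyMeasurable fun r : ((Fin (N + 1) → ℝ) × ℝ) × ℝ =>
        coeffK α (r.1.1, r.1.2 * Real.sqrt r.2) :=
      ((measurable_coeffK hα).comp (by fun_prop)).stronglyMeasurable
    exact this.integral_prod_right.measurable
  refine (hm.comp_aemeasurable (aemeasurable_coeff ha hξ)).congr ?_
  filter_upwards [ae_restrict_mem hU] with x hx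
  have h1 : ∫ θ in Ioc (0 : ℝ) 1, coeffK α (fun j => a j x, ξ x * Real.sqrt θ)
      = ∫ θ in (0 : ℝ)..1, K α a x (Real.sqrt (ξ x ^ 2 * θ)) := by
    rw [intervalIntegral.integral_of_le zero_le_one]
    refine setIntegral_congr_fun measurableSet_Ioc fun θ _ => ?_
    rw [coeffK_eq ha hx (mul_nonneg (hξ0 x) (Real.sqrt_nonneg _)),
      Real.sqrt_mul (sq_nonneg _), Real.sqrt_sq (hξ0 x)]
  simp only [Function.comp, h1]
  have := intervalIntegral.mul_integral_comp_mul_left (a := (0 : ℝ)) (b := 1)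
    (f := fun s => K α a x (Real.sqrt s)) (ξ x ^ 2)
  simp only [mul_zero, mul_one] at this
  rw [this, H]

theorem aestronglyMeasurable_flux (hU : MeasurableSet U) (hα : IsExponents α)
    (ha : IsMedium U φ a) {F : Space n → Space n}
    (hF : AEStronglyMeasurable F (volume.restrict U)) :
    AEStronglyMeasurable (fun x => flux α a x (F x)) (volume.restrict U) :=
  (aemeasurable_K hU hα ha hF.norm.aemeasurable fun _ => norm_nonneg _).aestronglyMeasurable.smul hF

end

/-! ### Differential and integral inequalities -/

/-- A function that decreases wherever it exceeds the level `B` stays below `B`. -/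
theorem le_of_deriv_nonpos_above {f : ℝ → ℝ} {T B : ℝ} (hf : ContinuousOn f (Icc 0 T))
    (h0 : f 0 ≤ B)
    (hd : ∀ t, 0 < t → t ≤ T → ∃ f', HasDerivAt f f' t ∧ (B < f t → f' ≤ 0)) {t : ℝ}
    (ht : t ∈ Icc 0 T) : f t ≤ B := by
  by_contra! hlt
  -- the last time before `t` at which `f` is at most `B`
  set S : Set ℝ := {s ∈ Icc 0 t | f s ≤ B} with hS
  have hfc : ContinuousOn f (Icc 0 t) := hf.mono (Icc_subset_Icc le_rfl ht.2)
  have hSclosed : IsClosed S := hfc.preimage_isClosed_of_isClosed isClosed_Icc isClosed_Iic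
  have hSc : IsCompact S := isCompact_Icc.of_isClosed_subset hSclosed (sep_subset _ _)
  obtain ⟨s, hs⟩ := hSc.exists_isGreatest ⟨0, ⟨le_rfl, ht.1⟩, h0⟩
  obtain ⟨⟨hs0, hst⟩, hfs⟩ := hs.1
  have habove : ∀ r ∈ Ioc s t, B < f r := fun r hr => by
    by_contra! hle
    exact absurd (hs.2 ⟨⟨hs0.trans hr.1.le, hr.2⟩, hle⟩) (not_le.2 hr.1)
  have hder : ∀ r ∈ interior (Icc s t), ∃ f', HasDerivAt f f' r ∧ f' ≤ 0 := by
    intro r hr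
    rw [interior_Icc] at hr
    obtain ⟨f', h1, h2⟩ := hd r (hs0.trans_lt hr.1) (hr.2.le.trans ht.2)
    exact ⟨f', h1, h2 (habove r ⟨hr.1, hr.2.le⟩)⟩
  have hanti : AntitoneOn f (Icc s t) := by
    refine antitoneOn_of_deriv_nonpos (convex_Icc _ _)
      (hfc.mono (Icc_subset_Icc hs0 le_rfl)) ?_ ?_
    · intro r hr
      obtain ⟨f', h1, -⟩ := hder r hr
      exact h1.differentiableAt.differentiableWithinAt
    · intro r hr
      obtain ⟨f', h1, h2⟩ := hder r hr
      rwa [h1.deriv]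
  have := hanti (left_mem_Icc.2 hst) (right_mem_Icc.2 hst) hst
  linarith

/-- Grönwall's inequality with variable coefficients. -/
theorem gronwall_of_deriv_le {y b f : ℝ → ℝ} (hy : ContinuousOn y (Ici 0))
    (hb : ContinuousOn b (Ici 0)) (hf : ContinuousOn f (Ici 0))
    (hd : ∀ t, 0 < t → ∃ y', HasDerivAt y y' t ∧ y' ≤ -(b t * y t) + f t) {t : ℝ} (ht : 0 ≤ t) :
    y t ≤ Real.exp (-∫ τ in (0 : ℝ)..t, b τ) * y 0 +
      ∫ s in (0 : ℝ)..t, Real.exp (-∫ τ in s..t, b τ) * f s := by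
  -- continuous extensions of the coefficients to the whole line
  have hmax : ∀ {h : ℝ → ℝ}, ContinuousOn h (Ici 0) → Continuous fun s => h (max s 0) :=
    fun hh => hh.comp_continuous (by fun_prop) fun s => mem_Ici.2 (le_max_right _ _)
  set b' : ℝ → ℝ := fun s => b (max s 0) with hb'
  set f' : ℝ → ℝ := fun s => f (max s 0) with hf'
  have hbc : Continuous b' := hmax hb
  have hfc : Continuous f' := hmax hf
  set A : ℝ → ℝ := fun s => ∫ τ in (0 : ℝ)..s, b' τ with hA
  have hAd : ∀ s, HasDerivAt A (b' s) s := fun s =>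
    intervalIntegral.integral_hasDerivAt_right (hbc.intervalIntegrable _ _)
      (hbc.stronglyMeasurableAtFilter _ _) hbc.continuousAt
  have hAc : Continuous A := continuous_iff_continuousAt.2 fun s => (hAd s).continuousAt
  set q : ℝ → ℝ := fun s => Real.exp (A s) * f' s with hq
  have hqc : Continuous q := (Real.continuous_exp.comp hAc).mul hfc
  set w : ℝ → ℝ := fun s => Real.exp (A s) * y s - ∫ r in (0 : ℝ)..s, q r with hw
  have hQd : ∀ s, HasDerivAt (fun s => ∫ r in (0 : ℝ)..s, q r) (q s) s := fun s =>
    intervalIntegral.integral_hasDerivAt_right (hqc.intervalIntegrable _ _)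
      (hqc.stronglyMeasurableAtFilter _ _) hqc.continuousAt
  have hwd : ∀ s, 0 < s → ∃ w', HasDerivAt w w' s ∧ w' ≤ 0 := by
    intro s hs
    obtain ⟨y', h1, h2⟩ := hd s hs
    refine ⟨_, ((hAd s).exp.mul h1).sub (hQd s), ?_⟩
    have e1 : b' s = b s := by simp [hb', hs.le]
    have e2 : f' s = f s := by simp [hf', hs.le]
    simp only [hq, e1, e2]
    have := mul_le_mul_of_nonneg_left h2 (Real.exp_pos (A s)).le
    nlinarith
  have hanti : AntitoneOn w (Ici 0) := by
    refine antitoneOn_of_deriv_nonpos (convex_Ici 0) ?_ ?_ ?_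
    · refine ((Real.continuous_exp.comp hAc).continuousOn.mul hy).sub ?_
      exact (continuous_iff_continuousAt.2 fun s => (hQd s).continuousAt).continuousOn
    · intro s hs
      rw [interior_Ici] at hs
      obtain ⟨w', h1, -⟩ := hwd s hs
      exact h1.differentiableAt.differentiableWithinAt
    · intro s hs
      rw [interior_Ici] at hs
      obtain ⟨w', h1, h2⟩ := hwd s hs
      rwa [h1.deriv]
  have key := hanti (mem_Ici.2 le_rfl) (mem_Ici.2 ht) ht
  simp only [hw, hA, intervalIntegral.integral_same, Real.exp_zero, one_mul, sub_zero] at key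
  have hbint : ∀ s, 0 ≤ s → s ≤ t → ∫ τ in s..t, b τ = A t - A s := by
    intro s hs hst
    rw [hA, intervalIntegral.integral_interval_sub_left (hbc.intervalIntegrable _ _)
      (hbc.intervalIntegrable _ _)]
    refine intervalIntegral.integral_congr fun τ hτ => ?_
    rw [uIcc_of_le hst] at hτ
    simp [hb', hs.trans hτ.1]
  have hsrc : ∫ s in (0 : ℝ)..t, Real.exp (-∫ τ in s..t, b τ) * f s
      = Real.exp (-A t) * ∫ s in (0 : ℝ)..t, q s := by
    rw [← intervalIntegral.integral_const_mul]
    refine intervalIntegral.integral_congr fun s hs => ?_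
    rw [uIcc_of_le ht] at hs
    have e2 : f' s = f s := by simp [hf', hs.1]
    simp only [hq, e2]
    rw [hbint s hs.1 hs.2, ← mul_assoc, ← Real.exp_add]
    congr 2; ring
  have hA0 : A 0 = 0 := by simp [hA]
  rw [hsrc, hbint 0 le_rfl ht, hA0, sub_zero]
  have hE : Real.exp (-A t) * Real.exp (A t) = 1 := by rw [← Real.exp_add]; simp
  calc y t = Real.exp (-A t) * (Real.exp (A t) * y t) := by rw [← mul_assoc, hE, one_mul]
    _ ≤ Real.exp (-A t) * (y 0 + ∫ s in (0 : ℝ)..t, q s) := by gcongr; simp only [hA]; linarith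
    _ = _ := by ring

theorem continuousOn_sSup_image_Icc {h : ℝ → ℝ} (hh : ContinuousOn h (Ici 0)) :
    ContinuousOn (fun t => sSup (h '' Icc 0 t)) (Ici 0) := by
  have hc : Continuous fun t => sSup ((fun θ => h (max (t * θ) 0)) '' Icc (0 : ℝ) 1) := by
    refine isCompact_Icc.continuous_sSup (f := fun t θ => h (max (t * θ) 0)) ?_
    exact hh.comp_continuous (by fun_prop) fun s => mem_Ici.2 (le_max_right _ _)
  refine hc.continuousOn.congr fun t ht => ?_
  have ht0 : (0 : ℝ) ≤ t := ht
  congr 1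
  ext y
  constructor
  · rintro ⟨s, hs, rfl⟩
    rcases ht0.eq_or_lt with rfl | ht'
    · obtain rfl : s = 0 := le_antisymm hs.2 hs.1
      exact ⟨0, by simp, by simp⟩
    · refine ⟨s / t, ⟨by have := hs.1; positivity, (div_le_one ht').2 hs.2⟩, ?_⟩
      have : t * (s / t) = s := by field_simp
      simp [this, hs.1]
  · rintro ⟨θ, hθ, rfl⟩
    refine ⟨t * θ, ⟨mul_nonneg ht0 hθ.1, mul_le_of_le_one_right ht0 hθ.2⟩, ?_⟩
    simp [mul_nonneg ht0 hθ.1]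

theorem continuousOn_Ici_of_tendsto {f : ℝ → ℝ} (h : ∀ t, 0 < t → ContinuousAt f t)
    (h0 : Tendsto f (𝓝[>] 0) (𝓝 (f 0))) : ContinuousOn f (Ici 0) := by
  intro t ht
  rcases (mem_Ici.1 ht).eq_or_lt with rfl | ht'
  · exact continuousWithinAt_Ioi_iff_Ici.1 h0
  · exact (h t ht').continuousWithinAt

/-- Hölder's inequality `∫ h ≤ (∫ f)^θ (∫ g)^{1-θ}` for `h ≤ f^θ g^{1-θ}`, with positive upper bounds
in place of the integrals so that no case of a vanishing integral arises; `h` need not be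
measurable. -/
theorem integral_le_rpow_mul_rpow {β : Type*} [MeasurableSpace β] {μ : Measure β}
    {f g h : β → ℝ} {θ X Y : ℝ} (hθ0 : 0 ≤ θ) (hθ1 : θ ≤ 1) (hX : 0 < X) (hY : 0 < Y)
    (hf : Integrable f μ) (hg : Integrable g μ) (hf0 : ∀ᵐ x ∂μ, 0 ≤ f x)
    (hg0 : ∀ᵐ x ∂μ, 0 ≤ g x) (hfX : ∫ x, f x ∂μ ≤ X) (hgY : ∫ x, g x ∂μ ≤ Y)
    (hh0 : ∀ᵐ x ∂μ, 0 ≤ h x) (hh : ∀ᵐ x ∂μ, h x ≤ f x ^ θ * g x ^ (1 - θ)) :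
    ∫ x, h x ∂μ ≤ X ^ θ * Y ^ (1 - θ) := by
  have hint : Integrable (fun x => X ^ θ * Y ^ (1 - θ) * (θ * (f x / X) + (1 - θ) * (g x / Y))) μ :=
    (((hf.div_const X).const_mul θ).add ((hg.div_const Y).const_mul (1 - θ))).const_mul _
  calc ∫ x, h x ∂μ
      ≤ ∫ x, X ^ θ * Y ^ (1 - θ) * (θ * (f x / X) + (1 - θ) * (g x / Y)) ∂μ := by
        refine integral_mono_of_nonneg hh0 hint ?_
        filter_upwards [hf0, hg0, hh] with x h1 h2 h3
        refine h3.trans ?_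
        have := Real.geom_mean_le_arith_mean2_weighted hθ0 (sub_nonneg.2 hθ1)
          (div_nonneg h1 hX.le) (div_nonneg h2 hY.le) (by ring)
        calc f x ^ θ * g x ^ (1 - θ)
            = X ^ θ * Y ^ (1 - θ) * ((f x / X) ^ θ * (g x / Y) ^ (1 - θ)) := by
              rw [Real.div_rpow h1 hX.le, Real.div_rpow h2 hY.le]; field_simp
          _ ≤ _ := by gcongr
    _ = X ^ θ * Y ^ (1 - θ) * (θ * ((∫ x, f x ∂μ) / X) + (1 - θ) * ((∫ x, g x ∂μ) / Y)) := by
        rw [integral_const_mul, integral_add ((hf.div_const X).const_mul θ)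
          ((hg.div_const Y).const_mul (1 - θ)), integral_const_mul, integral_const_mul,
          integral_div, integral_div]
    _ ≤ X ^ θ * Y ^ (1 - θ) * (θ * 1 + (1 - θ) * 1) := by
        have h1 : (∫ x, f x ∂μ) / X ≤ 1 := (div_le_one hX).2 hfX
        have h2 : (∫ x, g x ∂μ) / Y ≤ 1 := (div_le_one hY).2 hgY
        have := sub_nonneg.2 hθ1
        gcongr
    _ = _ := by ring

/-- The Cauchy–Schwarz inequality for the integral of a function dominated by a geometric mean. -/
theorem integral_le_sqrt_mul_sqrt {β : Type*} [MeasurableSpace β] {μ : Measure β}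
    {f g h : β → ℝ} (hf : Integrable f μ) (hg : Integrable g μ) (hf0 : ∀ᵐ x ∂μ, 0 ≤ f x)
    (hg0 : ∀ᵐ x ∂μ, 0 ≤ g x) (hh0 : ∀ᵐ x ∂μ, 0 ≤ h x) (hh : ∀ᵐ x ∂μ, h x ^ 2 ≤ f x * g x) :
    ∫ x, h x ∂μ ≤ √(∫ x, f x ∂μ) * √(∫ x, g x ∂μ) := by
  have key : ∀ ε : ℝ, 0 < ε →
      ∫ x, h x ∂μ ≤ √(∫ x, f x ∂μ + ε) * √(∫ x, g x ∂μ + ε) := by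
    intro ε hε
    have h1 := integral_nonneg_of_ae hf0
    have h2 := integral_nonneg_of_ae hg0
    have := integral_le_rpow_mul_rpow (θ := 1 / 2) (X := ∫ x, f x ∂μ + ε) (Y := ∫ x, g x ∂μ + ε)
      (h := h) (by norm_num) (by norm_num) (by positivity) (by positivity) hf hg hf0 hg0
      (by linarith) (by linarith) hh0 (by
        filter_upwards [hf0, hg0, hh0, hh] with x h3 h4 h5 h6
        rw [show (1 - 1 / 2 : ℝ) = 1 / 2 by norm_num, ← Real.sqrt_eq_rpow, ← Real.sqrt_eq_rpow,
          ← Real.sqrt_mul h3]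
        exact Real.le_sqrt_of_sq_le h6)
    rwa [show (1 - 1 / 2 : ℝ) = 1 / 2 by norm_num, ← Real.sqrt_eq_rpow, ← Real.sqrt_eq_rpow] at this
  have hlim : Tendsto (fun ε : ℝ => √(∫ x, f x ∂μ + ε) * √(∫ x, g x ∂μ + ε)) (𝓝[>] 0)
      (𝓝 (√(∫ x, f x ∂μ + 0) * √(∫ x, g x ∂μ + 0))) :=
    ((by fun_prop : Continuous fun ε : ℝ => √(∫ x, f x ∂μ + ε) * √(∫ x, g x ∂μ + ε)).tendsto
      0).mono_left nhdsWithin_le_nhds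
  simpa using ge_of_tendsto hlim (eventually_nhdsWithin_of_forall fun ε hε => key ε hε)

/-! ### Convex modulars -/

section

/-- A density `Θ(x,y)`, convex and differentiable in `y` with gradient `2ψ(x,y)`, such that
`y ↦ ∫ Θ(x,y(x)) dμ` is a modular with the doubling property which vanishes at the origin faster
than linearly, with exponent `β > 1`. Both parts of the energy are of this form: `φ u²` with
`ψ = φ u`, and `H(x,|F|)` with `ψ` the flux `K(x,|F|) F`. -/
structure IsModular {X E : Type*} [MeasurableSpace X] [NormedAddCommGroup E]
    [InnerProductSpace ℝ E] (μ : Measure X) (β : ℝ) (Θ : X → E → ℝ) (ψ : X → E → E) : Prop where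
  one_lt : 1 < β
  nonneg : ∀ᵐ x ∂μ, ∀ y, 0 ≤ Θ x y
  scale : ∀ᵐ x ∂μ, ∀ y, ∀ h : ℝ, 0 < h → h ≤ 1 → Θ x (h • y) ≤ 2 * h ^ β * Θ x y
  smul_le : ∀ᵐ x ∂μ, ∀ y, ∀ c : ℝ, Θ x (c • y) ≤ 2 * (1 + c ^ 2) * Θ x y
  neg : ∀ᵐ x ∂μ, ∀ y, Θ x (-y) = Θ x y
  sub_le : ∀ᵐ x ∂μ, ∀ y z, Θ x (y - z) ≤ 8 * (Θ x y + Θ x z)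
  convex : ∀ᵐ x ∂μ, ∀ y z, 2 * inner ℝ (ψ x y) (z - y) ≤ Θ x z - Θ x y
  smooth : ∀ᵐ x ∂μ, ∀ y z,
    Θ x z - Θ x y ≤ 2 * inner ℝ (ψ x y) (z - y) + 8 * Θ x (z - y)
  young : ∀ᵐ x ∂μ, ∀ y z, ∀ δ : ℝ, 0 < δ → δ ≤ 1 →
    |inner ℝ (ψ x y) z| ≤ δ * Θ x y + δ⁻¹ * Θ x z
  aesm : ∀ f : X → E, AEStronglyMeasurable f μ →
    AEStronglyMeasurable (fun x => Θ x (f x)) μ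
  aesm_flux : ∀ f : X → E, AEStronglyMeasurable f μ →
    AEStronglyMeasurable (fun x => ψ x (f x)) μ

/-- Measurable functions with finite modular. -/
structure FiniteModular {X E : Type*} [MeasurableSpace X] [NormedAddCommGroup E]
    (μ : Measure X) (Θ : X → E → ℝ) (f : X → E) : Prop where
  aesm : AEStronglyMeasurable f μ
  integrable : Integrable (fun x => Θ x (f x)) μ

variable {X E : Type*} [MeasurableSpace X] [NormedAddCommGroup E] [InnerProductSpace ℝ E]
  {μ : Measure X} {β : ℝ} {Θ : X → E → ℝ} {ψ : X → E → E} {f f' k : X → E}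

namespace IsModular

theorem integral_nonneg (hM : IsModular μ β Θ ψ) (f : X → E) : 0 ≤ ∫ x, Θ x (f x) ∂μ :=
  integral_nonneg_of_ae (hM.nonneg.mono fun _ h => h _)

theorem finite_of_le (hM : IsModular μ β Θ ψ) (hf : AEStronglyMeasurable f μ) {b : X → ℝ}
    (hb : Integrable b μ) (h : ∀ᵐ x ∂μ, Θ x (f x) ≤ b x) : FiniteModular μ Θ f := by
  refine ⟨hf, hb.mono' (hM.aesm f hf) ?_⟩
  filter_upwards [h, hM.nonneg] with x h1 h2
  rwa [Real.norm_eq_abs, abs_of_nonneg (h2 _)]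

theorem finite_smul (hM : IsModular μ β Θ ψ) (hf : FiniteModular μ Θ f) (c : ℝ) :
    FiniteModular μ Θ (fun x => c • f x) :=
  hM.finite_of_le (hf.aesm.const_smul c) (hf.integrable.const_mul (2 * (1 + c ^ 2)))
    (hM.smul_le.mono fun _ h => h _ _)

theorem finite_sub (hM : IsModular μ β Θ ψ) (hf : FiniteModular μ Θ f)
    (hk : FiniteModular μ Θ k) : FiniteModular μ Θ (fun x => f x - k x) :=
  hM.finite_of_le (hf.aesm.sub hk.aesm) ((hf.integrable.add hk.integrable).const_mul 8)
    (hM.sub_le.mono fun _ h => h _ _)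

theorem finite_neg (hM : IsModular μ β Θ ψ) (hf : FiniteModular μ Θ f) :
    FiniteModular μ Θ (fun x => -f x) :=
  hM.finite_of_le hf.aesm.neg hf.integrable (hM.neg.mono fun _ h => (h _).le)

theorem finite_add (hM : IsModular μ β Θ ψ) (hf : FiniteModular μ Θ f)
    (hk : FiniteModular μ Θ k) : FiniteModular μ Θ (fun x => f x + k x) := by
  simpa using hM.finite_sub hf (hM.finite_neg hk)

theorem integral_sub_le (hM : IsModular μ β Θ ψ) (hf : FiniteModular μ Θ f)
    (hk : FiniteModular μ Θ k) :
    ∫ x, Θ x (f x - k x) ∂μ ≤ 8 * (∫ x, Θ x (f x) ∂μ + ∫ x, Θ x (k x) ∂μ) := by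
  rw [← integral_add hf.integrable hk.integrable, ← integral_const_mul]
  exact integral_mono_ae (hM.finite_sub hf hk).integrable
    ((hf.integrable.add hk.integrable).const_mul 8) (hM.sub_le.mono fun _ h => h _ _)

theorem integral_add_le (hM : IsModular μ β Θ ψ) (hf : FiniteModular μ Θ f)
    (hk : FiniteModular μ Θ k) :
    ∫ x, Θ x (f x + k x) ∂μ ≤ 8 * (∫ x, Θ x (f x) ∂μ + ∫ x, Θ x (k x) ∂μ) := by
  have h := hM.integral_sub_le hf (hM.finite_neg hk)
  have e : ∫ x, Θ x (-k x) ∂μ = ∫ x, Θ x (k x) ∂μ :=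
    integral_congr_ae (hM.neg.mono fun _ h => h _)
  simpa [e] using h

theorem integral_smul_le (hM : IsModular μ β Θ ψ) (hf : FiniteModular μ Θ f) {h : ℝ}
    (h0 : 0 < |h|) (h1 : |h| ≤ 1) :
    ∫ x, Θ x (h • f x) ∂μ ≤ 2 * |h| ^ β * ∫ x, Θ x (f x) ∂μ := by
  rw [← integral_const_mul]
  refine integral_mono_ae (hM.finite_smul hf h).integrable (hf.integrable.const_mul _) ?_
  filter_upwards [hM.scale, hM.neg] with x h2 h3
  rcases abs_choice h with e | e
  · have := h2 (f x) |h| h0 h1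
    rwa [e] at this ⊢
  · have := h2 (f x) |h| h0 h1
    rw [e] at this ⊢
    rwa [neg_smul, h3] at this

theorem integrable_inner (hM : IsModular μ β Θ ψ) (hf : FiniteModular μ Θ f)
    (hk : FiniteModular μ Θ k) : Integrable (fun x => inner ℝ (ψ x (f x)) (k x)) μ := by
  refine (hf.integrable.add hk.integrable).mono' ((hM.aesm_flux f hf.aesm).inner hk.aesm) ?_
  filter_upwards [hM.young] with x h
  simpa using h (f x) (k x) 1 one_pos le_rfl

theorem abs_integral_inner_le (hM : IsModular μ β Θ ψ) (hf : FiniteModular μ Θ f)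
    (hk : FiniteModular μ Θ k) {δ : ℝ} (hδ : 0 < δ) (hδ1 : δ ≤ 1) :
    |∫ x, inner ℝ (ψ x (f x)) (k x) ∂μ| ≤
      δ * ∫ x, Θ x (f x) ∂μ + δ⁻¹ * ∫ x, Θ x (k x) ∂μ := by
  rw [← integral_const_mul, ← integral_const_mul,
    ← integral_add (hf.integrable.const_mul _) (hk.integrable.const_mul _)]
  refine (abs_integral_le_integral_abs).trans ?_
  exact integral_mono_ae (hM.integrable_inner hf hk).abs
    ((hf.integrable.const_mul _).add (hk.integrable.const_mul _))
    (hM.young.mono fun _ h => h _ _ _ hδ hδ1)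

theorem lintegral_eq (hM : IsModular μ β Θ ψ) (hf : FiniteModular μ Θ f) :
    ∫⁻ x, ENNReal.ofReal (Θ x (f x)) ∂μ = ENNReal.ofReal (∫ x, Θ x (f x) ∂μ) :=
  (ofReal_integral_eq_lintegral_ofReal hf.integrable (hM.nonneg.mono fun _ h => h _)).symm

theorem finite_of_lintegral (hM : IsModular μ β Θ ψ) (hf : AEStronglyMeasurable f μ)
    (h : ∫⁻ x, ENNReal.ofReal (Θ x (f x)) ∂μ < ⊤) : FiniteModular μ Θ f := by
  refine ⟨hf, hM.aesm f hf, ?_⟩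
  rw [hasFiniteIntegral_iff_ofReal (hM.nonneg.mono fun _ h => h _)]
  exact h

theorem lintegral_sub_le (hM : IsModular μ β Θ ψ) (hf : AEStronglyMeasurable f μ) (k : X → E) :
    ∫⁻ x, ENNReal.ofReal (Θ x (f x - k x)) ∂μ ≤
      8 * (∫⁻ x, ENNReal.ofReal (Θ x (f x)) ∂μ + ∫⁻ x, ENNReal.ofReal (Θ x (k x)) ∂μ) := by
  rw [← lintegral_add_left' (hM.aesm f hf).aemeasurable.ennreal_ofReal,
    ← lintegral_const_mul' _ _ (by simp)]
  refine lintegral_mono_ae ?_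
  filter_upwards [hM.sub_le, hM.nonneg] with x h h0
  rw [← ENNReal.ofReal_add (h0 _) (h0 _), show (8 : ℝ≥0∞) = ENNReal.ofReal 8 by simp,
    ← ENNReal.ofReal_mul (by norm_num)]
  exact ENNReal.ofReal_le_ofReal (h _ _)

theorem tendsto_lintegral_sub (hM : IsModular μ β Θ ψ) {ι : Type*} {l : Filter ι}
    {v w : ι → X → E} (hv : ∀ᶠ i in l, AEStronglyMeasurable (v i) μ)
    (h1 : Tendsto (fun i => ∫⁻ x, ENNReal.ofReal (Θ x (v i x)) ∂μ) l (𝓝 0))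
    (h2 : Tendsto (fun i => ∫⁻ x, ENNReal.ofReal (Θ x (w i x)) ∂μ) l (𝓝 0)) :
    Tendsto (fun i => ∫⁻ x, ENNReal.ofReal (Θ x (v i x - w i x)) ∂μ) l (𝓝 0) := by
  have h := ENNReal.Tendsto.const_mul (a := 8) (h1.add h2) (Or.inr (by simp))
  rw [add_zero, mul_zero] at h
  exact tendsto_of_tendsto_of_tendsto_of_le_of_le' tendsto_const_nhds h
    (Eventually.of_forall fun _ => zero_le) (hv.mono fun i hi => hM.lintegral_sub_le hi _)

section Limits

variable {ι : Type*} {l : Filter ι} {v : ι → X → E}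

theorem eventually_finite (hM : IsModular μ β Θ ψ)
    (hv : ∀ᶠ i in l, AEStronglyMeasurable (v i) μ)
    (h : Tendsto (fun i => ∫⁻ x, ENNReal.ofReal (Θ x (v i x)) ∂μ) l (𝓝 0)) :
    ∀ᶠ i in l, FiniteModular μ Θ (v i) := by
  filter_upwards [hv, h.eventually (gt_mem_nhds ENNReal.zero_lt_top)] with i h1 h2
  exact hM.finite_of_lintegral h1 h2

theorem tendsto_integral (hM : IsModular μ β Θ ψ)
    (hv : ∀ᶠ i in l, AEStronglyMeasurable (v i) μ)
    (h : Tendsto (fun i => ∫⁻ x, ENNReal.ofReal (Θ x (v i x)) ∂μ) l (𝓝 0)) :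
    Tendsto (fun i => ∫ x, Θ x (v i x) ∂μ) l (𝓝 0) := by
  have h2 := (ENNReal.tendsto_toReal ENNReal.zero_ne_top).comp h
  rw [ENNReal.toReal_zero] at h2
  refine h2.congr' ?_
  filter_upwards [hM.eventually_finite hv h] with i hi
  simp only [Function.comp]
  rw [hM.lintegral_eq hi, ENNReal.toReal_ofReal (hM.integral_nonneg _)]

theorem tendsto_integral_inner (hM : IsModular μ β Θ ψ) (hf : FiniteModular μ Θ f)
    (hv : ∀ᶠ i in l, FiniteModular μ Θ (v i))
    (h : Tendsto (fun i => ∫ x, Θ x (v i x) ∂μ) l (𝓝 0)) :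
    Tendsto (fun i => ∫ x, inner ℝ (ψ x (f x)) (v i x) ∂μ) l (𝓝 0) := by
  rw [Metric.tendsto_nhds]
  intro ε hε
  set A := ∫ x, Θ x (f x) ∂μ
  have hA : 0 ≤ A := hM.integral_nonneg f
  -- Young's inequality with a parameter that makes the contribution of `f` small
  set δ := min 1 (ε / (2 * (A + 1))) with hδ
  have hδ0 : 0 < δ := by positivity
  have hδ1 : δ ≤ 1 := min_le_left _ _
  have hδA : δ * A < ε / 2 := by
    have : δ ≤ ε / (2 * (A + 1)) := min_le_right _ _
    rw [le_div_iff₀ (by positivity)] at this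
    nlinarith
  filter_upwards [hv, h.eventually (gt_mem_nhds (show 0 < δ * (ε / 2) by positivity))]
    with i h1 h2
  rw [Real.dist_eq, sub_zero]
  have h3 := hM.abs_integral_inner_le hf h1 hδ0 hδ1
  have h4 : δ⁻¹ * ∫ x, Θ x (v i x) ∂μ < ε / 2 := by rwa [inv_mul_lt_iff₀ hδ0]
  linarith

theorem integral_expansion (hM : IsModular μ β Θ ψ) (hf : FiniteModular μ Θ f)
    (hk : FiniteModular μ Θ k) :
    |∫ x, Θ x (k x) ∂μ - ∫ x, Θ x (f x) ∂μ - 2 * ∫ x, inner ℝ (ψ x (f x)) (k x - f x) ∂μ| ≤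
      8 * ∫ x, Θ x (k x - f x) ∂μ := by
  have hd := hM.finite_sub hk hf
  have hi := hM.integrable_inner hf hd
  have h1 : 2 * ∫ x, inner ℝ (ψ x (f x)) (k x - f x) ∂μ ≤
      ∫ x, Θ x (k x) ∂μ - ∫ x, Θ x (f x) ∂μ := by
    rw [← integral_const_mul, ← integral_sub hk.integrable hf.integrable]
    exact integral_mono_ae (hi.const_mul 2) (hk.integrable.sub hf.integrable)
      (hM.convex.mono fun _ h => h _ _)
  have h2 : ∫ x, Θ x (k x) ∂μ - ∫ x, Θ x (f x) ∂μ ≤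
      2 * ∫ x, inner ℝ (ψ x (f x)) (k x - f x) ∂μ + 8 * ∫ x, Θ x (k x - f x) ∂μ := by
    rw [← integral_const_mul, ← integral_const_mul, ← integral_sub hk.integrable hf.integrable,
      ← integral_add (hi.const_mul 2) (hd.integrable.const_mul 8)]
    exact integral_mono_ae (hk.integrable.sub hf.integrable)
      ((hi.const_mul 2).add (hd.integrable.const_mul 8)) (hM.smooth.mono fun _ h => h _ _)
  rw [abs_le]
  constructor
  · linarith [hM.integral_nonneg fun x => k x - f x]
  · linarith

theorem tendsto_integral_of_sub (hM : IsModular μ β Θ ψ) (hf : FiniteModular μ Θ f)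
    (hv : ∀ᶠ i in l, FiniteModular μ Θ (v i))
    (h : Tendsto (fun i => ∫ x, Θ x (v i x - f x) ∂μ) l (𝓝 0)) :
    Tendsto (fun i => ∫ x, Θ x (v i x) ∂μ) l (𝓝 (∫ x, Θ x (f x) ∂μ)) := by
  have h1 := hM.tendsto_integral_inner hf (hv.mono fun i hi => hM.finite_sub hi hf) h
  have h2 : Tendsto (fun i => ∫ x, Θ x (v i x) ∂μ - ∫ x, Θ x (f x) ∂μ
      - 2 * ∫ x, inner ℝ (ψ x (f x)) (v i x - f x) ∂μ) l (𝓝 0) := by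
    refine squeeze_zero_norm' (hv.mono fun i hi => ?_)
      (show Tendsto (fun i => 8 * ∫ x, Θ x (v i x - f x) ∂μ) l (𝓝 0) by simpa using h.const_mul 8)
    exact hM.integral_expansion hf hi
  have h3 := (h2.add (h1.const_mul 2)).add_const (∫ x, Θ x (f x) ∂μ)
  simpa using h3

end Limits

/-- The modular is differentiable along a curve that is differentiable in the sense of the
modular; the remainder beyond the term linear in the increment is of order `|s - t|^β`. -/
theorem hasDerivAt_integral (hM : IsModular μ β Θ ψ) {v : ℝ → X → E} {t : ℝ} (ht : 0 < t)
    (hv : ∀ s, 0 ≤ s → FiniteModular μ Θ (v s)) (hf' : AEStronglyMeasurable f' μ)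
    (h : Tendsto (fun s => ∫⁻ x, ENNReal.ofReal (Θ x ((s - t)⁻¹ • (v s x - v t x) - f' x)) ∂μ)
      (𝓝[Ici 0 \ {t}] t) (𝓝 0)) :
    FiniteModular μ Θ f' ∧ HasDerivAt (fun s => ∫ x, Θ x (v s x) ∂μ)
      (2 * ∫ x, inner ℝ (ψ x (v t x)) (f' x) ∂μ) t := by
  have hfil : 𝓝[Ici 0 \ {t}] t = 𝓝[≠] t := by
    rw [sdiff_eq, nhdsWithin_inter_of_mem]
    exact mem_nhdsWithin_of_mem_nhds (Ici_mem_nhds ht)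
  rw [hfil] at h
  set r : ℝ → X → E := fun s x => (s - t)⁻¹ • (v s x - v t x) - f' x with hr
  have hvt := hv t ht.le
  have hpos : ∀ᶠ s in 𝓝[≠] t, 0 ≤ s :=
    mem_nhdsWithin_of_mem_nhds (Ici_mem_nhds ht)
  have hquot : ∀ s, 0 ≤ s → FiniteModular μ Θ (fun x => (s - t)⁻¹ • (v s x - v t x)) :=
    fun s hs => hM.finite_smul (hM.finite_sub (hv s hs) hvt) _
  have hrm : ∀ᶠ s in 𝓝[≠] t, AEStronglyMeasurable (r s) μ :=
    hpos.mono fun s hs => (hquot s hs).aesm.sub hf'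
  have hrf := hM.eventually_finite hrm h
  have hr0 := hM.tendsto_integral hrm h
  have hf'fin : FiniteModular μ Θ f' := by
    obtain ⟨s, hs, hs0⟩ := (hrf.and hpos).exists
    simpa [hr] using hM.finite_sub (hquot s hs0) hs
  refine ⟨hf'fin, ?_⟩
  have hin := hM.tendsto_integral_inner hvt hrf hr0
  rw [hasDerivAt_iff_tendsto_slope]
  have hsmall : Tendsto (fun s => |s - t|) (𝓝[≠] t) (𝓝 0) := by
    have : Tendsto (fun s => |s - t|) (𝓝 t) (𝓝 |t - t|) :=
      (by fun_prop : Continuous fun s => |s - t|).tendsto t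
    rw [sub_self, abs_zero] at this
    exact this.mono_left nhdsWithin_le_nhds
  have hrem : Tendsto (fun s => slope (fun s => ∫ x, Θ x (v s x) ∂μ) t s
      - 2 * (∫ x, inner ℝ (ψ x (v t x)) (f' x) ∂μ + ∫ x, inner ℝ (ψ x (v t x)) (r s x) ∂μ))
      (𝓝[≠] t) (𝓝 0) := by
    refine squeeze_zero_norm' (a := fun s => 128 * |s - t| ^ (β - 1) *
      (∫ x, Θ x (f' x) ∂μ + ∫ x, Θ x (r s x) ∂μ)) ?_ ?_
    · filter_upwards [hrf, hpos, self_mem_nhdsWithin,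
        hsmall.eventually (ge_mem_nhds one_pos)] with s h1 h2 h3 h4
      have hst : s - t ≠ 0 := sub_ne_zero.2 h3
      have habs : 0 < |s - t| := abs_pos.2 hst
      have e : ∀ x, v s x - v t x = (s - t) • (f' x + r s x) := fun x => by
        simp only [hr, add_sub_cancel, smul_smul, mul_inv_cancel₀ hst, one_smul]
      have hE := hM.integral_expansion hvt (hv s h2)
      simp only [e, real_inner_smul_right, inner_add_right] at hE
      rw [integral_const_mul, integral_add (hM.integrable_inner hvt hf'fin)
        (hM.integrable_inner hvt h1)] at hE
      have hB := hM.integral_smul_le (hM.finite_add hf'fin h1) habs h4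
      have hC := hM.integral_add_le hf'fin h1
      rw [slope_def_field, Real.norm_eq_abs]
      set I := ∫ x, inner ℝ (ψ x (v t x)) (f' x) ∂μ + ∫ x, inner ℝ (ψ x (v t x)) (r s x) ∂μ
      set Q := ∫ x, Θ x (f' x) ∂μ + ∫ x, Θ x (r s x) ∂μ
      have e2 : (∫ x, Θ x (v s x) ∂μ - ∫ x, Θ x (v t x) ∂μ) / (s - t) - 2 * I
          = (∫ x, Θ x (v s x) ∂μ - ∫ x, Θ x (v t x) ∂μ - 2 * ((s - t) * I)) / (s - t) := by
        field_simp
      rw [e2, abs_div, div_le_iff₀ habs]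
      have e3 : |s - t| ^ β = |s - t| ^ (β - 1) * |s - t| := by
        rw [← Real.rpow_add_one habs.ne']; simp
      have hβ : 0 ≤ |s - t| ^ β := by positivity
      calc _ ≤ 8 * (2 * |s - t| ^ β * (8 * Q)) := by
            refine hE.trans ?_
            have := mul_le_mul_of_nonneg_left hC (show 0 ≤ 2 * |s - t| ^ β by positivity)
            linarith
        _ = _ := by rw [e3]; ring
    · have h1 : Tendsto (fun s => |s - t| ^ (β - 1)) (𝓝[≠] t) (𝓝 0) := by
        have := hsmall.rpow_const (p := β - 1) (Or.inr (by linarith [hM.one_lt]))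
        rwa [Real.zero_rpow (by linarith [hM.one_lt])] at this
      simpa using (h1.const_mul 128).mul (hr0.const_add (∫ x, Θ x (f' x) ∂μ))
  have := hrem.add ((hin.const_add (∫ x, inner ℝ (ψ x (v t x)) (f' x) ∂μ)).const_mul 2)
  simpa using this

/-- A curve with a right derivative at `0` in the sense of the modular is continuous there. -/
theorem tendsto_sub_of_hasDeriv (hM : IsModular μ β Θ ψ) {v : ℝ → X → E}
    (hv : ∀ s, 0 ≤ s → AEStronglyMeasurable (v s) μ) (hf' : FiniteModular μ Θ f')
    (h : Tendsto (fun s => ∫⁻ x, ENNReal.ofReal (Θ x ((s - 0)⁻¹ • (v s x - v 0 x) - f' x)) ∂μ)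
      (𝓝[Ici 0 \ {0}] 0) (𝓝 0)) :
    Tendsto (fun s => ∫⁻ x, ENNReal.ofReal (Θ x (v s x - v 0 x)) ∂μ) (𝓝[>] 0) (𝓝 0) := by
  rw [Ici_sdiff_left] at h
  set r : ℝ → X → E := fun s x => (s - 0)⁻¹ • (v s x - v 0 x) - f' x with hr
  have hpos : ∀ᶠ s : ℝ in 𝓝[>] 0, 0 < s := self_mem_nhdsWithin
  have hrm : ∀ᶠ s in 𝓝[>] 0, AEStronglyMeasurable (r s) μ :=
    hpos.mono fun s hs => (((hv s hs.le).sub (hv 0 le_rfl)).const_smul _).sub hf'.aesm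
  have hrf := hM.eventually_finite hrm h
  have hr0 := hM.tendsto_integral hrm h
  have hs0 : Tendsto (fun s : ℝ => s) (𝓝[>] 0) (𝓝 0) := tendsto_id.mono_left nhdsWithin_le_nhds
  have hlim : Tendsto (fun s : ℝ => ENNReal.ofReal (16 * |s| ^ β *
      (∫ x, Θ x (f' x) ∂μ + ∫ x, Θ x (r s x) ∂μ))) (𝓝[>] 0) (𝓝 0) := by
    have h1 : Tendsto (fun s : ℝ => |s| ^ β) (𝓝[>] 0) (𝓝 0) := by
      have := hs0.abs.rpow_const (p := β) (Or.inr (by linarith [hM.one_lt]))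
      rwa [abs_zero, Real.zero_rpow (by linarith [hM.one_lt])] at this
    have h2 := (h1.const_mul 16).mul (hr0.const_add (∫ x, Θ x (f' x) ∂μ))
    simpa using ENNReal.tendsto_ofReal h2
  refine tendsto_of_tendsto_of_tendsto_of_le_of_le' tendsto_const_nhds hlim
    (Eventually.of_forall fun _ => zero_le) ?_
  filter_upwards [hpos, hrf, hs0.eventually (ge_mem_nhds one_pos)] with s h1 h2 h3
  have e : ∀ x, v s x - v 0 x = s • (f' x + r s x) := fun x => by
    simp only [hr, add_sub_cancel, smul_smul, sub_zero, mul_inv_cancel₀ h1.ne', one_smul]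
  have hfa := hM.finite_add hf' h2
  simp only [e]
  rw [hM.lintegral_eq (hM.finite_smul hfa s)]
  refine ENNReal.ofReal_le_ofReal ?_
  have habs : |s| = s := abs_of_pos h1
  have hB := hM.integral_smul_le hfa (h := s) (by rwa [habs]) (by rwa [habs])
  have hC := hM.integral_add_le hf' h2
  have := mul_le_mul_of_nonneg_left hC (show 0 ≤ 2 * |s| ^ β by positivity)
  linarith

end IsModular

end

/-! ### The two parts of the energy -/

section

variable {n N : ℕ} {α : Fin (N + 1) → ℝ} {U : Set (Space n)} {φ : Space n → ℝ}
  {a : Fin (N + 1) → Space n → ℝ}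

/-- The density `φ u²` of the first part of the energy. -/
abbrev sqDensity (φ : Space n → ℝ) (x : Space n) (u : ℝ) : ℝ := φ x * u ^ 2

/-- The density `H(x,|F|)` of the second part of the energy. -/
noncomputable abbrev gradDensity (α : Fin (N + 1) → ℝ) (a : Fin (N + 1) → Space n → ℝ)
    (x : Space n) (y : Space n) : ℝ := H α a x ‖y‖

theorem isModular_sq (hU : MeasurableSet U) (hα : IsExponents α) (ha : IsMedium U φ a) :
    IsModular (volume.restrict U) (2 - expo α) (sqDensity φ) (fun x u => φ x * u) := by
  have he0 := expo_pos hα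
  have he1 := expo_lt_one hα
  have hφ : ∀ᵐ x ∂volume.restrict U, 0 < φ x :=
    (ae_restrict_mem hU).mono ha.porosity_pos
  refine ⟨by linarith, ?_, ?_, ?_, ?_, ?_, ?_, ?_, ?_, ?_, ?_⟩
  · filter_upwards [hφ] with x hx y
    positivity
  · filter_upwards [hφ] with x hx y h h0 h1
    have : h ^ 2 ≤ h ^ (2 - expo α) := by
      rw [← Real.rpow_natCast]
      exact Real.rpow_le_rpow_of_exponent_ge h0 h1 (by push_cast; linarith)
    have hy : 0 ≤ φ x * y ^ 2 := by positivity
    have hp : 0 ≤ h ^ (2 - expo α) := by positivity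
    simp only [sqDensity, smul_eq_mul, mul_pow]
    nlinarith [mul_le_mul_of_nonneg_right this hy, mul_nonneg hp hy]
  · filter_upwards [hφ] with x hx y c
    have hy : 0 ≤ φ x * y ^ 2 := by positivity
    simp only [sqDensity, smul_eq_mul, mul_pow]
    nlinarith [mul_nonneg (sq_nonneg c) hy]
  · exact Eventually.of_forall fun x y => by simp [sqDensity]
  · filter_upwards [hφ] with x hx y z
    simp only [sqDensity]
    have : (y - z) ^ 2 ≤ 8 * (y ^ 2 + z ^ 2) := by nlinarith [sq_nonneg (y + z)]
    nlinarith
  · filter_upwards [hφ] with x hx y z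
    simp only [sqDensity, RCLike.inner_apply, conj_trivial]
    nlinarith [mul_nonneg hx.le (sq_nonneg (z - y))]
  · filter_upwards [hφ] with x hx y z
    simp only [sqDensity, RCLike.inner_apply, conj_trivial]
    nlinarith [mul_nonneg hx.le (sq_nonneg (z - y))]
  · filter_upwards [hφ] with x hx y z δ h0 h1
    simp only [sqDensity, RCLike.inner_apply, conj_trivial]
    have e : δ * (φ x * y ^ 2) + δ⁻¹ * (φ x * z ^ 2) =
        φ x * δ⁻¹ * ((δ * |y|) ^ 2 + |z| ^ 2) := by
      rw [mul_pow, sq_abs, sq_abs]; field_simp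
    rw [e, abs_mul, abs_mul, abs_of_pos hx]
    calc |z| * (φ x * |y|) = φ x * δ⁻¹ * (δ * |y| * |z|) := by field_simp
      _ ≤ _ := by
        gcongr
        nlinarith [sq_nonneg (δ * |y| - |z|), abs_nonneg y, abs_nonneg z,
          mul_nonneg (mul_nonneg h0.le (abs_nonneg y)) (abs_nonneg z)]
  · exact fun f hf => (ha.porosity_measurable.aestronglyMeasurable).mul (hf.pow 2)
  · exact fun f hf => (ha.porosity_measurable.aestronglyMeasurable).mul hf

theorem isModular_grad (hU : MeasurableSet U) (hα : IsExponents α) (ha : IsMedium U φ a) :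
    IsModular (volume.restrict U) (2 - expo α) (gradDensity α a) (flux α a) := by
  have hmem : ∀ᵐ x ∂volume.restrict U, x ∈ U := ae_restrict_mem hU
  refine ⟨by linarith [expo_lt_one hα], ?_, ?_, ?_, ?_, ?_, ?_, ?_, ?_, ?_, ?_⟩
  · exact hmem.mono fun x hx y => H_nonneg hα ha hx (norm_nonneg y)
  · filter_upwards [hmem] with x hx y h h0 h1
    have := H_scale_le_one hα ha hx (norm_nonneg y) h0 h1
    rwa [← abs_of_pos h0, ← Real.norm_eq_abs, ← norm_smul, Real.norm_eq_abs,
      abs_of_pos h0] at this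
  · exact hmem.mono fun x hx y c => H_norm_smul_le hα ha hx c y
  · exact Eventually.of_forall fun x y => by simp [gradDensity]
  · exact hmem.mono fun x hx => H_norm_sub_le hα ha hx
  · exact hmem.mono fun x hx => H_norm_sub_ge hα ha hx
  · exact hmem.mono fun x hx => H_norm_sub_le_add hα ha hx
  · exact hmem.mono fun x hx y z δ h0 h1 => abs_inner_flux_le hα ha hx y z h0 h1
  · exact fun f hf =>
      (aemeasurable_H hU hα ha hf.norm.aemeasurable fun _ => norm_nonneg _).aestronglyMeasurable
  · exact fun f hf => aestronglyMeasurable_flux hU hα ha hf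

theorem tendsto_val_of_energy {ι : Type*} {l : Filter ι} {u : ι → Space n → ℝ}
    {F : ι → Space n → Space n}
    (h : Tendsto (fun i => energy U φ α a (u i) (F i)) l (𝓝 0)) :
    Tendsto (fun i => ∫⁻ x in U, ENNReal.ofReal (sqDensity φ x (u i x))) l (𝓝 0) :=
  tendsto_of_tendsto_of_tendsto_of_le_of_le tendsto_const_nhds h (fun _ => zero_le)
    fun _ => le_self_add

theorem tendsto_grad_of_energy {ι : Type*} {l : Filter ι} {u : ι → Space n → ℝ}
    {F : ι → Space n → Space n}
    (h : Tendsto (fun i => energy U φ α a (u i) (F i)) l (𝓝 0)) :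
    Tendsto (fun i => ∫⁻ x in U, ENNReal.ofReal (gradDensity α a x (F i x))) l (𝓝 0) :=
  tendsto_of_tendsto_of_tendsto_of_le_of_le tendsto_const_nhds h (fun _ => zero_le)
    fun _ => le_add_self

theorem energy_sub_le (hU : MeasurableSet U) (hα : IsExponents α) (ha : IsMedium U φ a)
    {u v : Space n → ℝ} {F E : Space n → Space n}
    (hu : AEStronglyMeasurable u (volume.restrict U))
    (hF : AEStronglyMeasurable F (volume.restrict U)) :
    energy U φ α a (fun x => u x - v x) (fun x => F x - E x) ≤
      8 * (energy U φ α a u F + energy U φ α a v E) := by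
  refine (add_le_add ((isModular_sq hU hα ha).lintegral_sub_le hu v)
    ((isModular_grad hU hα ha).lintegral_sub_le hF E)).trans (le_of_eq ?_)
  simp only [energy]
  ring

theorem HasWeakGradient.aesm {u : Space n → ℝ} {F : Space n → Space n}
    (h : HasWeakGradient U u F) : AEStronglyMeasurable u (volume.restrict U) :=
  h.locallyIntegrable.aestronglyMeasurable

theorem HasWeakGradient.aesm_grad {u : Space n → ℝ} {F : Space n → Space n}
    (h : HasWeakGradient U u F) : AEStronglyMeasurable F (volume.restrict U) :=
  h.locallyIntegrable_grad.aestronglyMeasurable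

theorem HasTimeDerivAt.sub (hU : MeasurableSet U) (hα : IsExponents α) (ha : IsMedium U φ a)
    {u v : Evolution n} {t : ℝ} (ht : 0 ≤ t)
    (hu : ∀ s, 0 ≤ s → HasWeakGradient U (u.val s) (u.grad s))
    (hu' : HasWeakGradient U (u.dt t) (u.gradDt t))
    (h1 : HasTimeDerivAt U φ α a u t) (h2 : HasTimeDerivAt U φ α a v t) :
    HasTimeDerivAt U φ α a (u - v) t := by
  have h := ENNReal.Tendsto.const_mul (a := 8) (h1.add h2) (Or.inr (by simp))
  rw [add_zero, mul_zero] at h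
  refine tendsto_of_tendsto_of_tendsto_of_le_of_le' tendsto_const_nhds h
    (Eventually.of_forall fun _ => zero_le) ?_
  filter_upwards [self_mem_nhdsWithin] with s hs
  have hs0 : 0 ≤ s := hs.1
  refine le_trans (le_of_eq ?_) (energy_sub_le hU hα ha
    ((((hu s hs0).aesm.sub (hu t ht).aesm).const_mul (s - t)⁻¹).sub hu'.aesm)
    ((((hu s hs0).aesm_grad.sub (hu t ht).aesm_grad).const_smul (s - t)⁻¹).sub hu'.aesm_grad))
  congr 1
  · funext x
    change (s - t)⁻¹ * ((u.val s x - v.val s x) - (u.val t x - v.val t x))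
      - (u.dt t x - v.dt t x) = _
    ring
  · funext x
    change (s - t)⁻¹ • ((u.grad s x - v.grad s x) - (u.grad t x - v.grad t x))
      - (u.gradDt t x - v.gradDt t x) = _
    module

/-- Membership in the energy space. -/
structure FiniteEnergy (U : Set (Space n)) (φ : Space n → ℝ) (α : Fin (N + 1) → ℝ)
    (a : Fin (N + 1) → Space n → ℝ) (u : Space n → ℝ) (F : Space n → Space n) : Prop where
  val : FiniteModular (volume.restrict U) (sqDensity φ) u
  grad : FiniteModular (volume.restrict U) (gradDensity α a) F

/-! ### The weak formulation -/

/-- The pairing of `(w,G)` with `(u,F)` in the weak formulation of `φ w = ∇ · (K(x,|G|) G)`. -/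
noncomputable def weakForm (U : Set (Space n)) (φ : Space n → ℝ) (α : Fin (N + 1) → ℝ)
    (a : Fin (N + 1) → Space n → ℝ) (w : Space n → ℝ) (G : Space n → Space n)
    (u : Space n → ℝ) (F : Space n → Space n) : ℝ :=
  (∫ x in U, inner ℝ (φ x * w x) (u x)) + ∫ x in U, inner ℝ (flux α a x (G x)) (F x)

section WeakForm

variable {w u v : Space n → ℝ} {G F E : Space n → Space n}

theorem weakForm_sub (hU : MeasurableSet U) (hα : IsExponents α) (ha : IsMedium U φ a)
    (hw : FiniteEnergy U φ α a w G) (hu : FiniteEnergy U φ α a u F)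
    (hv : FiniteEnergy U φ α a v E) :
    weakForm U φ α a w G (fun x => u x - v x) (fun x => F x - E x) =
      weakForm U φ α a w G u F - weakForm U φ α a w G v E := by
  have h1 := isModular_sq hU hα ha
  have h2 := isModular_grad hU hα ha
  simp only [weakForm, inner_sub_right]
  rw [integral_sub (h1.integrable_inner hw.val hu.val) (h1.integrable_inner hw.val hv.val),
    integral_sub (h2.integrable_inner hw.grad hu.grad) (h2.integrable_inner hw.grad hv.grad)]
  ring

theorem weakForm_smul (c : ℝ) :
    weakForm U φ α a w G (fun x => c * u x) (fun x => c • F x) =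
      c * weakForm U φ α a w G u F := by
  have : ∀ x, inner ℝ (φ x * w x) (c * u x) = c * inner ℝ (φ x * w x) (u x) := fun x => by
    rw [← smul_eq_mul c (u x), real_inner_smul_right]
  simp only [weakForm, real_inner_smul_right, this, integral_const_mul]
  ring

theorem tendsto_weakForm (hU : MeasurableSet U) (hα : IsExponents α) (ha : IsMedium U φ a)
    (hw : FiniteEnergy U φ α a w G) {ι : Type*} {l : Filter ι} {u : ι → Space n → ℝ}
    {F : ι → Space n → Space n} (hu : ∀ᶠ i in l, AEStronglyMeasurable (u i) (volume.restrict U))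
    (hF : ∀ᶠ i in l, AEStronglyMeasurable (F i) (volume.restrict U))
    (h : Tendsto (fun i => energy U φ α a (u i) (F i)) l (𝓝 0)) :
    (∀ᶠ i in l, FiniteEnergy U φ α a (u i) (F i)) ∧
    Tendsto (fun i => weakForm U φ α a w G (u i) (F i)) l (𝓝 0) := by
  have h1 := isModular_sq hU hα ha
  have h2 := isModular_grad hU hα ha
  have hv := tendsto_val_of_energy h
  have hg := tendsto_grad_of_energy h
  have f1 := h1.eventually_finite hu hv
  have f2 := h2.eventually_finite hF hg
  refine ⟨by filter_upwards [f1, f2] with i a1 a2 using ⟨a1, a2⟩, ?_⟩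
  have h3 := (h1.tendsto_integral_inner hw.val f1 (h1.tendsto_integral hu hv)).add
    (h2.tendsto_integral_inner hw.grad f2 (h2.tendsto_integral hF hg))
  rwa [add_zero] at h3

theorem IsTestFunction.continuous_gradient {η : Space n → ℝ} (h : IsTestFunction U η) :
    Continuous (gradient η) :=
  (LinearIsometryEquiv.continuous _).comp (h.1.continuous_fderiv (by simp))

/-- If the weak form vanishes on test functions, it vanishes on all functions of finite energy
with zero boundary values. -/
theorem weakForm_eq_zero (hU : MeasurableSet U) (hα : IsExponents α) (ha : IsMedium U φ a)
    (hw : FiniteEnergy U φ α a w G)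
    (heq : ∀ η, IsTestFunction U η → weakForm U φ α a w G η (gradient η) = 0)
    (hu : FiniteEnergy U φ α a u F) (hb : VanishesOnBoundary U φ α a u F) :
    weakForm U φ α a w G u F = 0 := by
  have hε : ∀ k : ℕ, (0 : ℝ≥0∞) < ((k : ℝ≥0∞) + 1)⁻¹ := fun k => by simp
  choose η hη hlt using fun k => hb.2 _ (hε k)
  have hlim : Tendsto (fun k : ℕ => ((k : ℝ≥0∞) + 1)⁻¹) atTop (𝓝 0) := by
    have := (tendsto_add_atTop_iff_nat 1).2 ENNReal.tendsto_inv_nat_nhds_zero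
    simpa using this
  have hen := tendsto_of_tendsto_of_tendsto_of_le_of_le tendsto_const_nhds hlim
    (fun _ => zero_le) fun k => (hlt k).le
  obtain ⟨hfin, h0⟩ := tendsto_weakForm hU hα ha hw
    (Eventually.of_forall fun k => hu.val.aesm.sub (hη k).1.continuous.aestronglyMeasurable)
    (Eventually.of_forall fun k =>
      hu.grad.aesm.sub (hη k).continuous_gradient.aestronglyMeasurable) hen
  have hconst : Tendsto (fun _ : ℕ => weakForm U φ α a w G u F) atTop (𝓝 0) := by
    refine h0.congr' ?_
    filter_upwards [hfin] with k hk
    have hηfin : FiniteEnergy U φ α a (η k) (gradient (η k)) :=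
      ⟨by simpa using (isModular_sq hU hα ha).finite_sub hu.val hk.val,
        by simpa using (isModular_grad hU hα ha).finite_sub hu.grad hk.grad⟩
    exact (weakForm_sub hU hα ha hw hu hηfin).trans (by rw [heq _ (hη k), sub_zero])
  exact tendsto_nhds_unique tendsto_const_nhds hconst

end WeakForm

end

/-! ### Regularity of boundary data and solutions -/

section

variable {n N : ℕ} {α : Fin (N + 1) → ℝ} {U : Set (Space n)} {φ : Space n → ℝ}
  {a : Fin (N + 1) → Space n → ℝ} {Ψ p : Evolution n} {t : ℝ}

theorem finite_of_integrable_inv (hU : MeasurableSet U) (hα : IsExponents α)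
    (ha : IsMedium U φ a) {F : Space n → Space n}
    (hF : AEStronglyMeasurable F (volume.restrict U))
    (h : IntegrableOn (fun x => (a 0 x)⁻¹ * ‖F x‖ ^ 2) U) :
    FiniteModular (volume.restrict U) (gradDensity α a) F :=
  (isModular_grad hU hα ha).finite_of_le hF (h.const_mul 2)
    ((ae_restrict_mem hU).mono fun _ hx => H_le_inv hα ha hx (norm_nonneg _))

namespace IsBoundaryData

theorem finite_grad (hU : MeasurableSet U) (hα : IsExponents α) (ha : IsMedium U φ a)
    (hΨ : IsBoundaryData U φ α a Ψ) (ht : 0 ≤ t) :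
    FiniteModular (volume.restrict U) (gradDensity α a) (Ψ.grad t) :=
  finite_of_integrable_inv hU hα ha (hΨ.weakGradient t ht).aesm_grad (hΨ.integrable_grad_sq t ht)

theorem finite_dt (hΨ : IsBoundaryData U φ α a Ψ) (ht : 0 ≤ t) :
    FiniteModular (volume.restrict U) (sqDensity φ) (Ψ.dt t) :=
  ⟨(hΨ.weakGradient_dt t ht).aesm, (hΨ.integrable_dt_sq t ht).congr
    (Eventually.of_forall fun _ => mul_comm _ _)⟩

theorem finite_gradDt (hU : MeasurableSet U) (hα : IsExponents α) (ha : IsMedium U φ a)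
    (hΨ : IsBoundaryData U φ α a Ψ) (ht : 0 ≤ t) :
    FiniteModular (volume.restrict U) (gradDensity α a) (Ψ.gradDt t) :=
  finite_of_integrable_inv hU hα ha (hΨ.weakGradient_dt t ht).aesm_grad
    (hΨ.integrable_gradDt_sq t ht)

end IsBoundaryData

namespace IsSolution

theorem finite_grad (hs : IsSolution U φ α a Ψ p) (ht : 0 ≤ t) :
    FiniteModular (volume.restrict U) (gradDensity α a) (p.grad t) :=
  ⟨(hs.weakGradient t ht).aesm_grad, hs.integrable_H t ht⟩

/-- `p - Ψ` has finite energy. -/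
theorem finite_bar (hU : MeasurableSet U) (hα : IsExponents α) (ha : IsMedium U φ a)
    (hΨ : IsBoundaryData U φ α a Ψ) (hs : IsSolution U φ α a Ψ p) (ht : 0 ≤ t) :
    FiniteEnergy U φ α a ((p - Ψ).val t) ((p - Ψ).grad t) :=
  ⟨⟨(hs.weakGradient t ht).aesm.sub (hΨ.weakGradient t ht).aesm, hs.integrable_sq t ht⟩,
    (isModular_grad hU hα ha).finite_sub (hs.finite_grad ht) (hΨ.finite_grad hU hα ha ht)⟩

theorem hasTimeDeriv_bar (hU : MeasurableSet U) (hα : IsExponents α) (ha : IsMedium U φ a)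
    (hΨ : IsBoundaryData U φ α a Ψ) (hs : IsSolution U φ α a Ψ p) (ht : 0 < t) :
    HasTimeDerivAt U φ α a (p - Ψ) t :=
  HasTimeDerivAt.sub hU hα ha ht.le hs.weakGradient (hs.weakGradient_dt t ht)
    (hs.hasTimeDeriv t ht) (hΨ.hasTimeDeriv t ht.le)

theorem aesm_bar_dt (hΨ : IsBoundaryData U φ α a Ψ) (hs : IsSolution U φ α a Ψ p) (ht : 0 < t) :
    AEStronglyMeasurable ((p - Ψ).dt t) (volume.restrict U) :=
  (hs.weakGradient_dt t ht).aesm.sub (hΨ.weakGradient_dt t ht.le).aesm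

theorem hasDerivAt_H (hU : MeasurableSet U) (hα : IsExponents α) (ha : IsMedium U φ a)
    (hs : IsSolution U φ α a Ψ p) (ht : 0 < t) :
    FiniteModular (volume.restrict U) (gradDensity α a) (p.gradDt t) ∧
    HasDerivAt (fun s => ∫ x in U, H α a x ‖p.grad s x‖)
      (2 * ∫ x in U, inner ℝ (flux α a x (p.grad t x)) (p.gradDt t x)) t :=
  (isModular_grad hU hα ha).hasDerivAt_integral ht (fun _ h => hs.finite_grad h)
    (hs.weakGradient_dt t ht).aesm_grad (tendsto_grad_of_energy (hs.hasTimeDeriv t ht))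

theorem finite_bar_dt (hU : MeasurableSet U) (hα : IsExponents α) (ha : IsMedium U φ a)
    (hΨ : IsBoundaryData U φ α a Ψ) (hs : IsSolution U φ α a Ψ p) (ht : 0 < t) :
    FiniteEnergy U φ α a ((p - Ψ).dt t) ((p - Ψ).gradDt t) :=
  ⟨((isModular_sq hU hα ha).hasDerivAt_integral ht
    (fun _ h => (hs.finite_bar hU hα ha hΨ h).val) (hs.aesm_bar_dt hΨ ht)
    (tendsto_val_of_energy (hs.hasTimeDeriv_bar hU hα ha hΨ ht))).1,
    (isModular_grad hU hα ha).finite_sub (hs.hasDerivAt_H hU hα ha ht).1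
      (hΨ.finite_gradDt hU hα ha ht.le)⟩

/-- `(p_t, ∇p)` has finite energy. -/
theorem finite_dt (hU : MeasurableSet U) (hα : IsExponents α) (ha : IsMedium U φ a)
    (hΨ : IsBoundaryData U φ α a Ψ) (hs : IsSolution U φ α a Ψ p) (ht : 0 < t) :
    FiniteEnergy U φ α a (p.dt t) (p.grad t) := by
  refine ⟨?_, hs.finite_grad ht.le⟩
  have h : (fun x => (p - Ψ).dt t x + Ψ.dt t x) = p.dt t := by
    funext x
    change p.dt t x - Ψ.dt t x + Ψ.dt t x = _
    ring
  rw [← h]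
  exact (isModular_sq hU hα ha).finite_add (hs.finite_bar_dt hU hα ha hΨ ht).val
    (hΨ.finite_dt ht.le)

/-- The equation holds when tested with any function of finite energy vanishing on the boundary. -/
theorem weakForm_eq_zero (hU : MeasurableSet U) (hα : IsExponents α) (ha : IsMedium U φ a)
    (hΨ : IsBoundaryData U φ α a Ψ) (hs : IsSolution U φ α a Ψ p) (ht : 0 < t)
    {u : Space n → ℝ} {F : Space n → Space n} (hu : FiniteEnergy U φ α a u F)
    (hb : VanishesOnBoundary U φ α a u F) :
    weakForm U φ α a (p.dt t) (p.grad t) u F = 0 := by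
  refine Forchheimer.weakForm_eq_zero hU hα ha (hs.finite_dt hU hα ha hΨ ht) (fun η hη => ?_) hu hb
  have h := hs.equation t ht η hη
  have e : ∀ x, inner ℝ (φ x * p.dt t x) (η x) = φ x * p.dt t x * η x := fun x => by
    simp [mul_comm]
  simp only [weakForm, e, h, flux]
  ring

/-- The equation may be tested with `p_t - Ψ_t`, a limit in energy of difference quotients of
`p - Ψ`. -/
theorem weakForm_bar_dt (hU : MeasurableSet U) (hα : IsExponents α) (ha : IsMedium U φ a)
    (hΨ : IsBoundaryData U φ α a Ψ) (hs : IsSolution U φ α a Ψ p) (ht : 0 < t) :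
    weakForm U φ α a (p.dt t) (p.grad t) ((p - Ψ).dt t) ((p - Ψ).gradDt t) = 0 := by
  have hw := hs.finite_dt hU hα ha hΨ ht
  have hd := hs.finite_bar_dt hU hα ha hΨ ht
  have h1 := isModular_sq hU hα ha
  have h2 := isModular_grad hU hα ha
  have hfil : 𝓝[>] t ≤ 𝓝[Ici 0 \ {t}] t :=
    nhdsWithin_mono t fun s hst => ⟨ht.le.trans (le_of_lt hst), ne_of_gt hst⟩
  have hen := (hs.hasTimeDeriv_bar hU hα ha hΨ ht).mono_left hfil
  have hq : ∀ s, 0 < s → FiniteEnergy U φ α a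
      (fun x => (s - t)⁻¹ * ((p - Ψ).val s x - (p - Ψ).val t x))
      (fun x => (s - t)⁻¹ • ((p - Ψ).grad s x - (p - Ψ).grad t x)) := fun s h =>
    ⟨h1.finite_smul (h1.finite_sub (hs.finite_bar hU hα ha hΨ h.le).val
        (hs.finite_bar hU hα ha hΨ ht.le).val) _,
      h2.finite_smul (h2.finite_sub (hs.finite_bar hU hα ha hΨ h.le).grad
        (hs.finite_bar hU hα ha hΨ ht.le).grad) _⟩
  have hpos : ∀ᶠ s in 𝓝[>] t, 0 < s :=
    eventually_nhdsWithin_of_forall fun s hst => ht.trans hst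
  have h0 := (tendsto_weakForm hU hα ha hw
    (hpos.mono fun s h => (hq s h).val.aesm.sub hd.val.aesm)
    (hpos.mono fun s h => (hq s h).grad.aesm.sub hd.grad.aesm) hen).2
  have hconst : Tendsto (fun _ : ℝ => -weakForm U φ α a (p.dt t) (p.grad t)
      ((p - Ψ).dt t) ((p - Ψ).gradDt t)) (𝓝[>] t) (𝓝 0) := by
    refine h0.congr' ?_
    filter_upwards [hpos] with s h
    refine (weakForm_sub hU hα ha hw (hq s h) hd).trans ?_
    rw [weakForm_smul,
      weakForm_sub hU hα ha hw (hs.finite_bar hU hα ha hΨ h.le) (hs.finite_bar hU hα ha hΨ ht.le),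
      hs.weakForm_eq_zero hU hα ha hΨ ht (hs.finite_bar hU hα ha hΨ h.le) (hs.boundary s h),
      hs.weakForm_eq_zero hU hα ha hΨ ht (hs.finite_bar hU hα ha hΨ ht.le) (hs.boundary t ht)]
    ring
  exact neg_eq_zero.1 (tendsto_nhds_unique tendsto_const_nhds hconst)

theorem tendsto_bar_zero (hU : MeasurableSet U) (hα : IsExponents α) (ha : IsMedium U φ a)
    (hΨ : IsBoundaryData U φ α a Ψ) (hs : IsSolution U φ α a Ψ p) :
    Tendsto (fun s => ∫⁻ x in U,
      ENNReal.ofReal (sqDensity φ x ((p - Ψ).val s x - (p - Ψ).val 0 x))) (𝓝[>] 0) (𝓝 0) := by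
  have h1 := isModular_sq hU hα ha
  have hp := tendsto_val_of_energy hs.continuous_zero
  have hΨ' := h1.tendsto_sub_of_hasDeriv (fun s h => (hΨ.weakGradient s h).aesm)
    (hΨ.finite_dt le_rfl) (tendsto_val_of_energy (hΨ.hasTimeDeriv 0 le_rfl))
  refine (h1.tendsto_lintegral_sub ?_ hp hΨ').congr fun s => ?_
  · exact eventually_nhdsWithin_of_forall fun s h =>
      (hs.weakGradient s (le_of_lt h)).aesm.sub (hs.weakGradient 0 le_rfl).aesm
  · congr 1
    funext x
    congr 2
    change _ = p.val s x - Ψ.val s x - (p.val 0 x - Ψ.val 0 x)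
    ring

theorem continuousOn_H (hU : MeasurableSet U) (hα : IsExponents α) (ha : IsMedium U φ a)
    (hs : IsSolution U φ α a Ψ p) :
    ContinuousOn (fun s => ∫ x in U, H α a x ‖p.grad s x‖) (Ici 0) := by
  have h2 := isModular_grad hU hα ha
  refine continuousOn_Ici_of_tendsto
    (fun t ht => (hs.hasDerivAt_H hU hα ha ht).2.continuousAt) ?_
  have hpos : ∀ᶠ s : ℝ in 𝓝[>] 0, 0 < s := self_mem_nhdsWithin
  exact h2.tendsto_integral_of_sub (hs.finite_grad le_rfl)
    (hpos.mono fun s h => hs.finite_grad h.le)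
    (h2.tendsto_integral (hpos.mono fun s h => (h2.finite_sub (hs.finite_grad h.le)
      (hs.finite_grad le_rfl)).aesm) (tendsto_grad_of_energy hs.continuous_zero))

end IsSolution

end

/-! ### Energy inequalities for a single solution -/

section

variable {n N : ℕ} {α : Fin (N + 1) → ℝ} {U : Set (Space n)} {φ : Space n → ℝ}
  {a : Fin (N + 1) → Space n → ℝ} {Ψ p : Evolution n} {t : ℝ}

/-- Young's inequality with a small parameter, for the exponents `q` and `1 + 1/(q-1)`. -/
theorem two_mul_le_young {q ε Y V : ℝ} (hq : 1 < q) (hε : 0 < ε) (hY : 0 ≤ Y) (hV : 0 ≤ V) :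
    2 * (Y * V) ≤ ε * Y ^ q + 2 * (2 / ε) ^ (1 / (q - 1)) * V ^ (1 + 1 / (q - 1)) := by
  have hq1 : 0 < q - 1 := by linarith
  have hr1 : 0 ≤ Y ^ q := by positivity
  have hr2 : 0 ≤ 2 * (2 / ε) ^ (1 / (q - 1)) * V ^ (1 + 1 / (q - 1)) := by positivity
  rcases le_total V (ε / 2 * Y ^ (q - 1)) with h | h
  · rcases hY.eq_or_lt with rfl | hY
    · rw [zero_mul, mul_zero]; positivity
    have e : Y ^ q = Y ^ (q - 1) * Y := by rw [← Real.rpow_add_one hY.ne']; simp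
    have : 2 * (Y * V) ≤ ε * Y ^ q := by
      rw [e]; nlinarith
    linarith
  · rcases hV.eq_or_lt with rfl | hV
    · rw [mul_zero, mul_zero]; positivity
    have h0 : Y ^ (q - 1) ≤ 2 / ε * V := by
      calc Y ^ (q - 1) = 2 / ε * (ε / 2 * Y ^ (q - 1)) := by field_simp
        _ ≤ _ := by gcongr
    have h1 : Y ≤ (2 / ε * V) ^ (1 / (q - 1)) := by
      calc Y = (Y ^ (q - 1)) ^ (1 / (q - 1)) := by
            rw [← Real.rpow_mul hY, mul_one_div_cancel hq1.ne', Real.rpow_one]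
        _ ≤ _ := by gcongr
    have : 2 * (Y * V) ≤ 2 * (2 / ε) ^ (1 / (q - 1)) * V ^ (1 + 1 / (q - 1)) := by
      rw [Real.rpow_add hV, Real.rpow_one]
      rw [Real.mul_rpow (by positivity) hV.le] at h1
      calc 2 * (Y * V) ≤ 2 * ((2 / ε) ^ (1 / (q - 1)) * V ^ (1 / (q - 1)) * V) := by gcongr
        _ = _ := by ring
    have : 0 ≤ ε * Y ^ q := by positivity
    linarith

theorem weightedNorm_two (U : Set (Space n)) (φ u : Space n → ℝ) :
    weightedNorm U φ 2 u = √(∫ x in U, sqDensity φ x (u x)) := by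
  rw [weightedNorm, Real.sqrt_eq_rpow]
  congr 2
  funext x
  rw [show (2 : ℝ) = ((2 : ℕ) : ℝ) by norm_num, Real.rpow_natCast, sq_abs]

theorem weightedNorm_two_sq (hU : MeasurableSet U) (hα : IsExponents α) (ha : IsMedium U φ a)
    (u : Space n → ℝ) : weightedNorm U φ 2 u ^ 2 = ∫ x in U, sqDensity φ x (u x) := by
  rw [weightedNorm_two, Real.sq_sqrt ((isModular_sq hU hα ha).integral_nonneg u)]

theorem abs_integral_mul_le (hU : MeasurableSet U) (hα : IsExponents α) (ha : IsMedium U φ a)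
    {u v : Space n → ℝ} (hu : FiniteModular (volume.restrict U) (sqDensity φ) u)
    (hv : FiniteModular (volume.restrict U) (sqDensity φ) v) :
    |∫ x in U, inner ℝ (φ x * u x) (v x)| ≤
      √(∫ x in U, sqDensity φ x (u x)) * √(∫ x in U, sqDensity φ x (v x)) := by
  have hM := isModular_sq hU hα ha
  refine abs_integral_le_integral_abs.trans ?_
  refine integral_le_sqrt_mul_sqrt hu.integrable hv.integrable
    (hM.nonneg.mono fun _ h => h _) (hM.nonneg.mono fun _ h => h _)
    (Eventually.of_forall fun _ => abs_nonneg _) (Eventually.of_forall fun x => le_of_eq ?_)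
  simp only [RCLike.inner_apply, conj_trivial, sq_abs]
  ring

theorem W₁_mul_rpow_le_H (hα : IsExponents α) (ha : IsMedium U φ a) {x : Space n} (hx : x ∈ U)
    {ξ : ℝ} (hξ : 0 ≤ ξ) :
    W₁ α a x * ξ ^ (2 - expo α) ≤ H α a x ξ + a (Fin.last N) x := by
  have he0 := expo_pos hα
  have he1 := expo_lt_one hα
  have hK := K_pos hα ha hx hξ
  have hA := ha.coeff_last_pos x hx
  have h := Real.geom_mean_le_arith_mean2_weighted (w₁ := (2 - expo α) / 2)
    (w₂ := 1 - (2 - expo α) / 2) (p₁ := K α a x ξ * ξ ^ 2)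
    (p₂ := a (Fin.last N) x + K α a x ξ * ξ ^ 2) (by linarith) (by linarith)
    (by positivity) (by positivity) (by ring)
  have h1 := W₁_mul_rpow_le hα ha hx hξ hξ
  have h2 := le_H hα ha hx hξ
  nlinarith

theorem W₁_mul_sub_rpow_le (hα : IsExponents α) (ha : IsMedium U φ a) {x : Space n} (hx : x ∈ U)
    (y z : Space n) :
    W₁ α a x * ‖y - z‖ ^ (2 - expo α) ≤
      4 * (H α a x ‖y‖ + a (Fin.last N) x + W₁ α a x * ‖z‖ ^ (2 - expo α)) := by
  have he0 := expo_pos hα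
  have he1 := expo_lt_one hα
  have hW := W₁_nonneg (α := α) ha hx
  have hsub := norm_sub_le y z
  have h2 : (2 : ℝ) ^ (2 - expo α) ≤ 4 := by
    calc (2 : ℝ) ^ (2 - expo α) ≤ 2 ^ (2 : ℝ) :=
          Real.rpow_le_rpow_of_exponent_le one_le_two (by linarith)
      _ = 4 := by norm_num
  have hmax : ‖y - z‖ ^ (2 - expo α) ≤ 4 * (‖y‖ ^ (2 - expo α) + ‖z‖ ^ (2 - expo α)) := by
    have hy : 0 ≤ ‖y‖ ^ (2 - expo α) := by positivity
    have hz : 0 ≤ ‖z‖ ^ (2 - expo α) := by positivity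
    have key : ∀ b : ℝ, 0 ≤ b → ‖y - z‖ ≤ 2 * b →
        ‖y - z‖ ^ (2 - expo α) ≤ 4 * b ^ (2 - expo α) := fun b hb h => by
      refine (Real.rpow_le_rpow (norm_nonneg _) h (by linarith)).trans ?_
      rw [Real.mul_rpow zero_le_two hb]
      gcongr
    rcases le_total ‖y‖ ‖z‖ with h | h
    · have := key ‖z‖ (norm_nonneg _) (by linarith)
      linarith
    · have := key ‖y‖ (norm_nonneg _) (by linarith)
      linarith
  have h3 := W₁_mul_rpow_le_H hα ha hx (norm_nonneg y)
  have := mul_le_mul_of_nonneg_left hmax hW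
  nlinarith

theorem integral_coeff_last_le_Bstar : ∫ x in U, a (Fin.last N) x ≤ Bstar U a :=
  le_max_left _ _

/-- The terms of `G` are nonnegative. -/
theorem G_terms_nonneg (hU : MeasurableSet U) (ha : IsMedium U φ a) (Ψ : Evolution n) (t : ℝ) :
    0 ≤ (∫ x in U, (a 0 x)⁻¹ * ‖Ψ.grad t x‖ ^ 2) ∧
    0 ≤ (∫ x in U, W₁ α a x * ‖Ψ.grad t x‖ ^ (2 - expo α)) ∧
    0 ≤ ∫ x in U, Ψ.dt t x ^ 2 * φ x := by
  refine ⟨setIntegral_nonneg hU fun x hx => ?_, setIntegral_nonneg hU fun x hx => ?_,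
    setIntegral_nonneg hU fun x hx => ?_⟩
  · have := ha.coeff_zero_pos x hx
    positivity
  · have := W₁_nonneg (α := α) ha hx
    positivity
  · have := ha.porosity_pos x hx
    positivity

theorem integral_dt_sq_eq (U : Set (Space n)) (φ : Space n → ℝ) (u : Space n → ℝ) :
    ∫ x in U, u x ^ 2 * φ x = ∫ x in U, sqDensity φ x (u x) := by
  simp only [sqDensity, mul_comm]

namespace IsSolution

/-- The Poincaré–Sobolev inequality bounds `‖p - Ψ‖` by the energy and the data. -/
theorem rpow_le_of_poincare (hU : MeasurableSet U) (hα : IsExponents α) (ha : IsMedium U φ a)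
    (hΨ : IsBoundaryData U φ α a Ψ) (hs : IsSolution U φ α a Ψ p) (ht : 0 < t) {cP : ℝ}
    (hcP : 0 < cP) (hP : PoincareSobolev U φ α a cP ((p - Ψ).val t) ((p - Ψ).grad t)) :
    √(∫ x in U, sqDensity φ x ((p - Ψ).val t x)) ^ (2 - expo α) ≤
      4 * cP ^ (2 - expo α) * ((∫ x in U, H α a x ‖p.grad t x‖) + G U φ α a Ψ t) := by
  have he0 := expo_pos hα
  have he1 := expo_lt_one hα
  obtain ⟨g1, g2, g3⟩ := G_terms_nonneg (α := α) hU ha Ψ t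
  have hI0 : ∀ F : Space n → Space n, 0 ≤ ∫ x in U, W₁ α a x * |‖F x‖| ^ (2 - expo α) :=
    fun F => setIntegral_nonneg hU fun x hx => by
      have := W₁_nonneg (α := α) ha hx
      positivity
  have hI : ∫ x in U, W₁ α a x * |‖(p - Ψ).grad t x‖| ^ (2 - expo α) ≤
      4 * ((∫ x in U, H α a x ‖p.grad t x‖) + G U φ α a Ψ t) := by
    have i1 := hs.integrable_H t ht.le
    have i2 := ha.coeff_last_integrable
    have i3 := hΨ.integrable_grad_rpow t ht.le
    calc _ ≤ ∫ x in U, 4 * (H α a x ‖p.grad t x‖ + a (Fin.last N) x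
            + W₁ α a x * ‖Ψ.grad t x‖ ^ (2 - expo α)) := by
          refine integral_mono_of_nonneg ?_ (((i1.add i2).add i3).const_mul 4) ?_
          · filter_upwards [ae_restrict_mem hU] with x hx
            have := W₁_nonneg (α := α) ha hx
            simp only [Pi.zero_apply]; positivity
          · filter_upwards [ae_restrict_mem hU] with x hx
            rw [abs_norm]
            exact W₁_mul_sub_rpow_le hα ha hx _ _
      _ = 4 * ((∫ x in U, H α a x ‖p.grad t x‖) + (∫ x in U, a (Fin.last N) x)
            + ∫ x in U, W₁ α a x * ‖Ψ.grad t x‖ ^ (2 - expo α)) := by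
          have i4 : IntegrableOn (fun x => H α a x ‖p.grad t x‖ + a (Fin.last N) x) U := i1.add i2
          rw [integral_const_mul, integral_add i4 i3, integral_add i1 i2]
      _ ≤ _ := by
          have := integral_coeff_last_le_Bstar (U := U) (a := a)
          have : 0 ≤ (∫ x in U, Ψ.dt t x ^ 2 * φ x) ^ ((2 - expo α) / (2 * (1 - expo α))) := by
            positivity
          unfold G
          linarith
  unfold PoincareSobolev at hP
  rw [weightedNorm_two, weightedNorm] at hP
  calc _ ≤ (cP * (∫ x in U, W₁ α a x * |‖(p - Ψ).grad t x‖| ^ (2 - expo α)) ^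
        (1 / (2 - expo α))) ^ (2 - expo α) :=
        Real.rpow_le_rpow (Real.sqrt_nonneg _) hP (by linarith)
    _ = cP ^ (2 - expo α) * ∫ x in U, W₁ α a x * |‖(p - Ψ).grad t x‖| ^ (2 - expo α) := by
        rw [Real.mul_rpow hcP.le (Real.rpow_nonneg (hI0 _) _), ← Real.rpow_mul (hI0 _),
          one_div_mul_cancel (by linarith), Real.rpow_one]
    _ ≤ cP ^ (2 - expo α) * (4 * ((∫ x in U, H α a x ‖p.grad t x‖) + G U φ α a Ψ t)) := by
        gcongr
    _ = _ := by ring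

theorem hasDerivAt_sq (hU : MeasurableSet U) (hα : IsExponents α) (ha : IsMedium U φ a)
    (hΨ : IsBoundaryData U φ α a Ψ) (hs : IsSolution U φ α a Ψ p) (ht : 0 < t) :
    HasDerivAt (fun s => ∫ x in U, sqDensity φ x ((p - Ψ).val s x))
      (2 * ∫ x in U, inner ℝ (φ x * (p - Ψ).val t x) ((p - Ψ).dt t x)) t :=
  ((isModular_sq hU hα ha).hasDerivAt_integral ht
    (fun _ h => (hs.finite_bar hU hα ha hΨ h).val) (hs.aesm_bar_dt hΨ ht)
    (tendsto_val_of_energy (hs.hasTimeDeriv_bar hU hα ha hΨ ht))).2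

/-- The energy inequality obtained by testing the equation with `p - Ψ`. -/
theorem deriv_sq_le (hU : MeasurableSet U) (hα : IsExponents α) (ha : IsMedium U φ a)
    (hΨ : IsBoundaryData U φ α a Ψ) (hs : IsSolution U φ α a Ψ p) (ht : 0 < t) :
    2 * ∫ x in U, inner ℝ (φ x * (p - Ψ).val t x) ((p - Ψ).dt t x) ≤
      -(1 / 2 * ∫ x in U, H α a x ‖p.grad t x‖) + (∫ x in U, (a 0 x)⁻¹ * ‖Ψ.grad t x‖ ^ 2)
      + 2 * (√(∫ x in U, sqDensity φ x ((p - Ψ).val t x)) *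
          √(∫ x in U, sqDensity φ x (Ψ.dt t x))) := by
  have h1 := isModular_sq hU hα ha
  have h2 := isModular_grad hU hα ha
  have hbar := hs.finite_bar hU hα ha hΨ ht.le
  have hdt := hs.finite_dt hU hα ha hΨ ht
  have hΨt := hΨ.finite_dt ht.le
  have hweak := hs.weakForm_eq_zero hU hα ha hΨ ht hbar (hs.boundary t ht)
  have hsplit : ∫ x in U, inner ℝ (φ x * (p - Ψ).val t x) ((p - Ψ).dt t x) =
      (∫ x in U, inner ℝ (φ x * p.dt t x) ((p - Ψ).val t x)) -
        ∫ x in U, inner ℝ (φ x * (p - Ψ).val t x) (Ψ.dt t x) := by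
    rw [← integral_sub (h1.integrable_inner hdt.val hbar.val) (h1.integrable_inner hbar.val hΨt)]
    congr 1
    funext x
    change inner ℝ (φ x * (p - Ψ).val t x) (p.dt t x - Ψ.dt t x) = _
    simp only [RCLike.inner_apply, conj_trivial]
    ring
  have hcs := (abs_le.1 (abs_integral_mul_le hU hα ha hbar.val hΨt)).1
  have hflux : -(∫ x in U, inner ℝ (flux α a x (p.grad t x)) ((p - Ψ).grad t x)) ≤
      -(1 / 4 * ∫ x in U, H α a x ‖p.grad t x‖) +
        1 / 2 * ∫ x in U, (a 0 x)⁻¹ * ‖Ψ.grad t x‖ ^ 2 := by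
    have i1 := hs.integrable_H t ht.le
    have i2 := hΨ.integrable_grad_sq t ht.le
    have i3 : IntegrableOn (fun x => -(1 / 4 * H α a x ‖p.grad t x‖)) U := (i1.const_mul _).neg
    rw [← integral_neg, ← integral_const_mul, ← integral_const_mul, ← integral_neg,
      ← integral_add i3 (i2.const_mul _)]
    refine integral_mono_ae (h2.integrable_inner hdt.grad hbar.grad).neg
      (i3.add (i2.const_mul _)) ?_
    filter_upwards [ae_restrict_mem hU] with x hx
    change -inner ℝ (flux α a x (p.grad t x)) (p.grad t x - Ψ.grad t x) ≤ _
    rw [inner_sub_right, inner_flux_self]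
    have hK := K_pos hα ha hx (norm_nonneg (p.grad t x))
    have hKi := K_le_inv hα ha hx (norm_nonneg (p.grad t x))
    have hH := H_le_two_mul hα ha hx (norm_nonneg (p.grad t x))
    have hi := real_inner_le_norm (flux α a x (p.grad t x)) (Ψ.grad t x)
    rw [norm_flux hα ha hx] at hi
    have hsq := mul_le_mul_of_nonneg_right hKi (sq_nonneg ‖Ψ.grad t x‖)
    have hyoung := mul_nonneg hK.le (sq_nonneg (‖p.grad t x‖ - ‖Ψ.grad t x‖))
    nlinarith
  rw [weakForm] at hweak
  rw [hsplit]
  linarith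

/-- The energy inequality obtained by testing the equation with `p_t - Ψ_t`. -/
theorem deriv_H_le (hU : MeasurableSet U) (hα : IsExponents α) (ha : IsMedium U φ a)
    (hΨ : IsBoundaryData U φ α a Ψ) (hs : IsSolution U φ α a Ψ p) (ht : 0 < t) :
    2 * ∫ x in U, inner ℝ (flux α a x (p.grad t x)) (p.gradDt t x) ≤
      1 / 8 * (∫ x in U, H α a x ‖p.grad t x‖) + 8 * G₁ U a Ψ t
      + ∫ x in U, sqDensity φ x (Ψ.dt t x) := by
  have h1 := isModular_sq hU hα ha
  have h2 := isModular_grad hU hα ha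
  have hbar := hs.finite_bar_dt hU hα ha hΨ ht
  have hdt := hs.finite_dt hU hα ha hΨ ht
  have hΨt := hΨ.finite_dt ht.le
  have hΨg := hΨ.finite_gradDt hU hα ha ht.le
  have hweak := hs.weakForm_bar_dt hU hα ha hΨ ht
  have hsplit : ∫ x in U, inner ℝ (flux α a x (p.grad t x)) (p.gradDt t x) =
      (∫ x in U, inner ℝ (flux α a x (p.grad t x)) ((p - Ψ).gradDt t x)) +
        ∫ x in U, inner ℝ (flux α a x (p.grad t x)) (Ψ.gradDt t x) := by
    rw [← integral_add (h2.integrable_inner hdt.grad hbar.grad)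
      (h2.integrable_inner hdt.grad hΨg)]
    congr 1
    funext x
    change _ = inner ℝ _ (p.gradDt t x - Ψ.gradDt t x) + _
    rw [← inner_add_right, sub_add_cancel]
  have hval : -(∫ x in U, inner ℝ (φ x * p.dt t x) ((p - Ψ).dt t x)) ≤
      1 / 2 * ∫ x in U, sqDensity φ x (Ψ.dt t x) := by
    rw [← integral_neg, ← integral_const_mul]
    refine integral_mono_ae (h1.integrable_inner hdt.val hbar.val).neg
      (hΨt.integrable.const_mul _) ?_
    filter_upwards [ae_restrict_mem hU] with x hx
    change -inner ℝ (φ x * p.dt t x) (p.dt t x - Ψ.dt t x) ≤ 1 / 2 * (φ x * Ψ.dt t x ^ 2)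
    simp only [RCLike.inner_apply, conj_trivial]
    have hφ := ha.porosity_pos x hx
    nlinarith [mul_nonneg hφ.le (sq_nonneg (p.dt t x - Ψ.dt t x)),
      mul_nonneg hφ.le (sq_nonneg (p.dt t x))]
  have hflux : ∫ x in U, inner ℝ (flux α a x (p.grad t x)) (Ψ.gradDt t x) ≤
      1 / 16 * (∫ x in U, H α a x ‖p.grad t x‖) +
        4 * ∫ x in U, (a 0 x)⁻¹ * ‖Ψ.gradDt t x‖ ^ 2 := by
    have i1 := hs.integrable_H t ht.le
    have i2 := hΨ.integrable_gradDt_sq t ht.le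
    rw [← integral_const_mul, ← integral_const_mul,
      ← integral_add (i1.const_mul _) (i2.const_mul _)]
    refine integral_mono_ae (h2.integrable_inner hdt.grad hΨg)
      ((i1.const_mul _).add (i2.const_mul _)) ?_
    filter_upwards [ae_restrict_mem hU] with x hx
    have hK := K_pos hα ha hx (norm_nonneg (p.grad t x))
    have hKi := K_le_inv hα ha hx (norm_nonneg (p.grad t x))
    have hH := le_H hα ha hx (norm_nonneg (p.grad t x))
    have hi := real_inner_le_norm (flux α a x (p.grad t x)) (Ψ.gradDt t x)
    rw [norm_flux hα ha hx] at hi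
    have hsq := mul_le_mul_of_nonneg_right hKi (sq_nonneg ‖Ψ.gradDt t x‖)
    have hyoung := mul_nonneg hK.le (sq_nonneg (1 / 4 * ‖p.grad t x‖ - 2 * ‖Ψ.gradDt t x‖))
    nlinarith
  rw [weakForm] at hweak
  rw [hsplit, G₁]
  linarith

end IsSolution

end

/-! ### A priori bounds for a single solution -/

section

variable {n N : ℕ} {α : Fin (N + 1) → ℝ} {U : Set (Space n)} {φ : Space n → ℝ}
  {a : Fin (N + 1) → Space n → ℝ} {Ψ p : Evolution n} {t : ℝ}

/-- The sum of `∫ φ (p-Ψ)²` and `∫ H(x,|∇p|)`. -/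
noncomputable def totalEnergy (U : Set (Space n)) (φ : Space n → ℝ) (α : Fin (N + 1) → ℝ)
    (a : Fin (N + 1) → Space n → ℝ) (Ψ p : Evolution n) (t : ℝ) : ℝ :=
  (∫ x in U, sqDensity φ x ((p - Ψ).val t x)) + ∫ x in U, H α a x ‖p.grad t x‖

theorem IsSolution.continuousOn_sq (hU : MeasurableSet U) (hα : IsExponents α)
    (ha : IsMedium U φ a) (hΨ : IsBoundaryData U φ α a Ψ) (hs : IsSolution U φ α a Ψ p) :
    ContinuousOn (fun s => ∫ x in U, sqDensity φ x ((p - Ψ).val s x)) (Ici 0) := by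
  have h1 := isModular_sq hU hα ha
  have hpos : ∀ᶠ s : ℝ in 𝓝[>] 0, 0 < s := self_mem_nhdsWithin
  have hfin : ∀ s : ℝ, 0 ≤ s →
      FiniteModular (volume.restrict U) (sqDensity φ) ((p - Ψ).val s) := fun s h =>
    (hs.finite_bar hU hα ha hΨ h).val
  refine continuousOn_Ici_of_tendsto
    (fun t ht => (hs.hasDerivAt_sq hU hα ha hΨ ht).continuousAt) ?_
  exact h1.tendsto_integral_of_sub (hfin 0 le_rfl) (hpos.mono fun s h => hfin s h.le)
    (h1.tendsto_integral (hpos.mono fun s h => (h1.finite_sub (hfin s h.le) (hfin 0 le_rfl)).aesm)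
      (hs.tendsto_bar_zero hU hα ha hΨ))

/-- The data terms appearing in the two energy inequalities are bounded by `G`. -/
theorem data_le_G (hU : MeasurableSet U) (hα : IsExponents α) (ha : IsMedium U φ a)
    (Ψ : Evolution n) (t : ℝ) :
    1 ≤ G U φ α a Ψ t ∧
    (∫ x in U, (a 0 x)⁻¹ * ‖Ψ.grad t x‖ ^ 2) ≤ G U φ α a Ψ t ∧
    √(∫ x in U, sqDensity φ x (Ψ.dt t x)) ^ (1 + 1 / (2 - expo α - 1)) ≤ G U φ α a Ψ t ∧
    (∫ x in U, sqDensity φ x (Ψ.dt t x)) ≤ G U φ α a Ψ t := by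
  have he0 := expo_pos hα
  have he1 := expo_lt_one hα
  obtain ⟨g1, g2, g3⟩ := G_terms_nonneg (α := α) hU ha Ψ t
  have hB : 1 ≤ Bstar U a := le_max_right _ _
  have hd : 0 < 1 - expo α := by linarith
  rw [G, ← integral_dt_sq_eq U φ (Ψ.dt t)]
  set w := ∫ x in U, Ψ.dt t x ^ 2 * φ x
  have hw : 0 ≤ w ^ ((2 - expo α) / (2 * (1 - expo α))) := by positivity
  refine ⟨by linarith, by linarith, ?_, ?_⟩
  · have : √w ^ (1 + 1 / (2 - expo α - 1)) = w ^ ((2 - expo α) / (2 * (1 - expo α))) := by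
      rw [Real.sqrt_eq_rpow, ← Real.rpow_mul g3]
      congr 1
      rw [show 2 - expo α - 1 = 1 - expo α by ring]
      field_simp
      ring
    linarith
  · have hγ : 1 ≤ (2 - expo α) / (2 * (1 - expo α)) := by
      rw [le_div_iff₀ (by positivity)]; linarith
    rcases le_total w 1 with h | h
    · linarith
    · have := Real.self_le_rpow_of_one_le h hγ
      linarith

/-- The a priori bound. The first energy inequality together with the Poincaré–Sobolev inequality
shows that `y = ∫ φ (p-Ψ)²` decreases wherever it exceeds a multiple of `M^{2/(2-a)}`. Given this
bound on `y`, the sum of the two energy inequalities shows that `y + ∫ H(x,|∇p|)` decreases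
wherever it is large compared with `y(0)`, `M^{2/(2-a)}` and `S`. -/
theorem exists_totalEnergy_le (hα : IsExponents α) {cP : ℝ} (hcP : 0 < cP) :
    ∃ C > 0, ∀ {n : ℕ} {U : Set (Space n)} {φ : Space n → ℝ} {a : Fin (N + 1) → Space n → ℝ}
      {Ψ p : Evolution n}, MeasurableSet U → IsMedium U φ a → IsBoundaryData U φ α a Ψ →
      IsSolution U φ α a Ψ p →
      (∀ t, 0 < t → PoincareSobolev U φ α a cP ((p - Ψ).val t) ((p - Ψ).grad t)) →
      ∀ T M S : ℝ, (∀ t ∈ Icc 0 T, G U φ α a Ψ t ≤ M) → (∀ t ∈ Icc 0 T, G₁ U a Ψ t ≤ S) →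
      ∀ t ∈ Icc 0 T, totalEnergy U φ α a Ψ p t ≤
        C * (totalEnergy U φ α a Ψ p 0 + M ^ (2 / (2 - expo α)) + S) := by
  have he0 := expo_pos hα
  have he1 := expo_lt_one hα
  set q := 2 - expo α with hq
  have hq1 : 1 < q := by linarith
  have hq0 : 0 < q := by linarith
  -- the constant of the Poincaré–Sobolev inequality for `p - Ψ` and that of Young's inequality
  set c₁ := 4 * cP ^ q with hc₁
  have hc₁0 : 0 < c₁ := by positivity
  set c₂ := 2 * (2 / (1 / (4 * c₁))) ^ (1 / (q - 1)) with hc₂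
  have hc₂0 : 0 < c₂ := by positivity
  set c₃ := 2 + c₂ with hc₃
  set c₄ := (c₁ * (4 * c₃ + 1)) ^ (2 / q) with hc₄
  have hc₃0 : 0 < c₃ := by positivity
  have hc₄0 : 0 < c₄ := by positivity
  refine ⟨2 + c₄ + 8 * (c₃ + 1) + 64, by positivity, ?_⟩
  intro n U φ a Ψ p hU ha hΨ hs hP T M S hM hS t ht
  have hT : 0 ≤ T := ht.1.trans ht.2
  set y : ℝ → ℝ := fun s => ∫ x in U, sqDensity φ x ((p - Ψ).val s x) with hy
  set E : ℝ → ℝ := fun s => ∫ x in U, H α a x ‖p.grad s x‖ with hE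
  have hy0 : ∀ s, 0 ≤ y s := fun s => (isModular_sq hU hα ha).integral_nonneg _
  have hE0 : ∀ s, 0 ≤ E s := fun s => (isModular_grad hU hα ha).integral_nonneg _
  have hM1 : 1 ≤ M := (data_le_G hU hα ha Ψ 0).1.trans (hM 0 ⟨le_rfl, hT⟩)
  have hS0 : 0 ≤ S := le_trans (setIntegral_nonneg hU fun x hx => by
    have := ha.coeff_zero_pos x hx
    positivity) (hS 0 ⟨le_rfl, hT⟩)
  have hMM : M ≤ M ^ (2 / q) :=
    Real.self_le_rpow_of_one_le hM1 (by rw [le_div_iff₀ hq0]; linarith)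
  have hpoin : ∀ s, 0 < s → √(y s) ^ q ≤ c₁ * (E s + G U φ α a Ψ s) := fun s h =>
    hs.rpow_le_of_poincare hU hα ha hΨ h hcP (hP s h)
  have hycont := hs.continuousOn_sq hU hα ha hΨ
  have hEcont := hs.continuousOn_H hU hα ha
  have hdy : ∀ s, 0 < s → ∃ y', HasDerivAt y y' s ∧
      y' ≤ -(1 / 4 * E s) + c₃ * G U φ α a Ψ s := by
    intro s h
    refine ⟨_, hs.hasDerivAt_sq hU hα ha hΨ h, (hs.deriv_sq_le hU hα ha hΨ h).trans ?_⟩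
    obtain ⟨d1, d2, d3, -⟩ := data_le_G hU hα ha Ψ s
    have hyoung := two_mul_le_young hq1 (show 0 < 1 / (4 * c₁) by positivity)
      (Real.sqrt_nonneg (y s)) (Real.sqrt_nonneg (∫ x in U, sqDensity φ x (Ψ.dt s x)))
    have h1 : 1 / (4 * c₁) * √(y s) ^ q ≤ 1 / 4 * (E s + G U φ α a Ψ s) := by
      calc 1 / (4 * c₁) * √(y s) ^ q ≤ 1 / (4 * c₁) * (c₁ * (E s + G U φ α a Ψ s)) := by
            gcongr; exact hpoin s h
        _ = _ := by field_simp
    have h2 := mul_le_mul_of_nonneg_left d3 hc₂0.le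
    rw [← hc₂] at hyoung
    change -(1 / 2 * E s) + _ + 2 * (√(y s) * _) ≤ _
    rw [hc₃]
    linarith
  have hdE : ∀ s, 0 < s → ∃ E', HasDerivAt E E' s ∧
      E' ≤ 1 / 8 * E s + 8 * G₁ U a Ψ s + G U φ α a Ψ s := by
    intro s h
    refine ⟨_, (hs.hasDerivAt_H hU hα ha h).2, (hs.deriv_H_le hU hα ha hΨ h).trans ?_⟩
    have := (data_le_G hU hα ha Ψ s).2.2.2
    change 1 / 8 * E s + _ + _ ≤ _
    linarith
  -- the bound on `y`
  have hyB : ∀ s ∈ Icc 0 T, y s ≤ y 0 + c₄ * M ^ (2 / q) := by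
    intro s hs'
    refine le_of_deriv_nonpos_above (hycont.mono Icc_subset_Ici_self)
      (le_add_of_nonneg_right (by positivity)) (fun r hr hrT => ?_) hs'
    obtain ⟨y', h1, h2⟩ := hdy r hr
    refine ⟨y', h1, fun hlt => h2.trans ?_⟩
    have hGM := hM r ⟨hr.le, hrT⟩
    have hlt' : (c₁ * (4 * c₃ + 1) * M) ^ (2 / q) < y r := by
      rw [Real.mul_rpow (by positivity) (by linarith)]
      linarith [hy0 0]
    have h3 : c₁ * (4 * c₃ + 1) * M < √(y r) ^ q := by
      have h4 : c₁ * (4 * c₃ + 1) * M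
          = ((c₁ * (4 * c₃ + 1) * M) ^ (2 / q)) ^ (q / 2) := by
        rw [← Real.rpow_mul (by positivity)]
        rw [show 2 / q * (q / 2) = 1 by field_simp, Real.rpow_one]
      have h5 : √(y r) ^ q = y r ^ (q / 2) := by
        rw [Real.sqrt_eq_rpow, ← Real.rpow_mul (hy0 r)]; congr 1; ring
      rw [h4, h5]
      exact Real.rpow_lt_rpow (by positivity) hlt' (by positivity)
    have h6 := h3.trans_le (hpoin r hr)
    have h7 : (4 * c₃ + 1) * M < E r + G U φ α a Ψ r := by
      rw [mul_assoc] at h6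
      exact lt_of_mul_lt_mul_left h6 hc₁0.le
    nlinarith
  -- the bound on the sum: above this level `E` alone is large, since `y` is bounded already
  have hsum : y t + E t ≤ (E 0 + y 0) + (y 0 + c₄ * M ^ (2 / q)) +
      8 * ((c₃ + 1) * M + 8 * S) := by
    refine le_of_deriv_nonpos_above (f := fun s => y s + E s)
      ((hycont.add hEcont).mono Icc_subset_Ici_self) ?_ (fun r hr hrT => ?_) ht
    · have : 0 ≤ c₄ * M ^ (2 / q) := by positivity
      have : 0 ≤ (c₃ + 1) * M := by positivity
      linarith [hy0 0]
    obtain ⟨y', h1, h2⟩ := hdy r hr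
    obtain ⟨E', h3, h4⟩ := hdE r hr
    refine ⟨y' + E', h1.add h3, fun hlt => ?_⟩
    have hGM := hM r ⟨hr.le, hrT⟩
    have hGS := hS r ⟨hr.le, hrT⟩
    have hyr := hyB r ⟨hr.le, hrT⟩
    have h5 : c₃ * G U φ α a Ψ r ≤ c₃ * M := by gcongr
    linarith [hy0 0, hE0 0]
  change y t + E t ≤ _ * ((y 0 + E 0) + M ^ (2 / q) + S)
  have hc₃M : (c₃ + 1) * M ≤ (c₃ + 1) * M ^ (2 / q) := by gcongr
  have hMq : 0 ≤ M ^ (2 / q) := by positivity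
  have p1 := mul_nonneg hc₄0.le (add_nonneg (hy0 0) (hE0 0))
  have p2 := mul_nonneg hc₄0.le hS0
  have p3 := mul_nonneg hc₃0.le (add_nonneg (hy0 0) (hE0 0))
  have p4 := mul_nonneg hc₃0.le hS0
  linarith [hy0 0, hE0 0]

end

/-! ### The difference of two solutions -/

section

variable {n N : ℕ} {α : Fin (N + 1) → ℝ} {U : Set (Space n)} {φ : Space n → ℝ}
  {a : Fin (N + 1) → Space n → ℝ} {Ψ₁ Ψ₂ p₁ p₂ : Evolution n} {t : ℝ}

/-- The integral of `K |∇P̄|²`, with `K` evaluated at the larger of the two pressure gradients. -/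
noncomputable def dissipation (U : Set (Space n)) (α : Fin (N + 1) → ℝ)
    (a : Fin (N + 1) → Space n → ℝ) (Ψ₁ p₁ Ψ₂ p₂ : Evolution n) (t : ℝ) : ℝ :=
  ∫ x in U, K α a x (max ‖p₁.grad t x‖ ‖p₂.grad t x‖) *
    ‖((p₁ - Ψ₁) - (p₂ - Ψ₂)).grad t x‖ ^ 2

theorem finite_diff (hU : MeasurableSet U) (hα : IsExponents α) (ha : IsMedium U φ a)
    (hΨ₁ : IsBoundaryData U φ α a Ψ₁) (h₁ : IsSolution U φ α a Ψ₁ p₁)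
    (hΨ₂ : IsBoundaryData U φ α a Ψ₂) (h₂ : IsSolution U φ α a Ψ₂ p₂) (ht : 0 ≤ t) :
    FiniteEnergy U φ α a (((p₁ - Ψ₁) - (p₂ - Ψ₂)).val t) (((p₁ - Ψ₁) - (p₂ - Ψ₂)).grad t) :=
  ⟨(isModular_sq hU hα ha).finite_sub (h₁.finite_bar hU hα ha hΨ₁ ht).val
      (h₂.finite_bar hU hα ha hΨ₂ ht).val,
    (isModular_grad hU hα ha).finite_sub (h₁.finite_bar hU hα ha hΨ₁ ht).grad
      (h₂.finite_bar hU hα ha hΨ₂ ht).grad⟩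

theorem hasDerivAt_sq_diff (hU : MeasurableSet U) (hα : IsExponents α) (ha : IsMedium U φ a)
    (hΨ₁ : IsBoundaryData U φ α a Ψ₁) (h₁ : IsSolution U φ α a Ψ₁ p₁)
    (hΨ₂ : IsBoundaryData U φ α a Ψ₂) (h₂ : IsSolution U φ α a Ψ₂ p₂) (ht : 0 < t) :
    HasDerivAt (fun s => ∫ x in U, sqDensity φ x (((p₁ - Ψ₁) - (p₂ - Ψ₂)).val s x))
      (2 * ∫ x in U, inner ℝ (φ x * ((p₁ - Ψ₁) - (p₂ - Ψ₂)).val t x)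
        (((p₁ - Ψ₁) - (p₂ - Ψ₂)).dt t x)) t := by
  have hM := isModular_sq hU hα ha
  refine (hM.hasDerivAt_integral ht
    (fun _ h => (finite_diff hU hα ha hΨ₁ h₁ hΨ₂ h₂ h).val)
    ((h₁.aesm_bar_dt hΨ₁ ht).sub (h₂.aesm_bar_dt hΨ₂ ht)) ?_).2
  have hd₁ := tendsto_val_of_energy (h₁.hasTimeDeriv_bar hU hα ha hΨ₁ ht)
  have hd₂ := tendsto_val_of_energy (h₂.hasTimeDeriv_bar hU hα ha hΨ₂ ht)
  refine (hM.tendsto_lintegral_sub ?_ hd₁ hd₂).congr fun s => ?_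
  · filter_upwards [self_mem_nhdsWithin] with s hs
    exact (((h₁.finite_bar hU hα ha hΨ₁ hs.1).val.aesm.sub
      (h₁.finite_bar hU hα ha hΨ₁ ht.le).val.aesm).const_mul _).sub (h₁.aesm_bar_dt hΨ₁ ht)
  · congr 1
    funext x
    congr 2
    change _ = (s - t)⁻¹ * (((p₁ - Ψ₁).val s x - (p₂ - Ψ₂).val s x)
      - ((p₁ - Ψ₁).val t x - (p₂ - Ψ₂).val t x)) - ((p₁ - Ψ₁).dt t x - (p₂ - Ψ₂).dt t x)
    ring

theorem continuousOn_sq_diff (hU : MeasurableSet U) (hα : IsExponents α) (ha : IsMedium U φ a)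
    (hΨ₁ : IsBoundaryData U φ α a Ψ₁) (h₁ : IsSolution U φ α a Ψ₁ p₁)
    (hΨ₂ : IsBoundaryData U φ α a Ψ₂) (h₂ : IsSolution U φ α a Ψ₂ p₂) :
    ContinuousOn (fun s => ∫ x in U, sqDensity φ x (((p₁ - Ψ₁) - (p₂ - Ψ₂)).val s x))
      (Ici 0) := by
  have hM := isModular_sq hU hα ha
  have hpos : ∀ᶠ s : ℝ in 𝓝[>] 0, 0 < s := self_mem_nhdsWithin
  have hfin : ∀ s : ℝ, 0 ≤ s → FiniteModular (volume.restrict U) (sqDensity φ)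
      (((p₁ - Ψ₁) - (p₂ - Ψ₂)).val s) := fun s h =>
    (finite_diff hU hα ha hΨ₁ h₁ hΨ₂ h₂ h).val
  refine continuousOn_Ici_of_tendsto
    (fun t ht => (hasDerivAt_sq_diff hU hα ha hΨ₁ h₁ hΨ₂ h₂ ht).continuousAt) ?_
  refine hM.tendsto_integral_of_sub (hfin 0 le_rfl) (hpos.mono fun s h => hfin s h.le)
    (hM.tendsto_integral
      (hpos.mono fun s h => (hM.finite_sub (hfin s h.le) (hfin 0 le_rfl)).aesm) ?_)
  refine (hM.tendsto_lintegral_sub ?_ (h₁.tendsto_bar_zero hU hα ha hΨ₁)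
    (h₂.tendsto_bar_zero hU hα ha hΨ₂)).congr fun s => ?_
  · exact hpos.mono fun s h => (h₁.finite_bar hU hα ha hΨ₁ h.le).val.aesm.sub
      (h₁.finite_bar hU hα ha hΨ₁ le_rfl).val.aesm
  · congr 1
    funext x
    congr 2
    change _ = ((p₁ - Ψ₁).val s x - (p₂ - Ψ₂).val s x)
      - ((p₁ - Ψ₁).val 0 x - (p₂ - Ψ₂).val 0 x)
    ring

/-- The equation of either solution may be tested with the difference. -/
theorem weakForm_diff (hU : MeasurableSet U) (hα : IsExponents α) (ha : IsMedium U φ a)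
    {Ψ p : Evolution n} (hΨ : IsBoundaryData U φ α a Ψ) (h : IsSolution U φ α a Ψ p)
    (hΨ₁ : IsBoundaryData U φ α a Ψ₁) (h₁ : IsSolution U φ α a Ψ₁ p₁)
    (hΨ₂ : IsBoundaryData U φ α a Ψ₂) (h₂ : IsSolution U φ α a Ψ₂ p₂) (ht : 0 < t) :
    weakForm U φ α a (p.dt t) (p.grad t) (((p₁ - Ψ₁) - (p₂ - Ψ₂)).val t)
      (((p₁ - Ψ₁) - (p₂ - Ψ₂)).grad t) = 0 := by
  have b₁ := h₁.finite_bar hU hα ha hΨ₁ ht.le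
  have b₂ := h₂.finite_bar hU hα ha hΨ₂ ht.le
  have := weakForm_sub hU hα ha (h.finite_dt hU hα ha hΨ ht) b₁ b₂
  rw [h.weakForm_eq_zero hU hα ha hΨ ht b₁ (h₁.boundary t ht),
    h.weakForm_eq_zero hU hα ha hΨ ht b₂ (h₂.boundary t ht), sub_zero] at this
  exact this

theorem inv_mul_norm_sub_sq_le (ha : IsMedium U φ a) {x : Space n} (hx : x ∈ U)
    (y z : Space n) : (a 0 x)⁻¹ * ‖y - z‖ ^ 2 ≤
      2 * ((a 0 x)⁻¹ * ‖y‖ ^ 2 + (a 0 x)⁻¹ * ‖z‖ ^ 2) := by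
  have h0 : 0 ≤ (a 0 x)⁻¹ := (inv_pos.2 (ha.coeff_zero_pos x hx)).le
  have h1 : ‖y - z‖ ^ 2 ≤ 2 * (‖y‖ ^ 2 + ‖z‖ ^ 2) := by
    have := norm_sub_le y z
    nlinarith [sq_nonneg (‖y‖ - ‖z‖), norm_nonneg (y - z)]
  nlinarith

theorem integrable_inv_diff (hU : MeasurableSet U) (ha : IsMedium U φ a)
    (hΨ₁ : IsBoundaryData U φ α a Ψ₁) (hΨ₂ : IsBoundaryData U φ α a Ψ₂) (ht : 0 ≤ t) :
    IntegrableOn (fun x => (a 0 x)⁻¹ * ‖(Ψ₁ - Ψ₂).grad t x‖ ^ 2) U := by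
  have i₁ := hΨ₁.integrable_grad_sq t ht
  have i₂ := hΨ₂.integrable_grad_sq t ht
  refine ((i₁.add i₂).const_mul 2).mono' ?_ ?_
  · exact ((ha.coeff_measurable 0).inv.aestronglyMeasurable).mul
      (((hΨ₁.weakGradient t ht).aesm_grad.sub (hΨ₂.weakGradient t ht).aesm_grad).norm.pow 2)
  · filter_upwards [ae_restrict_mem hU] with x hx
    have h0 : 0 ≤ (a 0 x)⁻¹ := (inv_pos.2 (ha.coeff_zero_pos x hx)).le
    rw [Real.norm_eq_abs, abs_of_nonneg (by positivity)]
    exact inv_mul_norm_sub_sq_le ha hx _ _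

theorem K_max_mul_sub_sq_le (hα : IsExponents α) (ha : IsMedium U φ a) {x : Space n} (hx : x ∈ U)
    (y z : Space n) : K α a x (max ‖y‖ ‖z‖) * ‖y - z‖ ^ 2 ≤ 4 * (H α a x ‖y‖ + H α a x ‖z‖) := by
  have hy := norm_nonneg y
  have hz := norm_nonneg z
  have hm : 0 ≤ max ‖y‖ ‖z‖ := hy.trans (le_max_left _ _)
  have h1 := le_H hα ha hx hm
  have h2 : H α a x (max ‖y‖ ‖z‖) ≤ H α a x ‖y‖ + H α a x ‖z‖ := by
    have := H_nonneg hα ha hx hy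
    have := H_nonneg hα ha hx hz
    rcases max_choice ‖y‖ ‖z‖ with h | h <;> rw [h] <;> linarith
  have h3 : ‖y - z‖ ≤ 2 * max ‖y‖ ‖z‖ := by
    linarith [norm_sub_le y z, le_max_left ‖y‖ ‖z‖, le_max_right ‖y‖ ‖z‖]
  have h4 : ‖y - z‖ ^ 2 ≤ 4 * max ‖y‖ ‖z‖ ^ 2 := by
    nlinarith [norm_nonneg (y - z)]
  have := mul_le_mul_of_nonneg_left h4 (K_pos hα ha hx hm).le
  linarith

/-- Splitting of the gradient of the difference into the pressure part and the boundary part. -/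
theorem grad_diff_eq (Ψ₁ p₁ Ψ₂ p₂ : Evolution n) (t : ℝ) (x : Space n) :
    ((p₁ - Ψ₁) - (p₂ - Ψ₂)).grad t x =
      (p₁.grad t x - p₂.grad t x) - (Ψ₁ - Ψ₂).grad t x := by
  change (p₁.grad t x - Ψ₁.grad t x) - (p₂.grad t x - Ψ₂.grad t x) =
    (p₁.grad t x - p₂.grad t x) - (Ψ₁.grad t x - Ψ₂.grad t x)
  abel

theorem K_max_mul_diff_sq_le (hα : IsExponents α) (ha : IsMedium U φ a) {x : Space n}
    (hx : x ∈ U) (y z w : Space n) :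
    K α a x (max ‖y‖ ‖z‖) * ‖(y - z) - w‖ ^ 2 ≤
      2 * (K α a x (max ‖y‖ ‖z‖) * ‖y - z‖ ^ 2) + 2 * ((a 0 x)⁻¹ * ‖w‖ ^ 2) := by
  have hm : 0 ≤ max ‖y‖ ‖z‖ := (norm_nonneg y).trans (le_max_left _ _)
  have hK := K_pos hα ha hx hm
  have hKi := K_le_inv hα ha hx hm
  have h1 : ‖(y - z) - w‖ ^ 2 ≤ 2 * ‖y - z‖ ^ 2 + 2 * ‖w‖ ^ 2 := by
    have := norm_sub_le (y - z) w
    nlinarith [sq_nonneg (‖y - z‖ - ‖w‖), norm_nonneg (y - z - w)]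
  have h2 := mul_le_mul_of_nonneg_left h1 hK.le
  have h3 := mul_le_mul_of_nonneg_right hKi (sq_nonneg ‖w‖)
  linarith

theorem integrable_dissipation (hU : MeasurableSet U) (hα : IsExponents α) (ha : IsMedium U φ a)
    (hΨ₁ : IsBoundaryData U φ α a Ψ₁) (h₁ : IsSolution U φ α a Ψ₁ p₁)
    (hΨ₂ : IsBoundaryData U φ α a Ψ₂) (h₂ : IsSolution U φ α a Ψ₂ p₂) (ht : 0 ≤ t) :
    IntegrableOn (fun x => K α a x (max ‖p₁.grad t x‖ ‖p₂.grad t x‖) *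
      ‖((p₁ - Ψ₁) - (p₂ - Ψ₂)).grad t x‖ ^ 2) U := by
  have f₁ := h₁.finite_grad ht
  have f₂ := h₂.finite_grad ht
  have iΦ := integrable_inv_diff hU ha hΨ₁ hΨ₂ ht
  refine ((((f₁.integrable.add f₂.integrable).const_mul 4).const_mul 2).add
    (iΦ.const_mul 2)).mono' ?_ ?_
  · refine AEStronglyMeasurable.mul ?_
      ((finite_diff hU hα ha hΨ₁ h₁ hΨ₂ h₂ ht).grad.aesm.norm.pow 2)
    exact (aemeasurable_K hU hα ha (f₁.aesm.norm.aemeasurable.max f₂.aesm.norm.aemeasurable)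
      fun _ => (norm_nonneg _).trans (le_max_left _ _)).aestronglyMeasurable
  · filter_upwards [ae_restrict_mem hU] with x hx
    have hm : 0 ≤ max ‖p₁.grad t x‖ ‖p₂.grad t x‖ := (norm_nonneg _).trans (le_max_left _ _)
    have hK := K_pos hα ha hx hm
    rw [Real.norm_eq_abs, abs_of_nonneg (by positivity), grad_diff_eq]
    refine (K_max_mul_diff_sq_le hα ha hx _ _ _).trans ?_
    have := K_max_mul_sub_sq_le hα ha hx (p₁.grad t x) (p₂.grad t x)
    simp only [Pi.add_apply]
    linarith

/-- The flux of a solution paired with the gradient of the boundary data, by Cauchy–Schwarz. -/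
theorem integral_flux_mul_le (hU : MeasurableSet U) (hα : IsExponents α) (ha : IsMedium U φ a)
    {F E : Space n → Space n} (hF : FiniteModular (volume.restrict U) (gradDensity α a) F)
    (hE : IntegrableOn (fun x => (a 0 x)⁻¹ * ‖E x‖ ^ 2) U) :
    ∫ x in U, ‖flux α a x (F x)‖ * ‖E x‖ ≤
      √(∫ x in U, H α a x ‖F x‖) * √(∫ x in U, (a 0 x)⁻¹ * ‖E x‖ ^ 2) := by
  have hmem := ae_restrict_mem (μ := volume) hU
  refine integral_le_sqrt_mul_sqrt hF.integrable hE ?_ ?_ ?_ ?_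
  · exact hmem.mono fun x hx => H_nonneg hα ha hx (norm_nonneg _)
  · filter_upwards [hmem] with x hx
    have := ha.coeff_zero_pos x hx
    positivity
  · exact Eventually.of_forall fun x => by positivity
  · filter_upwards [hmem] with x hx
    have hK := K_pos hα ha hx (norm_nonneg (F x))
    have hKi := K_le_inv hα ha hx (norm_nonneg (F x))
    have hH := le_H hα ha hx (norm_nonneg (F x))
    rw [norm_flux hα ha hx]
    calc (K α a x ‖F x‖ * ‖F x‖ * ‖E x‖) ^ 2
        = (K α a x ‖F x‖ * ‖F x‖ ^ 2) * (K α a x ‖F x‖ * ‖E x‖ ^ 2) := by ring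
      _ ≤ H α a x ‖F x‖ * ((a 0 x)⁻¹ * ‖E x‖ ^ 2) := by
        have : 0 ≤ K α a x ‖F x‖ * ‖F x‖ ^ 2 := by positivity
        gcongr
        exact this.trans hH

theorem integrable_norm_flux_mul (hU : MeasurableSet U) (hα : IsExponents α)
    (ha : IsMedium U φ a) {F E : Space n → Space n}
    (hF : FiniteModular (volume.restrict U) (gradDensity α a) F)
    (hE : FiniteModular (volume.restrict U) (gradDensity α a) E) :
    IntegrableOn (fun x => ‖flux α a x (F x)‖ * ‖E x‖) U := by
  refine (hF.integrable.add hE.integrable).mono'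
    ((aestronglyMeasurable_flux hU hα ha hF.aesm).norm.mul hE.aesm.norm) ?_
  filter_upwards [ae_restrict_mem hU] with x hx
  rw [Real.norm_eq_abs, abs_of_nonneg (by positivity), norm_flux hα ha hx]
  simpa using K_mul_mul_le hα ha hx (norm_nonneg (F x)) (norm_nonneg (E x)) one_pos le_rfl

/-- The energy inequality for the difference of two solutions. -/
theorem deriv_sq_diff_le (hU : MeasurableSet U) (hα : IsExponents α) (ha : IsMedium U φ a)
    (hΨ₁ : IsBoundaryData U φ α a Ψ₁) (h₁ : IsSolution U φ α a Ψ₁ p₁)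
    (hΨ₂ : IsBoundaryData U φ α a Ψ₂) (h₂ : IsSolution U φ α a Ψ₂ p₂) (ht : 0 < t) :
    2 * ∫ x in U, inner ℝ (φ x * ((p₁ - Ψ₁) - (p₂ - Ψ₂)).val t x)
        (((p₁ - Ψ₁) - (p₂ - Ψ₂)).dt t x) ≤
      -((1 - expo α) * dissipation U α a Ψ₁ p₁ Ψ₂ p₂ t)
      + 2 * (∫ x in U, (a 0 x)⁻¹ * ‖(Ψ₁ - Ψ₂).grad t x‖ ^ 2)
      + 2 * ((√(∫ x in U, H α a x ‖p₁.grad t x‖) + √(∫ x in U, H α a x ‖p₂.grad t x‖)) *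
          √(∫ x in U, (a 0 x)⁻¹ * ‖(Ψ₁ - Ψ₂).grad t x‖ ^ 2))
      + 2 * (√(∫ x in U, sqDensity φ x (((p₁ - Ψ₁) - (p₂ - Ψ₂)).val t x)) *
          √(∫ x in U, sqDensity φ x ((Ψ₁ - Ψ₂).dt t x))) := by
  have he0 := expo_pos hα
  have he1 := expo_lt_one hα
  have m1 := isModular_sq hU hα ha
  have m2 := isModular_grad hU hα ha
  have hz := finite_diff hU hα ha hΨ₁ h₁ hΨ₂ h₂ ht.le
  have d₁ := h₁.finite_dt hU hα ha hΨ₁ ht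
  have d₂ := h₂.finite_dt hU hα ha hΨ₂ ht
  have hΦ : FiniteModular (volume.restrict U) (sqDensity φ) ((Ψ₁ - Ψ₂).dt t) :=
    m1.finite_sub (hΨ₁.finite_dt ht.le) (hΨ₂.finite_dt ht.le)
  have hΦg : FiniteModular (volume.restrict U) (gradDensity α a) ((Ψ₁ - Ψ₂).grad t) :=
    m2.finite_sub (hΨ₁.finite_grad hU hα ha ht.le) (hΨ₂.finite_grad hU hα ha ht.le)
  have iΦ := integrable_inv_diff hU ha hΨ₁ hΨ₂ ht.le
  have w₁ := weakForm_diff hU hα ha hΨ₁ h₁ hΨ₁ h₁ hΨ₂ h₂ ht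
  have w₂ := weakForm_diff hU hα ha hΨ₂ h₂ hΨ₁ h₁ hΨ₂ h₂ ht
  have hsplit : ∫ x in U, inner ℝ (φ x * ((p₁ - Ψ₁) - (p₂ - Ψ₂)).val t x)
      (((p₁ - Ψ₁) - (p₂ - Ψ₂)).dt t x) =
      (∫ x in U, inner ℝ (φ x * p₁.dt t x) (((p₁ - Ψ₁) - (p₂ - Ψ₂)).val t x))
      - (∫ x in U, inner ℝ (φ x * p₂.dt t x) (((p₁ - Ψ₁) - (p₂ - Ψ₂)).val t x))
      - ∫ x in U, inner ℝ (φ x * ((p₁ - Ψ₁) - (p₂ - Ψ₂)).val t x) ((Ψ₁ - Ψ₂).dt t x) := by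
    have j₁ := m1.integrable_inner d₁.val hz.val
    have j₂ := m1.integrable_inner d₂.val hz.val
    have j₃ := m1.integrable_inner hz.val hΦ
    have j₄ : IntegrableOn (fun x =>
        inner ℝ (φ x * p₁.dt t x) (((p₁ - Ψ₁) - (p₂ - Ψ₂)).val t x) -
        inner ℝ (φ x * p₂.dt t x) (((p₁ - Ψ₁) - (p₂ - Ψ₂)).val t x)) U := j₁.sub j₂
    rw [← integral_sub j₁ j₂, ← integral_sub j₄ j₃]
    congr 1
    funext x
    change inner ℝ _ ((p₁.dt t x - Ψ₁.dt t x) - (p₂.dt t x - Ψ₂.dt t x)) =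
      _ - inner ℝ _ (Ψ₁.dt t x - Ψ₂.dt t x)
    simp only [RCLike.inner_apply, conj_trivial]
    ring
  have hcs := (abs_le.1 (abs_integral_mul_le hU hα ha hz.val hΦ)).1
  have k₁ := integral_flux_mul_le hU hα ha d₁.grad iΦ
  have k₂ := integral_flux_mul_le hU hα ha d₂.grad iΦ
  have hdiss := integrable_dissipation hU hα ha hΨ₁ h₁ hΨ₂ h₂ ht.le
  have hflux : (1 - expo α) / 2 * dissipation U α a Ψ₁ p₁ Ψ₂ p₂ t ≤
      (∫ x in U, inner ℝ (flux α a x (p₁.grad t x)) (((p₁ - Ψ₁) - (p₂ - Ψ₂)).grad t x))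
      - (∫ x in U, inner ℝ (flux α a x (p₂.grad t x)) (((p₁ - Ψ₁) - (p₂ - Ψ₂)).grad t x))
      + ((∫ x in U, (a 0 x)⁻¹ * ‖(Ψ₁ - Ψ₂).grad t x‖ ^ 2)
        + ((∫ x in U, ‖flux α a x (p₁.grad t x)‖ * ‖(Ψ₁ - Ψ₂).grad t x‖)
        + ∫ x in U, ‖flux α a x (p₂.grad t x)‖ * ‖(Ψ₁ - Ψ₂).grad t x‖)) := by
    have j₁ := m2.integrable_inner d₁.grad hz.grad
    have j₂ := m2.integrable_inner d₂.grad hz.grad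
    have l₁ := integrable_norm_flux_mul hU hα ha d₁.grad hΦg
    have l₂ := integrable_norm_flux_mul hU hα ha d₂.grad hΦg
    have j₁₂ : IntegrableOn (fun x =>
        inner ℝ (flux α a x (p₁.grad t x)) (((p₁ - Ψ₁) - (p₂ - Ψ₂)).grad t x) -
        inner ℝ (flux α a x (p₂.grad t x)) (((p₁ - Ψ₁) - (p₂ - Ψ₂)).grad t x)) U := j₁.sub j₂
    have l₁₂ : IntegrableOn (fun x =>
        ‖flux α a x (p₁.grad t x)‖ * ‖(Ψ₁ - Ψ₂).grad t x‖ +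
        ‖flux α a x (p₂.grad t x)‖ * ‖(Ψ₁ - Ψ₂).grad t x‖) U := l₁.add l₂
    have l₃ : IntegrableOn (fun x => (a 0 x)⁻¹ * ‖(Ψ₁ - Ψ₂).grad t x‖ ^ 2 +
        (‖flux α a x (p₁.grad t x)‖ * ‖(Ψ₁ - Ψ₂).grad t x‖ +
        ‖flux α a x (p₂.grad t x)‖ * ‖(Ψ₁ - Ψ₂).grad t x‖)) U := iΦ.add l₁₂
    rw [dissipation, ← integral_const_mul, ← integral_sub j₁ j₂, ← integral_add l₁ l₂,
      ← integral_add iΦ l₁₂, ← integral_add j₁₂ l₃]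
    refine integral_mono_ae (hdiss.const_mul _) (j₁₂.add l₃) ?_
    filter_upwards [ae_restrict_mem hU] with x hx
    have hmono := inner_flux_sub_ge hα ha hx (p₁.grad t x) (p₂.grad t x)
    have hsq := K_max_mul_diff_sq_le hα ha hx (p₁.grad t x) (p₂.grad t x) ((Ψ₁ - Ψ₂).grad t x)
    have i₁ := real_inner_le_norm (flux α a x (p₁.grad t x)) ((Ψ₁ - Ψ₂).grad t x)
    have i₂ := (abs_le.1 (abs_real_inner_le_norm (flux α a x (p₂.grad t x))
      ((Ψ₁ - Ψ₂).grad t x))).1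
    rw [grad_diff_eq]
    have e : inner ℝ (flux α a x (p₁.grad t x) - flux α a x (p₂.grad t x))
        (p₁.grad t x - p₂.grad t x) =
        inner ℝ (flux α a x (p₁.grad t x)) (p₁.grad t x - p₂.grad t x - (Ψ₁ - Ψ₂).grad t x) -
        inner ℝ (flux α a x (p₂.grad t x)) (p₁.grad t x - p₂.grad t x - (Ψ₁ - Ψ₂).grad t x) +
        (inner ℝ (flux α a x (p₁.grad t x)) ((Ψ₁ - Ψ₂).grad t x) -
          inner ℝ (flux α a x (p₂.grad t x)) ((Ψ₁ - Ψ₂).grad t x)) := by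
      simp only [inner_sub_left, inner_sub_right]
      ring
    have h0 : 0 ≤ (a 0 x)⁻¹ * ‖(Ψ₁ - Ψ₂).grad t x‖ ^ 2 := by
      have := ha.coeff_zero_pos x hx
      positivity
    have hsq' := mul_le_mul_of_nonneg_left hsq (show 0 ≤ (1 - expo α) / 2 by linarith)
    have h0' : (1 - expo α) * ((a 0 x)⁻¹ * ‖(Ψ₁ - Ψ₂).grad t x‖ ^ 2) ≤
        (a 0 x)⁻¹ * ‖(Ψ₁ - Ψ₂).grad t x‖ ^ 2 :=
      mul_le_of_le_one_left h0 (by linarith)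
    linarith
  rw [weakForm] at w₁ w₂
  rw [hsplit]
  linarith

/-- The weighted Poincaré–Sobolev inequality bounds the `L²_φ` norm of the difference by the
dissipation, after an application of Hölder's inequality with `W₁_mul_rpow_le`. -/
theorem sq_diff_le_dissipation (hU : MeasurableSet U) (hα : IsExponents α) (ha : IsMedium U φ a)
    (hΨ₁ : IsBoundaryData U φ α a Ψ₁) (h₁ : IsSolution U φ α a Ψ₁ p₁)
    (hΨ₂ : IsBoundaryData U φ α a Ψ₂) (h₂ : IsSolution U φ α a Ψ₂ p₂) (ht : 0 ≤ t)
    {cP Q : ℝ} (hcP : 0 < cP) (hQ : 0 < Q)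
    (hP : PoincareSobolev U φ α a cP (((p₁ - Ψ₁) - (p₂ - Ψ₂)).val t)
      (((p₁ - Ψ₁) - (p₂ - Ψ₂)).grad t))
    (hle : (∫ x in U, a (Fin.last N) x) + ((∫ x in U, H α a x ‖p₁.grad t x‖)
      + ∫ x in U, H α a x ‖p₂.grad t x‖) ≤ Q) :
    ∫ x in U, sqDensity φ x (((p₁ - Ψ₁) - (p₂ - Ψ₂)).val t x) ≤
      cP ^ 2 * Q ^ (expo α / (2 - expo α)) * dissipation U α a Ψ₁ p₁ Ψ₂ p₂ t := by
  have he0 := expo_pos hα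
  have he1 := expo_lt_one hα
  have hmem := ae_restrict_mem (μ := volume) hU
  have hdiss := integrable_dissipation hU hα ha hΨ₁ h₁ hΨ₂ h₂ ht
  have hX0 : 0 ≤ dissipation U α a Ψ₁ p₁ Ψ₂ p₂ t := setIntegral_nonneg hU fun x hx => by
    have := K_pos hα ha hx ((norm_nonneg (p₁.grad t x)).trans (le_max_left _ ‖p₂.grad t x‖))
    positivity
  have i₁ := h₁.integrable_H t ht
  have i₂ := h₂.integrable_H t ht
  have i₁₂ : IntegrableOn (fun x => H α a x ‖p₁.grad t x‖ + H α a x ‖p₂.grad t x‖) U := i₁.add i₂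
  have i₃ := ha.coeff_last_integrable
  set c := cP ^ 2 * Q ^ (expo α / (2 - expo α)) with hc
  have hc0 : 0 < c := by positivity
  set y := ∫ x in U, sqDensity φ x (((p₁ - Ψ₁) - (p₂ - Ψ₂)).val t x) with hy
  have hy0 : 0 ≤ y := (isModular_sq hU hα ha).integral_nonneg _
  have key : ∀ X, dissipation U α a Ψ₁ p₁ Ψ₂ p₂ t ≤ X → 0 < X → y ≤ c * X := by
    intro X hX hX'
    have hh := integral_le_rpow_mul_rpow (μ := volume.restrict U) (θ := (2 - expo α) / 2)
      (h := fun x => W₁ α a x * |‖((p₁ - Ψ₁) - (p₂ - Ψ₂)).grad t x‖| ^ (2 - expo α))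
      (g := fun x => a (Fin.last N) x + (H α a x ‖p₁.grad t x‖ + H α a x ‖p₂.grad t x‖))
      (by linarith) (by linarith) hX' hQ hdiss (i₃.add i₁₂) ?_ ?_ hX ?_ ?_ ?_
    · rw [PoincareSobolev, weightedNorm_two, weightedNorm, ← hy] at hP
      have hI0 : 0 ≤ ∫ x in U, W₁ α a x *
          |‖((p₁ - Ψ₁) - (p₂ - Ψ₂)).grad t x‖| ^ (2 - expo α) :=
        setIntegral_nonneg hU fun x hx => by
          have := W₁_nonneg (α := α) ha hx
          positivity
      have h3 : √y ≤ cP * (X ^ ((2 - expo α) / 2) * Q ^ (1 - (2 - expo α) / 2)) ^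
          (1 / (2 - expo α)) := by
        refine hP.trans ?_
        have : 0 ≤ 1 / (2 - expo α) := by
          have : 0 < 2 - expo α := by linarith
          positivity
        gcongr
      have hq : 2 - expo α ≠ 0 := by linarith
      calc y = √y ^ 2 := (Real.sq_sqrt hy0).symm
        _ ≤ (cP * (X ^ ((2 - expo α) / 2) * Q ^ (1 - (2 - expo α) / 2)) ^
            (1 / (2 - expo α))) ^ 2 := by gcongr
        _ = c * X := by
          rw [hc, mul_pow, ← Real.rpow_natCast (_ ^ (1 / (2 - expo α))) 2,
            ← Real.rpow_mul (by positivity), Real.mul_rpow (by positivity) (by positivity),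
            ← Real.rpow_mul hX'.le, ← Real.rpow_mul hQ.le]
          have e1 : (2 - expo α) / 2 * (1 / (2 - expo α) * ((2 : ℕ) : ℝ)) = 1 := by
            push_cast; field_simp
          have e2 : (1 - (2 - expo α) / 2) * (1 / (2 - expo α) * ((2 : ℕ) : ℝ))
              = expo α / (2 - expo α) := by
            push_cast; field_simp; ring
          rw [e1, e2, Real.rpow_one]
          ring
    · filter_upwards [hmem] with x hx
      have := K_pos hα ha hx ((norm_nonneg (p₁.grad t x)).trans (le_max_left _ ‖p₂.grad t x‖))
      positivity
    · filter_upwards [hmem] with x hx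
      have := ha.coeff_last_pos x hx
      have := H_nonneg hα ha hx (norm_nonneg (p₁.grad t x))
      have := H_nonneg hα ha hx (norm_nonneg (p₂.grad t x))
      positivity
    · rw [integral_add i₃ i₁₂, integral_add i₁ i₂]
      exact hle
    · filter_upwards [hmem] with x hx
      have := W₁_nonneg (α := α) ha hx
      positivity
    · filter_upwards [hmem] with x hx
      have hm : 0 ≤ max ‖p₁.grad t x‖ ‖p₂.grad t x‖ := (norm_nonneg _).trans (le_max_left _ _)
      have hK := K_pos hα ha hx hm
      have hA := ha.coeff_last_pos x hx
      have hH₁ := H_nonneg hα ha hx (norm_nonneg (p₁.grad t x))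
      have hH₂ := H_nonneg hα ha hx (norm_nonneg (p₂.grad t x))
      rw [abs_norm]
      refine (W₁_mul_rpow_le hα ha hx hm (norm_nonneg _)).trans ?_
      refine mul_le_mul_of_nonneg_left ?_ (by positivity)
      refine Real.rpow_le_rpow (by positivity) ?_ (by linarith)
      have h4 := le_H hα ha hx hm
      have : H α a x (max ‖p₁.grad t x‖ ‖p₂.grad t x‖) ≤
          H α a x ‖p₁.grad t x‖ + H α a x ‖p₂.grad t x‖ := by
        rcases max_choice ‖p₁.grad t x‖ ‖p₂.grad t x‖ with h | h <;> rw [h] <;> linarith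
      linarith
  refine le_of_forall_pos_le_add fun ε hε => ?_
  have := key (dissipation U α a Ψ₁ p₁ Ψ₂ p₂ t + ε / c)
    (by have : 0 < ε / c := by positivity
        linarith) (by positivity)
  calc y ≤ _ := this
    _ = _ := by field_simp

end

/-! ### The function `𝓜₁` -/

section

variable {n N : ℕ} {α : Fin (N + 1) → ℝ} {U : Set (Space n)} {φ : Space n → ℝ}
  {a : Fin (N + 1) → Space n → ℝ} {p Ψ : Fin 2 → Evolution n} {M : Fin 2 → ℝ → ℝ} {t : ℝ}

theorem G₁_nonneg (hU : MeasurableSet U) (ha : IsMedium U φ a) (Ψ : Evolution n) (t : ℝ) :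
    0 ≤ G₁ U a Ψ t :=
  setIntegral_nonneg hU fun x hx => by
    have := ha.coeff_zero_pos x hx
    positivity

theorem totalEnergy_nonneg (hU : MeasurableSet U) (hα : IsExponents α) (ha : IsMedium U φ a)
    (Ψ p : Evolution n) (t : ℝ) : 0 ≤ totalEnergy U φ α a Ψ p t :=
  add_nonneg ((isModular_sq hU hα ha).integral_nonneg _)
    ((isModular_grad hU hα ha).integral_nonneg _)

theorem bigM₁_eq (U : Set (Space n)) (φ : Space n → ℝ) (α : Fin (N + 1) → ℝ)
    (a : Fin (N + 1) → Space n → ℝ) (p Ψ : Fin 2 → Evolution n) (M : Fin 2 → ℝ → ℝ) (t : ℝ) :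
    bigM₁ U φ α a p Ψ M t =
      (∑ i, totalEnergy U φ α a (Ψ i) (p i) 0) + (∑ i, M i t) ^ (2 / (2 - expo α)) +
        sSup ((fun τ => ∑ i, G₁ U a (Ψ i) τ) '' Icc 0 t) := by
  unfold bigM₁ totalEnergy
  simp only [integral_dt_sq_eq, Finset.sum_add_distrib]
  ring

theorem continuousOn_sum_G₁ (hΨ : ∀ i, IsBoundaryData U φ α a (Ψ i)) :
    ContinuousOn (fun τ => ∑ i, G₁ U a (Ψ i) τ) (Ici 0) :=
  continuousOn_finsetSum _ fun i _ => (hΨ i).continuousOn_G₁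

theorem bddAbove_sum_G₁ (hΨ : ∀ i, IsBoundaryData U φ α a (Ψ i)) (t : ℝ) :
    BddAbove ((fun τ => ∑ i, G₁ U a (Ψ i) τ) '' Icc 0 t) :=
  (isCompact_Icc.image_of_continuousOn
    ((continuousOn_sum_G₁ hΨ).mono Icc_subset_Ici_self)).bddAbove

theorem one_le_majorant (hU : MeasurableSet U) (hα : IsExponents α) (ha : IsMedium U φ a)
    (hM : ∀ i, IsMajorant U φ α a (Ψ i) (M i)) (ht : 0 ≤ t) (i : Fin 2) : 1 ≤ M i t :=
  (data_le_G hU hα ha (Ψ i) t).1.trans ((hM i).le t ht)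

theorem one_le_sum_majorant (hU : MeasurableSet U) (hα : IsExponents α) (ha : IsMedium U φ a)
    (hM : ∀ i, IsMajorant U φ α a (Ψ i) (M i)) (ht : 0 ≤ t) : 1 ≤ ∑ i, M i t := by
  rw [Fin.sum_univ_two]
  linarith [one_le_majorant hU hα ha hM ht 0, one_le_majorant hU hα ha hM ht 1]

theorem sum_majorant_le (hU : MeasurableSet U) (hα : IsExponents α) (ha : IsMedium U φ a)
    (hΨ : ∀ i, IsBoundaryData U φ α a (Ψ i)) (hM : ∀ i, IsMajorant U φ α a (Ψ i) (M i))
    (ht : 0 ≤ t) : ∑ i, M i t ≤ bigM₁ U φ α a p Ψ M t := by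
  have he0 := expo_pos hα
  have he1 := expo_lt_one hα
  have hq : 1 ≤ 2 / (2 - expo α) := by
    rw [le_div_iff₀ (by linarith)]; linarith
  have h1 := Real.self_le_rpow_of_one_le (one_le_sum_majorant hU hα ha hM ht) hq
  have h2 : 0 ≤ ∑ i, totalEnergy U φ α a (Ψ i) (p i) 0 :=
    Finset.sum_nonneg fun i _ => totalEnergy_nonneg hU hα ha _ _ _
  have h3 : 0 ≤ sSup ((fun τ => ∑ i, G₁ U a (Ψ i) τ) '' Icc 0 t) :=
    le_csSup_of_le (bddAbove_sum_G₁ hΨ t) (mem_image_of_mem _ ⟨le_rfl, ht⟩)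
      (Finset.sum_nonneg fun i _ => G₁_nonneg hU ha _ _)
  rw [bigM₁_eq]
  linarith

theorem one_le_bigM₁ (hU : MeasurableSet U) (hα : IsExponents α) (ha : IsMedium U φ a)
    (hΨ : ∀ i, IsBoundaryData U φ α a (Ψ i)) (hM : ∀ i, IsMajorant U φ α a (Ψ i) (M i))
    (ht : 0 ≤ t) : 1 ≤ bigM₁ U φ α a p Ψ M t :=
  (one_le_sum_majorant hU hα ha hM ht).trans (sum_majorant_le hU hα ha hΨ hM ht)

theorem continuousOn_bigM₁ (hU : MeasurableSet U) (hα : IsExponents α) (ha : IsMedium U φ a)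
    (hΨ : ∀ i, IsBoundaryData U φ α a (Ψ i)) (hM : ∀ i, IsMajorant U φ α a (Ψ i) (M i)) :
    ContinuousOn (bigM₁ U φ α a p Ψ M) (Ici 0) := by
  unfold bigM₁
  refine (continuousOn_const.add ?_).add (continuousOn_sSup_image_Icc (continuousOn_sum_G₁ hΨ))
  refine (continuousOn_finsetSum _ fun i _ => (hM i).continuousOn).rpow_const fun t ht => Or.inl ?_
  linarith [one_le_sum_majorant hU hα ha hM ht]

theorem monotoneOn_bigM₁ (hU : MeasurableSet U) (hα : IsExponents α) (ha : IsMedium U φ a)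
    (hΨ : ∀ i, IsBoundaryData U φ α a (Ψ i)) (hM : ∀ i, IsMajorant U φ α a (Ψ i) (M i)) :
    MonotoneOn (bigM₁ U φ α a p Ψ M) (Ici 0) := by
  intro s hs t ht hst
  have he1 := expo_lt_one hα
  have h1 : 1 ≤ ∑ i, M i s := one_le_sum_majorant hU hα ha hM hs
  have h2 : (∑ i, M i s) ^ (2 / (2 - expo α)) ≤ (∑ i, M i t) ^ (2 / (2 - expo α)) :=
    Real.rpow_le_rpow (by linarith) (Finset.sum_le_sum fun i _ => (hM i).monotoneOn hs ht hst)
      (div_nonneg zero_le_two (by linarith))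
  have h3 : sSup ((fun τ => ∑ i, G₁ U a (Ψ i) τ) '' Icc 0 s) ≤
      sSup ((fun τ => ∑ i, G₁ U a (Ψ i) τ) '' Icc 0 t) :=
    csSup_le_csSup (bddAbove_sum_G₁ hΨ t) ((nonempty_Icc.2 hs).image _)
      (image_mono (Icc_subset_Icc_right hst))
  unfold bigM₁
  linarith

/-- `𝓜₁` dominates the quantities that enter the a priori bound of either solution. -/
theorem data_le_bigM₁ (hU : MeasurableSet U) (hα : IsExponents α) (ha : IsMedium U φ a)
    (hM : ∀ i, IsMajorant U φ α a (Ψ i) (M i)) (ht : 0 ≤ t) (i : Fin 2) :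
    totalEnergy U φ α a (Ψ i) (p i) 0 + M i t ^ (2 / (2 - expo α)) +
      sSup ((fun τ => ∑ i, G₁ U a (Ψ i) τ) '' Icc 0 t) ≤ bigM₁ U φ α a p Ψ M t := by
  have he1 := expo_lt_one hα
  have h1 : totalEnergy U φ α a (Ψ i) (p i) 0 ≤ ∑ i, totalEnergy U φ α a (Ψ i) (p i) 0 :=
    Finset.single_le_sum (f := fun i => totalEnergy U φ α a (Ψ i) (p i) 0)
      (fun i _ => totalEnergy_nonneg hU hα ha _ _ _) (Finset.mem_univ i)
  have h2 : M i t ≤ ∑ i, M i t :=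
    Finset.single_le_sum (f := fun i => M i t)
      (fun i _ => zero_le_one.trans (one_le_majorant hU hα ha hM ht i)) (Finset.mem_univ i)
  have h3 : M i t ^ (2 / (2 - expo α)) ≤ (∑ i, M i t) ^ (2 / (2 - expo α)) :=
    Real.rpow_le_rpow (zero_le_one.trans (one_le_majorant hU hα ha hM ht i)) h2
      (div_nonneg zero_le_two (by linarith))
  rw [bigM₁_eq]
  linarith

/-- The a priori bounds for both solutions in terms of `𝓜₁`. -/
theorem exists_totalEnergy_le_bigM₁ (hα : IsExponents α) {cP : ℝ} (hcP : 0 < cP) :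
    ∃ C > 0, ∀ {n : ℕ} {U : Set (Space n)} {φ : Space n → ℝ} {a : Fin (N + 1) → Space n → ℝ}
      {p Ψ : Fin 2 → Evolution n} {M : Fin 2 → ℝ → ℝ}, MeasurableSet U → IsMedium U φ a →
      (∀ i, IsBoundaryData U φ α a (Ψ i)) → (∀ i, IsSolution U φ α a (Ψ i) (p i)) →
      (∀ i, IsMajorant U φ α a (Ψ i) (M i)) →
      (∀ i, ∀ t, 0 < t →
        PoincareSobolev U φ α a cP ((p i - Ψ i).val t) ((p i - Ψ i).grad t)) →
      ∀ i, ∀ t, 0 ≤ t → totalEnergy U φ α a (Ψ i) (p i) t ≤ C * bigM₁ U φ α a p Ψ M t := by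
  obtain ⟨C, hC, h⟩ := exists_totalEnergy_le hα hcP
  refine ⟨C, hC, ?_⟩
  intro n U φ a p Ψ M hU ha hΨ hs hM hP i t ht
  refine (h hU ha (hΨ i) (hs i) (hP i) t (M i t)
    (sSup ((fun τ => ∑ i, G₁ U a (Ψ i) τ) '' Icc 0 t)) (fun s hst => ?_) (fun s hst => ?_)
    t ⟨ht, le_rfl⟩).trans (mul_le_mul_of_nonneg_left (data_le_bigM₁ hU hα ha hM ht i) hC.le)
  · exact ((hM i).le s hst.1).trans ((hM i).monotoneOn hst.1 ht hst.2)
  · refine le_trans ?_ (le_csSup (bddAbove_sum_G₁ hΨ t) (mem_image_of_mem _ hst))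
    exact Finset.single_le_sum (f := fun i => G₁ U a (Ψ i) s)
      (fun i _ => G₁_nonneg hU ha _ _) (Finset.mem_univ i)

/-! ### The differential inequality for the difference -/

theorem D_eq (U : Set (Space n)) (φ : Space n → ℝ) (a : Fin (N + 1) → Space n → ℝ)
    (Φ : Evolution n) (t : ℝ) :
    D U φ a Φ t = (∫ x in U, (a 0 x)⁻¹ * ‖Φ.grad t x‖ ^ 2)
      + √(∫ x in U, (a 0 x)⁻¹ * ‖Φ.grad t x‖ ^ 2) + √(∫ x in U, sqDensity φ x (Φ.dt t x)) := by
  rw [D, integral_dt_sq_eq, Real.sqrt_eq_rpow, Real.sqrt_eq_rpow]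

theorem D_nonneg (hU : MeasurableSet U) (ha : IsMedium U φ a) (Φ : Evolution n) (t : ℝ) :
    0 ≤ D U φ a Φ t := by
  have : 0 ≤ ∫ x in U, (a 0 x)⁻¹ * ‖Φ.grad t x‖ ^ 2 := setIntegral_nonneg hU fun x hx => by
    have := ha.coeff_zero_pos x hx
    positivity
  rw [D_eq]
  positivity

/-- The squared norm of the difference satisfies a linear differential inequality with damping
coefficient `d 𝓜₁^{-a/(2-a)}` and source `C 𝓜₁^{1/2} D`. -/
theorem exists_deriv_sq_diff_le (hα : IsExponents α) {cP : ℝ} (hcP : 0 < cP) :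
    ∃ C > 0, ∃ d > 0, ∀ {n : ℕ} {U : Set (Space n)} {φ : Space n → ℝ}
      {a : Fin (N + 1) → Space n → ℝ} {p Ψ : Fin 2 → Evolution n} {M : Fin 2 → ℝ → ℝ},
      MeasurableSet U → IsMedium U φ a →
      (∀ i, IsBoundaryData U φ α a (Ψ i)) → (∀ i, IsSolution U φ α a (Ψ i) (p i)) →
      (∀ i, IsMajorant U φ α a (Ψ i) (M i)) →
      (∀ i, ∀ t, 0 < t →
        PoincareSobolev U φ α a cP ((p i - Ψ i).val t) ((p i - Ψ i).grad t)) →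
      (∀ t, 0 < t → PoincareSobolev U φ α a cP (((p 0 - Ψ 0) - (p 1 - Ψ 1)).val t)
        (((p 0 - Ψ 0) - (p 1 - Ψ 1)).grad t)) →
      ∀ t, 0 < t → ∃ y', HasDerivAt
        (fun s => ∫ x in U, sqDensity φ x (((p 0 - Ψ 0) - (p 1 - Ψ 1)).val s x)) y' t ∧
        y' ≤ -(d * bigM₁ U φ α a p Ψ M t ^ (-(expo α / (2 - expo α))) *
            ∫ x in U, sqDensity φ x (((p 0 - Ψ 0) - (p 1 - Ψ 1)).val t x)) +
          C * (bigM₁ U φ α a p Ψ M t ^ (1 / 2 : ℝ) * D U φ a (Ψ 0 - Ψ 1) t) := by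
  have he0 := expo_pos hα
  have he1 := expo_lt_one hα
  obtain ⟨C₁, hC₁, hbound⟩ := exists_totalEnergy_le_bigM₁ hα hcP
  set r := expo α / (2 - expo α) with hr
  have hr0 : 0 < r := div_pos he0 (by linarith)
  set c := cP ^ 2 * (1 + 2 * C₁) ^ r with hc
  have hc0 : 0 < c := by positivity
  refine ⟨2 + 12 * √C₁, by positivity, (1 - expo α) / c, div_pos (by linarith) hc0, ?_⟩
  intro n U φ a p Ψ M hU ha hΨ hs hM hP hP' t ht
  refine ⟨_, hasDerivAt_sq_diff hU hα ha (hΨ 0) (hs 0) (hΨ 1) (hs 1) ht,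
    (deriv_sq_diff_le hU hα ha (hΨ 0) (hs 0) (hΨ 1) (hs 1) ht).trans ?_⟩
  set m := bigM₁ U φ α a p Ψ M t with hm
  have hm1 : 1 ≤ m := one_le_bigM₁ hU hα ha hΨ hM ht.le
  have hb := fun i => hbound hU ha hΨ hs hM hP i t ht.le
  have hy : ∀ i, ∫ x in U, sqDensity φ x ((p i - Ψ i).val t x) ≤ C₁ * m := fun i => by
    have := (isModular_grad hU hα ha).integral_nonneg ((p i).grad t)
    have := hb i
    unfold totalEnergy at this
    linarith
  have hE : ∀ i, ∫ x in U, H α a x ‖(p i).grad t x‖ ≤ C₁ * m := fun i => by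
    have := (isModular_sq hU hα ha).integral_nonneg ((p i - Ψ i).val t)
    have := hb i
    unfold totalEnergy at this
    linarith
  have hz : ∫ x in U, sqDensity φ x (((p 0 - Ψ 0) - (p 1 - Ψ 1)).val t x) ≤
      4 ^ 2 * (C₁ * m) := by
    have := (isModular_sq hU hα ha).integral_sub_le
      ((hs 0).finite_bar hU hα ha (hΨ 0) ht.le).val ((hs 1).finite_bar hU hα ha (hΨ 1) ht.le).val
    refine this.trans ?_
    linarith [hy 0, hy 1]
  have haN : ∫ x in U, a (Fin.last N) x ≤ m := by
    have h1 := integral_coeff_last_le_Bstar (U := U) (a := a)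
    obtain ⟨g1, g2, g3⟩ := G_terms_nonneg (α := α) hU ha (Ψ 0) t
    have h2 := (hM 0).le t ht.le
    have h3 := sum_majorant_le (p := p) hU hα ha hΨ hM ht.le
    have h4 := one_le_majorant hU hα ha hM ht.le 1
    rw [Fin.sum_univ_two] at h3
    have : 0 ≤ (∫ x in U, (Ψ 0).dt t x ^ 2 * φ x) ^ ((2 - expo α) / (2 * (1 - expo α))) := by
      positivity
    unfold G at h2
    linarith
  have hdiss := sq_diff_le_dissipation hU hα ha (hΨ 0) (hs 0) (hΨ 1) (hs 1) ht.le hcP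
    (Q := (1 + 2 * C₁) * m) (by positivity) (hP' t ht) (by linarith [hE 0, hE 1])
  set y := ∫ x in U, sqDensity φ x (((p 0 - Ψ 0) - (p 1 - Ψ 1)).val t x)
  set X := dissipation U α a (Ψ 0) (p 0) (Ψ 1) (p 1) t
  have hdamp : (1 - expo α) / c * m ^ (-r) * y ≤ (1 - expo α) * X := by
    have hmr : 0 < m ^ r := by positivity
    rw [Real.mul_rpow (by positivity) (by positivity)] at hdiss
    have h1 : y ≤ c * m ^ r * X := by rw [hc]; linarith
    rw [Real.rpow_neg (by positivity)]
    have h2 : 0 ≤ (1 - expo α) / c * (m ^ r)⁻¹ := by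
      have : 0 ≤ 1 - expo α := by linarith
      positivity
    calc (1 - expo α) / c * (m ^ r)⁻¹ * y
        ≤ (1 - expo α) / c * (m ^ r)⁻¹ * (c * m ^ r * X) := by gcongr
      _ = (1 - expo α) * X := by field_simp
  rw [← Real.sqrt_eq_rpow, D_eq]
  have hD0 : 0 ≤ ∫ x in U, (a 0 x)⁻¹ * ‖(Ψ 0 - Ψ 1).grad t x‖ ^ 2 :=
    setIntegral_nonneg hU fun x hx => by
      have := ha.coeff_zero_pos x hx
      positivity
  set D₁ := ∫ x in U, (a 0 x)⁻¹ * ‖(Ψ 0 - Ψ 1).grad t x‖ ^ 2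
  set w := √(∫ x in U, sqDensity φ x ((Ψ 0 - Ψ 1).dt t x))
  have hw0 : 0 ≤ w := Real.sqrt_nonneg _
  have hsm : 1 ≤ √m := Real.one_le_sqrt.2 hm1
  have hsE : ∀ i, √(∫ x in U, H α a x ‖(p i).grad t x‖) ≤ √C₁ * √m := fun i => by
    rw [← Real.sqrt_mul hC₁.le]
    exact Real.sqrt_le_sqrt (hE i)
  have hsy : √y ≤ 4 * (√C₁ * √m) := by
    rw [← Real.sqrt_mul hC₁.le]
    refine (Real.sqrt_le_sqrt hz).trans (le_of_eq ?_)
    rw [Real.sqrt_mul (by norm_num), Real.sqrt_sq (by norm_num)]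
  have t1 : 2 * D₁ ≤ (2 + 12 * √C₁) * (√m * D₁) := by
    have h1 : D₁ ≤ √m * D₁ := le_mul_of_one_le_left hD0 hsm
    have h2 : 0 ≤ √C₁ * (√m * D₁) := by positivity
    linarith
  have t2 : 2 * ((√(∫ x in U, H α a x ‖(p 0).grad t x‖) +
      √(∫ x in U, H α a x ‖(p 1).grad t x‖)) * √D₁) ≤ (2 + 12 * √C₁) * (√m * √D₁) := by
    have h1 := mul_le_mul_of_nonneg_right (add_le_add (hsE 0) (hsE 1)) (Real.sqrt_nonneg D₁)
    have h2 : 0 ≤ √C₁ * (√m * √D₁) := by positivity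
    have h3 : 0 ≤ √m * √D₁ := by positivity
    linarith
  have t3 : 2 * (√y * w) ≤ (2 + 12 * √C₁) * (√m * w) := by
    have h1 := mul_le_mul_of_nonneg_right hsy hw0
    have h2 : 0 ≤ √C₁ * (√m * w) := by positivity
    have h3 : 0 ≤ √m * w := by positivity
    linarith
  linarith

end

end Forchheimer

theorem mainTheorem2 {n N : ℕ} (hn : 2 ≤ n)
    (U : Set (Forchheimer.Space n)) (hU : Forchheimer.IsBoundedC1Domain U)
    (α : Fin (N + 1) → ℝ) (hα : Forchheimer.IsExponents α) (cP : ℝ) (hcP : 0 < cP) :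
    ∃ C > 0, ∃ d₄ > 0,
      ∀ (φ : Forchheimer.Space n → ℝ) (a : Fin (N + 1) → Forchheimer.Space n → ℝ),
      Forchheimer.IsMedium U φ a →
      ∀ (p Ψ : Fin 2 → Forchheimer.Evolution n) (M : Fin 2 → ℝ → ℝ),
      (∀ i, Forchheimer.IsBoundaryData U φ α a (Ψ i)) →
      (∀ i, Forchheimer.IsSolution U φ α a (Ψ i) (p i)) →
      (∀ i, Forchheimer.IsMajorant U φ α a (Ψ i) (M i)) →
      ContinuousOn (Forchheimer.D U φ a (Ψ 0 - Ψ 1)) (Set.Ici 0) →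
      (∀ t, 0 < t → ∀ u ∈ ({p 0 - Ψ 0, p 1 - Ψ 1, (p 0 - Ψ 0) - (p 1 - Ψ 1)} :
          Set (Forchheimer.Evolution n)),
        Forchheimer.PoincareSobolev U φ α a cP (u.val t) (u.grad t)) →
      (∀ t, 0 ≤ t →
        Forchheimer.weightedNorm U φ 2 (((p 0 - Ψ 0) - (p 1 - Ψ 1)).val t) ^ 2 ≤
          Real.exp (-d₄ * ∫ τ in (0 : ℝ)..t, Forchheimer.bigM₁ U φ α a p Ψ M τ ^
              (-(Forchheimer.expo α / (2 - Forchheimer.expo α)))) *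
            Forchheimer.weightedNorm U φ 2 (((p 0 - Ψ 0) - (p 1 - Ψ 1)).val 0) ^ 2 +
          C * ∫ s in (0 : ℝ)..t,
            Real.exp (-d₄ * ∫ τ in s..t, Forchheimer.bigM₁ U φ α a p Ψ M τ ^
              (-(Forchheimer.expo α / (2 - Forchheimer.expo α)))) *
            Forchheimer.bigM₁ U φ α a p Ψ M s ^ (1 / 2 : ℝ) *
            Forchheimer.D U φ a (Ψ 0 - Ψ 1) s) ∧
      (∀ T, 0 < T →
        BddAbove ((fun t => Forchheimer.weightedNorm U φ 2
          (((p 0 - Ψ 0) - (p 1 - Ψ 1)).val t) ^ 2) '' Set.Icc 0 T) ∧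
        sSup ((fun t => Forchheimer.weightedNorm U φ 2
          (((p 0 - Ψ 0) - (p 1 - Ψ 1)).val t) ^ 2) '' Set.Icc 0 T) ≤
          Forchheimer.weightedNorm U φ 2 (((p 0 - Ψ 0) - (p 1 - Ψ 1)).val 0) ^ 2 +
          C * Forchheimer.bigM₁ U φ α a p Ψ M T ^ (1 / 2 : ℝ) *
            ∫ t in (0 : ℝ)..T, Forchheimer.D U φ a (Ψ 0 - Ψ 1) t) := by
  have he0 := Forchheimer.expo_pos hα
  have he1 := Forchheimer.expo_lt_one hα
  have hUm : MeasurableSet U := hU.isOpen.measurableSet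
  obtain ⟨C, hC, d, hd, hder⟩ := Forchheimer.exists_deriv_sq_diff_le hα hcP
  refine ⟨C, hC, d, hd, ?_⟩
  intro φ a ha p Ψ M hΨ hs hM hDc hP
  set m := Forchheimer.bigM₁ U φ α a p Ψ M with hm
  set r := Forchheimer.expo α / (2 - Forchheimer.expo α) with hr
  have hm1 : ∀ t, 0 ≤ t → 1 ≤ m t := fun t ht => Forchheimer.one_le_bigM₁ hUm hα ha hΨ hM ht
  have hmc : ContinuousOn m (Set.Ici 0) := Forchheimer.continuousOn_bigM₁ hUm hα ha hΨ hM
  have hmm : MonotoneOn m (Set.Ici 0) := Forchheimer.monotoneOn_bigM₁ hUm hα ha hΨ hM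
  have hD0 : ∀ t, 0 ≤ Forchheimer.D U φ a (Ψ 0 - Ψ 1) t := Forchheimer.D_nonneg hUm ha _
  have hbc : ContinuousOn (fun t => d * m t ^ (-r)) (Set.Ici 0) :=
    continuousOn_const.mul (hmc.rpow_const fun t ht => Or.inl (by linarith [hm1 t ht]))
  have hsc : ContinuousOn
      (fun t => C * (m t ^ (1 / 2 : ℝ) * Forchheimer.D U φ a (Ψ 0 - Ψ 1) t)) (Set.Ici 0) :=
    continuousOn_const.mul
      ((hmc.rpow_const fun t ht => Or.inl (by linarith [hm1 t ht])).mul hDc)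
  have hP0 : ∀ i, ∀ t, 0 < t → Forchheimer.PoincareSobolev U φ α a cP
      ((p i - Ψ i).val t) ((p i - Ψ i).grad t) := by
    intro i t ht
    fin_cases i
    · exact hP t ht _ (by simp)
    · exact hP t ht _ (by simp)
  have hP1 : ∀ t, 0 < t → Forchheimer.PoincareSobolev U φ α a cP
      (((p 0 - Ψ 0) - (p 1 - Ψ 1)).val t) (((p 0 - Ψ 0) - (p 1 - Ψ 1)).grad t) :=
    fun t ht => hP t ht _ (by simp)
  have main : ∀ t, 0 ≤ t →
      Forchheimer.weightedNorm U φ 2 (((p 0 - Ψ 0) - (p 1 - Ψ 1)).val t) ^ 2 ≤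
        Real.exp (-d * ∫ τ in (0 : ℝ)..t, m τ ^ (-r)) *
          Forchheimer.weightedNorm U φ 2 (((p 0 - Ψ 0) - (p 1 - Ψ 1)).val 0) ^ 2 +
        C * ∫ s in (0 : ℝ)..t, Real.exp (-d * ∫ τ in s..t, m τ ^ (-r)) *
          m s ^ (1 / 2 : ℝ) * Forchheimer.D U φ a (Ψ 0 - Ψ 1) s := by
    intro t ht
    have h := Forchheimer.gronwall_of_deriv_le
      (Forchheimer.continuousOn_sq_diff hUm hα ha (hΨ 0) (hs 0) (hΨ 1) (hs 1)) hbc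
      hsc (hder hUm ha hΨ hs hM hP0 hP1) ht
    have e : ∫ s in (0 : ℝ)..t, Real.exp (-∫ τ in s..t, d * m τ ^ (-r)) *
        (C * (m s ^ (1 / 2 : ℝ) * Forchheimer.D U φ a (Ψ 0 - Ψ 1) s)) =
        C * ∫ s in (0 : ℝ)..t, Real.exp (-d * ∫ τ in s..t, m τ ^ (-r)) *
          m s ^ (1 / 2 : ℝ) * Forchheimer.D U φ a (Ψ 0 - Ψ 1) s := by
      rw [← intervalIntegral.integral_const_mul C]
      refine intervalIntegral.integral_congr fun s _ => ?_
      simp only [intervalIntegral.integral_const_mul d, neg_mul]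
      ring
    rw [Forchheimer.weightedNorm_two_sq hUm hα ha, Forchheimer.weightedNorm_two_sq hUm hα ha]
    rwa [e, intervalIntegral.integral_const_mul d, ← neg_mul] at h
  refine ⟨main, fun T hT => ?_⟩
  have hsup : ∀ y ∈ (fun t => Forchheimer.weightedNorm U φ 2
      (((p 0 - Ψ 0) - (p 1 - Ψ 1)).val t) ^ 2) '' Set.Icc 0 T, y ≤
      Forchheimer.weightedNorm U φ 2 (((p 0 - Ψ 0) - (p 1 - Ψ 1)).val 0) ^ 2 +
        C * m T ^ (1 / 2 : ℝ) * ∫ t in (0 : ℝ)..T, Forchheimer.D U φ a (Ψ 0 - Ψ 1) t := by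
    rintro _ ⟨t, ht, rfl⟩
    refine (main t ht.1).trans ?_
    have hdamp : ∀ s, 0 ≤ s → s ≤ t → Real.exp (-d * ∫ τ in s..t, m τ ^ (-r)) ≤ 1 := by
      intro s hs0 hst
      rw [Real.exp_le_one_iff, neg_mul, neg_nonpos]
      refine mul_nonneg hd.le (intervalIntegral.integral_nonneg hst fun τ hτ => ?_)
      exact Real.rpow_nonneg (by linarith [hm1 τ (hs0.trans hτ.1)]) _
    have hDint : ∀ b c : ℝ, 0 ≤ b → b ≤ c →
        IntervalIntegrable (Forchheimer.D U φ a (Ψ 0 - Ψ 1)) MeasureTheory.volume b c :=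
      fun b c hb hbc => (hDc.mono fun s hs' => by
        rw [Set.uIcc_of_le hbc] at hs'
        exact hb.trans hs'.1).intervalIntegrable
    have hmT : 0 ≤ m T ^ (1 / 2 : ℝ) := Real.rpow_nonneg (by linarith [hm1 T hT.le]) _
    refine add_le_add (mul_le_of_le_one_left (sq_nonneg _) (hdamp 0 le_rfl ht.1)) ?_
    rw [mul_assoc]
    refine mul_le_mul_of_nonneg_left ?_ hC.le
    calc ∫ s in (0 : ℝ)..t, Real.exp (-d * ∫ τ in s..t, m τ ^ (-r)) * m s ^ (1 / 2 : ℝ) *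
          Forchheimer.D U φ a (Ψ 0 - Ψ 1) s
        ≤ ∫ s in (0 : ℝ)..t, m T ^ (1 / 2 : ℝ) * Forchheimer.D U φ a (Ψ 0 - Ψ 1) s := by
          rw [intervalIntegral.integral_of_le ht.1, intervalIntegral.integral_of_le ht.1]
          refine MeasureTheory.integral_mono_of_nonneg ?_
            (((hDint 0 t le_rfl ht.1).const_mul _).1) ?_
          · filter_upwards [MeasureTheory.ae_restrict_mem measurableSet_Ioc] with s hs'
            have := hm1 s hs'.1.le
            have := hD0 s
            simp only [Pi.zero_apply]
            positivity
          · filter_upwards [MeasureTheory.ae_restrict_mem measurableSet_Ioc] with s hs'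
            have h1 := hm1 s hs'.1.le
            have h2 : m s ^ (1 / 2 : ℝ) ≤ m T ^ (1 / 2 : ℝ) :=
              Real.rpow_le_rpow (by linarith)
                (hmm hs'.1.le hT.le (hs'.2.trans ht.2)) (by norm_num)
            refine mul_le_mul_of_nonneg_right ?_ (hD0 s)
            calc _ ≤ 1 * m T ^ (1 / 2 : ℝ) :=
                  mul_le_mul (hdamp s hs'.1.le hs'.2) h2 (by positivity) zero_le_one
              _ = _ := one_mul _
      _ = m T ^ (1 / 2 : ℝ) * ∫ s in (0 : ℝ)..t, Forchheimer.D U φ a (Ψ 0 - Ψ 1) s :=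
          intervalIntegral.integral_const_mul _ _
      _ ≤ m T ^ (1 / 2 : ℝ) * ∫ s in (0 : ℝ)..T, Forchheimer.D U φ a (Ψ 0 - Ψ 1) s := by
          refine mul_le_mul_of_nonneg_left ?_ hmT
          exact intervalIntegral.integral_mono_interval le_rfl ht.1 ht.2
            (Filter.Eventually.of_forall hD0) (hDint 0 T le_rfl hT.le)
  exact ⟨⟨_, hsup⟩, csSup_le ((Set.nonempty_Icc.2 hT.le).image _) hsup⟩
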